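/- **Setting.** Let $T:[0,1]\to[0,1]$ satisfy (A1) (a) $T$ is continuous and attains its maximum at a unique point $\mathfrak c$, with $\Delta:=T(\mathfrak c)<1$; (b) there is an interval $[d_1,d_2]\subset[0,1]$, $d_1<d_2$, with $T([d_1,d_2])\subset[d_1,d_2]$, on which every power $T^t$, $t\ge1$, is topologically transitive, and which attracts Lebesgue-almost every initial condition: $\operatorname{dist}(T^t x,[d_1,d_2])\to0$ for a.e. $x\in[0,1]$; (c) $T$ has exactly one invariant Borel probability measure that is absolutely continuous with respect to Lebesgue measure. Put $\Gamma=1-\Delta$ and $I=[-\Gamma,1]$, and extend $T$ to $[-\Gamma,0]$ continuously and decreasingly with $T(-\Gamma)<\Delta$. Fix the noise intensity $n$. Let $a>0$ and let $\sigma=\sigma_n:I\to[0,\infty)$ be measurable, differentiable and positive on $(0,1)$, with $T(x)-a\sigma(x)>0$ for $x\in(0,1-\Gamma/2]$, and such that one of the following holds: - $T(0)=0=\sigma(0)$, $a\sigma\le\Gamma/2$ on $I$, and for some $\varepsilon_n>0$ one has $T(x)-a\sigma(x)>x$ on $(0,\varepsilon_n)$ and $T(x)-a\sigma(x)>\varepsilon_n$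 on $(\varepsilon_n,1-\Gamma/2)$; - $T(0)=q>0$ and $a\sigma\le\min\{\Gamma/2,\;q/2,\;\tfrac12T(1-\Gamma/2)\}$ on $I$. Let $\theta$ be the probability measure on $\mathbb R$ with density $g_a(y)=c_a\chi_a(y)e^{-y^2/2}$, where $\chi_a\ge0$ is $C^\infty$ and positive exactly on $(-a,a)$ and $c_a$ is the normalizing constant. Put $T_\eta(x)=T(x)+\sigma(x)\eta$, $P_x(A)=\theta\{\eta:T_\eta(x)\in A\}$ and $(\mathcal Uf)(x)=\int f(T_\eta(x))\,d\theta(\eta)$. Let $\mu_n=h_n\,dx$ be a stationary probability measure on $I$, i.e. $\int P_x(A)\,d\mu_n(x)=\mu_n(A)$ for all Borel $A$, with density $h_n\in BV(I)$. Here $BV(I)$ consists of the functions in $L^1(I)$ of finite (essential) total variation, and $\|f\|_{BV}=|f|_{TV}+\|f\|_1$. Let $g\in BV(I)$ with $\int g\,d\mu_n=0$, and on the probability space with measure $\widetilde{\mathbb P}_n=\theta^{\otimes\mathbb N}\otimes\mu_n$ let $$S_t((\eta_k)_{k\ge1},x)=\sum_{k=0}^{t-1}g\big(T_{\eta_k}\circ\cdots\circ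 T_{\eta_1}(x)\big).$$ **Theorem.** (e1) The limit $\iota^2:=\lim_{t\to\infty}\frac1t\mathbb E_{\widetilde{\mathbb P}_n}(S_t^2)$ exists (with $\iota\ge0$), the series below converges absolutely, and $$\iota^2=\int g^2\,d\mu_n+2\sum_{t=1}^\infty\int g\,(\mathcal U^tg)\,d\mu_n .$$ Suppose moreover that $\iota>0$. Then: (e2) $S_t/\sqrt t$ converges in law to $\mathcal N(0,\iota^2)$ under $\widetilde{\mathbb P}_n$. (e3) There is a non-negative function $\mathcal R:\mathbb R\to\mathbb R$, continuous, strictly convex and vanishing only at $0$, such that for every sufficiently small $\varepsilon>0$ $$\lim_{t\to\infty}\frac1t\log\widetilde{\mathbb P}_n(S_t>t\varepsilon)=-\mathcal R(\varepsilon).$$ (e4) There is $D>0$ such that for all $t\ge1$ $$\sup_{r\in\mathbb R}\Big|\widetilde{\mathbb P}_n\Big(\frac{S_t}{\sqrt t}\le r\Big)-\frac1{\iota\sqrt{2\pi}}\int_{-\infty}^re^{-u^2/(2\iota^2)}\,du\Big|\le\frac{D\,\|h_n\|_{BV}}{\sqrt t}.$$ -/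

import Mathlib

open MeasureTheory ProbabilityTheory Filter Topology Set

noncomputable section

/-! ### Functions of bounded variation, as classes modulo null sets -/

/-- Essential variation of `f` on `s`: the infimum of the pointwise variations over all functions
that agree with `f` almost everywhere on `s`. -/
def essVariationOn (f : ℝ → ℝ) (s : Set ℝ) : ENNReal :=
  ⨅ (u : ℝ → ℝ) (_ : u =ᵐ[volume.restrict s] f), eVariationOn u s

/-- `f ∈ BV(s)`: `f` is integrable on `s` and has finite essential variation there. -/
structure MemBV (f : ℝ → ℝ) (s : Set ℝ) : Prop where
  integrableOn : IntegrableOn f s volume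
  variation_ne_top : essVariationOn f s ≠ ⊤

/-- `‖f‖_BV = |f|_TV + ‖f‖₁` on `s`. -/
def bvNorm (f : ℝ → ℝ) (s : Set ℝ) : ℝ :=
  (essVariationOn f s).toReal + ∫ x in s, |f x|

/-! ### The deterministic map -/

/-- Topological transitivity of `f` on the subspace `s` (used for `s` invariant under `f`). -/
def TopTransitiveOn (f : ℝ → ℝ) (s : Set ℝ) : Prop :=
  ∀ U V : Set ℝ, IsOpen U → IsOpen V → (U ∩ s).Nonempty → (V ∩ s).Nonempty →
    ∃ k : ℕ, ∃ x ∈ V ∩ s, f^[k] x ∈ U ∩ s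

/-- The assumptions on the unperturbed map `T` of `[0,1]`, with maximum point `c` and transitive
interval `[d₁, d₂]`. -/
structure MapAssumption (T : ℝ → ℝ) (c d₁ d₂ : ℝ) : Prop where
  mapsTo : MapsTo T (Icc 0 1) (Icc 0 1)
  continuousOn : ContinuousOn T (Icc 0 1)
  c_mem : c ∈ Icc (0 : ℝ) 1
  unique_max : ∀ x ∈ Icc (0 : ℝ) 1, x ≠ c → T x < T c
  max_lt_one : T c < 1
  d_lt : d₁ < d₂
  core_subset : Icc d₁ d₂ ⊆ Icc 0 1
  core_invariant : MapsTo T (Icc d₁ d₂) (Icc d₁ d₂)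
  core_transitive : ∀ t : ℕ, 1 ≤ t → TopTransitiveOn (T^[t]) (Icc d₁ d₂)
  /-- `[d₁, d₂]` is the only transitive component: it attracts almost every initial condition. -/
  core_attracting : ∀ᵐ x ∂(volume.restrict (Icc (0 : ℝ) 1)),
    Tendsto (fun t : ℕ => Metric.infDist (T^[t] x) (Icc d₁ d₂)) atTop (𝓝 0)
  unique_acip : ∃! ν : Measure ℝ, IsProbabilityMeasure ν ∧ ν (Icc 0 1)ᶜ = 0 ∧ ν ≪ volume ∧
    ν.map T = ν

/-- The gap `Γ = 1 - Δ`, where `Δ = T c` is the maximum of `T`. -/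
def gap (T : ℝ → ℝ) (c : ℝ) : ℝ := 1 - T c

/-- The enlarged state space `[-Γ, 1]`. -/
def stateSpace (T : ℝ → ℝ) (c : ℝ) : Set ℝ := Icc (-gap T c) 1

/-- The extension of `T` to `[-Γ, 0]`: continuous, decreasing and with `T (-Γ) < Δ`.
(Measurability concerns only the irrelevant values outside `[-Γ, 1]`.) -/
structure ExtensionAssumption (T : ℝ → ℝ) (c : ℝ) : Prop where
  measurable : Measurable T
  continuousOn : ContinuousOn T (Icc (-gap T c) 0)
  antitoneOn : AntitoneOn T (Icc (-gap T c) 0)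
  left_lt : T (-gap T c) < T c

/-! ### The noise -/

/-- The variance-like function `σ`, at a fixed noise intensity, and the noise amplitude `a`. The
last field distinguishes the cases `T 0 = 0` and `T 0 = q > 0`; a bound
`a ≤ (1 / σ_max) * B` is written as `a * σ x ≤ B` for all `x`. -/
structure NoiseAssumption (T : ℝ → ℝ) (c : ℝ) (σ : ℝ → ℝ) (a : ℝ) : Prop where
  a_pos : 0 < a
  measurable : Measurable σ
  nonneg : ∀ x ∈ stateSpace T c, 0 ≤ σ x
  pos : ∀ x ∈ Ioo (0 : ℝ) 1, 0 < σ x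
  differentiableOn : DifferentiableOn ℝ σ (Ioo 0 1)
  /-- When `T 0 > 0` and `T` is increasing on `[0, c]` and decreasing on `[c, 1]`, this is a
  consequence of the bound on `a` in the second case below. -/
  lower_pos : ∀ x ∈ Ioc 0 (1 - gap T c / 2), 0 < T x - a * σ x
  cases :
    (T 0 = 0 ∧ σ 0 = 0 ∧ (∀ x ∈ stateSpace T c, a * σ x ≤ gap T c / 2) ∧
      ∃ ε : ℝ, 0 < ε ∧ (∀ x ∈ Ioo 0 ε, x < T x - a * σ x) ∧
        ∀ x ∈ Ioo ε (1 - gap T c / 2), ε < T x - a * σ x) ∨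
    (0 < T 0 ∧ ∀ x ∈ stateSpace T c,
      a * σ x ≤ min (gap T c / 2) (min (T 0 / 2) (T (1 - gap T c / 2) / 2)))

/-- `χ` is a smooth bump function on `[-a, a]`: nonnegative, and positive exactly on `(-a, a)`. -/
structure BumpAssumption (χ : ℝ → ℝ) (a : ℝ) : Prop where
  contDiff : ContDiff ℝ (⊤ : ℕ∞) χ
  nonneg : ∀ y, 0 ≤ χ y
  support_eq : Function.support χ = Ioo (-a) a

/-! ### The random system -/

/-- A map perturbed by heteroscedastic noise: the map `T` with its distinguished points, the
function `σ`, the amplitude `a` and the bump function `χ` of the noise density. -/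
structure RandomSystem where
  T : ℝ → ℝ
  c : ℝ
  d₁ : ℝ
  d₂ : ℝ
  σ : ℝ → ℝ
  a : ℝ
  χ : ℝ → ℝ
  map_assumption : MapAssumption T c d₁ d₂
  extension_assumption : ExtensionAssumption T c
  noise_assumption : NoiseAssumption T c σ a
  bump_assumption : BumpAssumption χ a

namespace RandomSystem

variable (S : RandomSystem)

/-- The state space `[-Γ, 1]`. -/
def space : Set ℝ := stateSpace S.T S.c

/-- The normalizing constant `c_a`. -/
def normConst : ℝ := (∫ y, S.χ y * Real.exp (-y ^ 2 / 2))⁻¹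

/-- The noise density `g_a(y) = c_a χ(y) exp(-y²/2)`. -/
def noiseDensity (y : ℝ) : ℝ := S.normConst * S.χ y * Real.exp (-y ^ 2 / 2)

/-- The noise law `θ = g_a(η) dη`. -/
def θ : Measure ℝ := volume.withDensity fun y => ENNReal.ofReal (S.noiseDensity y)

/-- The random map `T_η(x) = T x + σ x * η`. -/
def randomMap (η x : ℝ) : ℝ := S.T x + S.σ x * η

/-- The transition probability `P_x(A)`. -/
def transition (x : ℝ) (A : Set ℝ) : ENNReal := S.θ {η | S.randomMap η x ∈ A}

/-- `μ` is a fixed point of the Markov operator: `∫ P_x(A) dμ(x) = μ(A)` for all Borel `A`. -/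
def IsStationary (μ : Measure ℝ) : Prop :=
  ∀ A : Set ℝ, MeasurableSet A → ∫⁻ x, S.transition x A ∂μ = μ A

/-- `μ` is the measure on `[-Γ, 1]` with density `h ∈ BV`, `h ≥ 0`. -/
structure HasBVDensity (μ : Measure ℝ) (h : ℝ → ℝ) : Prop where
  memBV : MemBV h S.space
  nonneg : ∀ x, 0 ≤ h x
  eq_withDensity : μ = (volume.restrict S.space).withDensity fun x => ENNReal.ofReal (h x)

/-- The adjoint operator `(U f)(x) = ∫ f(T_η(x)) dθ(η)`. -/
def adjointOp (f : ℝ → ℝ) (x : ℝ) : ℝ := ∫ η, f (S.randomMap η x) ∂S.θ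

/-- The random orbit `T_{η_k} ∘ ⋯ ∘ T_{η_1} (x)`, where `η_{k+1}` is `ω k`. -/
def orbit (ω : ℕ → ℝ) (x : ℝ) : ℕ → ℝ
  | 0 => x
  | k + 1 => S.randomMap (ω k) (orbit ω x k)

/-- The Birkhoff sum `S_t = ∑_{k<t} g(T_{η_k} ∘ ⋯ ∘ T_{η_1} (x))`. -/
def birkhoff (g : ℝ → ℝ) (t : ℕ) (p : (ℕ → ℝ) × ℝ) : ℝ :=
  ∑ k ∈ Finset.range t, g (S.orbit p.1 p.2 k)

/-- The probability `θ^{⊗ℕ} ⊗ μ`. -/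
def pathMeasure (μ : Measure ℝ) : Measure ((ℕ → ℝ) × ℝ) :=
  (Measure.infinitePi fun _ : ℕ => S.θ).prod μ

lemma continuous_weight : Continuous fun y => S.χ y * Real.exp (-y ^ 2 / 2) :=
  S.bump_assumption.contDiff.continuous.mul (by fun_prop)

lemma weight_nonneg (y : ℝ) : 0 ≤ S.χ y * Real.exp (-y ^ 2 / 2) :=
  mul_nonneg (S.bump_assumption.nonneg y) (Real.exp_pos _).le

lemma hasCompactSupport_weight : HasCompactSupport fun y => S.χ y * Real.exp (-y ^ 2 / 2) := by
  apply HasCompactSupport.mul_right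
  refine HasCompactSupport.of_support_subset_isCompact (isCompact_Icc (a := -S.a) (b := S.a)) ?_
  rw [S.bump_assumption.support_eq]
  exact Ioo_subset_Icc_self

lemma integrable_weight : Integrable fun y => S.χ y * Real.exp (-y ^ 2 / 2) :=
  S.continuous_weight.integrable_of_hasCompactSupport S.hasCompactSupport_weight

lemma weight_integral_pos : 0 < ∫ y, S.χ y * Real.exp (-y ^ 2 / 2) := by
  apply integral_pos_of_integrable_nonneg_nonzero S.continuous_weight S.integrable_weight
    S.weight_nonneg (x := 0)
  have h0 : (0 : ℝ) ∈ Function.support S.χ := by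
    rw [S.bump_assumption.support_eq]
    exact ⟨by linarith [S.noise_assumption.a_pos], S.noise_assumption.a_pos⟩
  exact mul_ne_zero h0 (Real.exp_pos _).ne'

instance : IsProbabilityMeasure S.θ := by
  constructor
  have hnd : S.noiseDensity = fun y => S.normConst * (S.χ y * Real.exp (-y ^ 2 / 2)) := by
    funext y; simp only [noiseDensity]; ring
  have hc : 0 < S.normConst := inv_pos.mpr S.weight_integral_pos
  rw [θ, withDensity_apply _ MeasurableSet.univ, Measure.restrict_univ, hnd,
    ← ofReal_integral_eq_lintegral_ofReal (S.integrable_weight.const_mul _)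
      (Eventually.of_forall fun y => mul_nonneg hc.le (S.weight_nonneg y)),
    integral_const_mul, normConst, inv_mul_cancel₀ S.weight_integral_pos.ne', ENNReal.ofReal_one]

instance (μ : Measure ℝ) [IsProbabilityMeasure μ] : IsProbabilityMeasure (S.pathMeasure μ) := by
  unfold pathMeasure; infer_instance

end RandomSystem

end

/-! The theorem reduces to one fact: the averaging operator $\mathcal U$ has a spectral gap. The gap
is proved by Doeblin's method, on bounded measurable functions with the pointwise supremum norm. BV
enters through $g$, which has a bounded measurable version.

Localization. The stationary measure gives full mass to an interval $[b,e]\subset(0,1)$ that every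
noise maps into itself (`IsStationary.exists_interval`). There $T$ and $\sigma$ are continuous and
$\sigma$ is bounded below. Clamping the argument to $[b,e]$ extends the system to the whole line
without changing it almost surely.

Minorization. $T$ has a fixed point $z$ in the core $[d_1,d_2]$, and near $z$ one noisy step has a
density bounded below on a ball $V$ around $z$. From any point of $[b,e]$ a suitable noise leads to
a point attracted to the core. After some noiseless steps, a second noise leads to a point whose
deterministic orbit enters $V$, by transitivity. Compactness and the fact that $V$ minorizes itself
make this uniform at one common time (`exists_minorization_affine`), and
`StationarySystem.exists_spectralGap` follows. Exponential decay of correlations then gives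
Green–Kubo by expanding the square and taking a Cesàro limit.

Perturbation. The twisted operators $L_zf=e^{zg}\,\mathcal Uf$ satisfy $m(L_z^t1)=\mathbb
E\,e^{zS_t}$, where $m$ is integration against $\mu$. For small $z$ the orbit of $1$ under the
normalized operator converges geometrically, so the ratios of successive values $m(L_z^t1)$ converge
to a nonvanishing holomorphic factor, whose logarithm is $\ell(z)$. This replaces spectral
projections and gives $\mathbb E\,e^{zS_t}=e^{t\ell(z)}(1+O(|z|))$ uniformly in $t$
(`SpectralGap.exists_quasiPower`).

Limit theorems. Cauchy estimates at $0$ give $\ell'(0)=0$ and $\ell''(0)=\iota^2$. At imaginary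
arguments the approximation yields the CLT by Lévy's theorem and the Berry–Esseen bound by Esseen's
inequality. At real arguments it yields large deviations by a local Gärtner–Ellis argument, whose
rate is a Legendre transform. -/

noncomputable section

/-! ### Smoothing inequality for distribution functions -/

/-- The Fejér kernel `(1 - cos u) / u²`, up to normalization. -/
def fejer (u : ℝ) : ℝ := Real.sinc (u / 2) ^ 2 / 2

lemma continuous_fejer : Continuous fejer := by
  unfold fejer
  have := Real.continuous_sinc
  fun_prop

lemma fejer_nonneg (u : ℝ) : 0 ≤ fejer u := by unfold fejer; positivity

lemma fejer_neg (u : ℝ) : fejer (-u) = fejer u := by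
  unfold fejer; rw [neg_div, Real.sinc_neg]

lemma fejer_le_half (u : ℝ) : fejer u ≤ 1 / 2 := by
  unfold fejer
  have := Real.abs_sinc_le_one (u / 2)
  have := (sq_le_one_iff_abs_le_one _).2 this
  linarith

lemma fejer_of_ne {u : ℝ} (hu : u ≠ 0) : fejer u = (1 - Real.cos u) / u ^ 2 := by
  unfold fejer
  rw [Real.sinc_of_ne_zero (by positivity)]
  have h : Real.cos u = 1 - 2 * Real.sin (u / 2) ^ 2 := by
    have := Real.cos_two_mul (u / 2)
    rw [show 2 * (u / 2) = u by ring] at this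
    rw [this, Real.cos_sq']; ring
  rw [h]; field_simp; ring

lemma fejer_le_two_div {u : ℝ} (hu : u ≠ 0) : fejer u ≤ 2 / u ^ 2 := by
  rw [fejer_of_ne hu]
  have := Real.neg_one_le_cos u
  gcongr
  linarith

lemma integrable_fejer : Integrable fejer := by
  refine Integrable.mono' (g := fun u => 5 / 2 * (1 + u ^ 2)⁻¹)
    (integrable_inv_one_add_sq.const_mul _) continuous_fejer.aestronglyMeasurable ?_
  refine Eventually.of_forall fun u => ?_
  rw [Real.norm_of_nonneg (fejer_nonneg u), ← div_eq_mul_inv, le_div_iff₀ (by positivity)]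
  have h1 := fejer_le_half u
  have h2 : fejer u * u ^ 2 ≤ 2 := by
    by_cases hu : u = 0
    · simp [hu]
    · have := fejer_le_two_div hu
      rwa [le_div_iff₀ (by positivity)] at this
  linarith

lemma fejer_integral_pos : 0 < ∫ u, fejer u := by
  apply integral_pos_of_integrable_nonneg_nonzero continuous_fejer integrable_fejer
    fejer_nonneg (x := 0)
  simp [fejer]

/-- The kernel is the cosine transform of a triangle supported in $[-1,1]$. This compact support is
why smoothing sees characteristic functions only up to a cut-off frequency. -/
lemma fejer_eq_integral (u : ℝ) : fejer u = ∫ t in (0 : ℝ)..1, (1 - t) * Real.cos (t * u) := by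
  by_cases hu : u = 0
  · have : ∫ t in (0 : ℝ)..1, (1 - t) = 1 / 2 := by
      rw [intervalIntegral.integral_sub (by simp) (by simp)]
      norm_num
    simp [hu, fejer, this]
  · have hd : ∀ t ∈ uIcc (0 : ℝ) 1, HasDerivAt
        (fun t => (1 - t) * (Real.sin (t * u) / u) - Real.cos (t * u) / u ^ 2)
        ((1 - t) * Real.cos (t * u)) t := by
      intro t _
      have h1 : HasDerivAt (fun t : ℝ => t * u) u t := by
        simpa using (hasDerivAt_id t).mul_const u
      have h2 := ((hasDerivAt_id t).const_sub 1).mul (h1.sin.div_const u)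
      have h3 := h2.sub (h1.cos.div_const (u ^ 2))
      convert! h3 using 1
      simp only [id]
      field_simp
      ring
    rw [intervalIntegral.integral_eq_sub_of_hasDerivAt hd
      (Continuous.intervalIntegrable (by fun_prop) _ _), fejer_of_ne hu]
    simp
    field_simp
    ring

lemma integral_fejer_eq (y : ℝ) :
    ∫ u in (0 : ℝ)..y, fejer u = ∫ t in (0 : ℝ)..1, (1 - t) * (Real.sin (t * y) / t) := by
  simp_rw [fejer_eq_integral]
  rw [intervalIntegral_intervalIntegral_swap]
  · refine intervalIntegral.integral_congr_ae ?_
    refine Eventually.of_forall fun t ht => ?_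
    rw [uIoc_of_le zero_le_one] at ht
    rw [intervalIntegral.integral_const_mul]
    congr 1
    have := integral_cos (a := 0) (b := t * y)
    rw [Real.sin_zero, sub_zero] at this
    rw [← this, intervalIntegral.integral_comp_mul_left (fun x => Real.cos x) ht.1.ne']
    simp [div_eq_inv_mul]
  · refine (ContinuousOn.integrableOn_compact (isCompact_uIcc.prod isCompact_uIcc)
      (Continuous.continuousOn ?_)).mono_set (prod_mono uIoc_subset_uIcc uIoc_subset_uIcc)
    unfold Function.uncurry
    fun_prop

/-- The probability measure whose density is the normalized Fejér kernel. -/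
def fejerMeasure : Measure ℝ :=
  volume.withDensity fun u => ENNReal.ofReal (fejer u / ∫ v, fejer v)

lemma fejerMeasure_real {s : Set ℝ} (hs : MeasurableSet s) :
    fejerMeasure.real s = (∫ u in s, fejer u) / ∫ v, fejer v := by
  have hA := fejer_integral_pos
  rw [Measure.real, fejerMeasure, withDensity_apply _ hs,
    ← ofReal_integral_eq_lintegral_ofReal (integrable_fejer.div_const _).integrableOn
      (Eventually.of_forall fun y => div_nonneg (fejer_nonneg y) hA.le),
    integral_div, ENNReal.toReal_ofReal]
  exact div_nonneg (integral_nonneg fun y => fejer_nonneg y) hA.le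

instance : IsProbabilityMeasure fejerMeasure := by
  have h := fejerMeasure_real MeasurableSet.univ
  rw [setIntegral_univ, div_self fejer_integral_pos.ne', Measure.real] at h
  exact ⟨(ENNReal.toReal_eq_one_iff _).1 h⟩

lemma setIntegral_Ioi_fejer_le {r : ℝ} (hr : 0 < r) : ∫ u in Ioi r, fejer u ≤ 2 / r := by
  have h := integral_Ioi_rpow_of_lt (a := -2) (by norm_num) hr
  have h1 : ∫ u in Ioi r, fejer u ≤ ∫ u in Ioi r, 2 * u ^ (-2 : ℝ) := by
    refine setIntegral_mono_on integrable_fejer.integrableOn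
      ((integrableOn_Ioi_rpow_of_lt (by norm_num) hr).const_mul 2) measurableSet_Ioi ?_
    intro u hu
    have hu0 : 0 < u := hr.trans hu
    have := fejer_le_two_div hu0.ne'
    rw [Real.rpow_neg hu0.le, ← div_eq_mul_inv]
    exact_mod_cast this
  rw [integral_const_mul, h] at h1
  refine h1.trans (le_of_eq ?_)
  norm_num
  rw [Real.rpow_neg_one]
  ring

/-- The kernel decays like $2/u^2$, so each tail costs at most $2/r$ before normalization. No first
moment of the kernel is needed. -/
lemma fejerMeasure_tail {r : ℝ} (hr : 0 < r) :
    fejerMeasure.real {u | r ≤ |u|} ≤ 4 / (∫ v, fejer v) / r := by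
  have hA := fejer_integral_pos
  have hset : {u : ℝ | r ≤ |u|} = Iic (-r) ∪ Ici r := by
    ext u
    simp only [mem_ofPred_eq, le_abs, mem_union, mem_Iic, mem_Ici]
    constructor
    · rintro (h | h)
      · exact Or.inr h
      · left; linarith
    · rintro (h | h)
      · right; linarith
      · exact Or.inl h
  have h1 : fejerMeasure.real (Ici r) ≤ 2 / r / ∫ v, fejer v := by
    rw [fejerMeasure_real measurableSet_Ici, integral_Ici_eq_integral_Ioi]
    gcongr
    exact setIntegral_Ioi_fejer_le hr
  have h2 : fejerMeasure.real (Iic (-r)) ≤ 2 / r / ∫ v, fejer v := by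
    rw [fejerMeasure_real measurableSet_Iic]
    gcongr
    have := integral_comp_neg_Iic (-r) fejer
    simp_rw [fejer_neg, neg_neg] at this
    rw [this]
    exact setIntegral_Ioi_fejer_le hr
  rw [hset]
  refine (measureReal_union_le _ _).trans ((add_le_add h2 h1).trans (le_of_eq ?_))
  field_simp
  ring

lemma fejerMeasure_Iic (v : ℝ) : fejerMeasure.real (Iic v) =
    fejerMeasure.real (Iic 0) +
      (∫ t in (0 : ℝ)..1, (1 - t) * (Real.sin (t * v) / t)) / ∫ v, fejer v := by
  rw [fejerMeasure_real measurableSet_Iic, fejerMeasure_real measurableSet_Iic,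
    ← integral_fejer_eq, ← intervalIntegral.integral_Iic_sub_Iic integrable_fejer.integrableOn
      integrable_fejer.integrableOn]
  ring

lemma abs_sin_mul_div_le (t v : ℝ) : |Real.sin (t * v) / t| ≤ |v| := by
  by_cases ht : t = 0
  · simp [ht]
  · rw [abs_div, div_le_iff₀ (abs_pos.2 ht)]
    calc |Real.sin (t * v)| ≤ |t * v| := Real.abs_sin_le_abs
      _ = |v| * |t| := by rw [abs_mul, mul_comm]

lemma integral_sin_sub (ν : Measure ℝ) [IsProbabilityMeasure ν] (s x : ℝ) :
    ∫ y, Real.sin (s * (x - y)) ∂ν = (Complex.exp (s * x * Complex.I) * charFun ν (-s)).im := by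
  rw [charFun_apply_real, ← integral_const_mul]
  have hI : Integrable (fun y : ℝ => Complex.exp (s * x * Complex.I) *
      Complex.exp (((-s : ℝ) : ℂ) * y * Complex.I)) ν := by
    refine Integrable.of_bound (Continuous.aestronglyMeasurable (by fun_prop)) 1
      (Eventually.of_forall fun y => ?_)
    rw [norm_mul]
    have h1 : ‖Complex.exp (s * x * Complex.I)‖ = 1 := by
      exact_mod_cast Complex.norm_exp_ofReal_mul_I (s * x)
    have h2 : ‖Complex.exp (((-s : ℝ) : ℂ) * y * Complex.I)‖ = 1 := by
      exact_mod_cast Complex.norm_exp_ofReal_mul_I (-s * y)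
    rw [h1, h2]; norm_num
  have := Complex.imCLM.integral_comp_comm hI
  simp only [Complex.imCLM_apply] at this
  rw [← this]
  congr 1
  ext y
  rw [← Complex.exp_add]
  have : (s * x * Complex.I + ((-s : ℝ) : ℂ) * y * Complex.I : ℂ)
      = ((s * (x - y) : ℝ) : ℂ) * Complex.I := by push_cast; ring
  rw [this, Complex.exp_ofReal_mul_I_im]

/-- Fubini in the sine representation of the smoothed distribution function. The singularity $1/t$
is harmless because $|\sin(tv)/t|\le|v|$; this is where the first moment of `ν` is used. -/
lemma integral_fejerMeasure_Iic (ν : Measure ℝ) [IsProbabilityMeasure ν]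
    (hν : Integrable (fun y => y) ν) (T x : ℝ) :
    ∫ y, fejerMeasure.real (Iic (T * (x - y))) ∂ν = fejerMeasure.real (Iic 0) +
      (∫ t in (0 : ℝ)..1, (1 - t) / t *
        (Complex.exp ((t * T : ℝ) * x * Complex.I) * charFun ν (-(t * T))).im) /
          ∫ v, fejer v := by
  have : IsFiniteMeasure (volume.restrict (uIoc (0 : ℝ) 1)) := by
    rw [uIoc_of_le zero_le_one]; infer_instance
  have hI : Integrable (Function.uncurry fun (t : ℝ) (y : ℝ) =>
      (1 - t) * (Real.sin (t * (T * (x - y))) / t))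
      ((volume.restrict (uIoc (0 : ℝ) 1)).prod ν) := by
    have hb : Integrable (fun p : ℝ × ℝ => |T * (x - p.2)|)
        ((volume.restrict (uIoc (0 : ℝ) 1)).prod ν) := by
      have : Integrable (fun y => |T * (x - y)|) ν :=
        (((integrable_const x).sub hν).const_mul T).abs
      exact this.comp_snd _
    refine hb.mono' ?_ ?_
    · refine Measurable.aestronglyMeasurable ?_
      unfold Function.uncurry
      fun_prop
    · have hae : ∀ᵐ t ∂(volume.restrict (uIoc (0 : ℝ) 1)), t ∈ uIoc (0 : ℝ) 1 :=
        ae_restrict_mem measurableSet_uIoc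
      have := (Measure.quasiMeasurePreserving_fst (μ := volume.restrict (uIoc (0 : ℝ) 1))
        (ν := ν)).ae hae
      filter_upwards [this] with p hp
      rw [uIoc_of_le zero_le_one] at hp
      simp only [Function.uncurry]
      rw [Real.norm_eq_abs, abs_mul]
      have h1 : |1 - p.1| ≤ 1 := by rw [abs_le]; constructor <;> linarith [hp.1, hp.2]
      calc _ ≤ 1 * |T * (x - p.2)| := mul_le_mul h1 (abs_sin_mul_div_le _ _) (abs_nonneg _) zero_le_one
        _ = _ := one_mul _
  have hF : (fun y => fejerMeasure.real (Iic (T * (x - y)))) = fun y =>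
      fejerMeasure.real (Iic 0) + (∫ t in (0 : ℝ)..1,
        (1 - t) * (Real.sin (t * (T * (x - y))) / t)) / ∫ v, fejer v :=
    funext fun y => fejerMeasure_Iic _
  rw [hF]
  have hI2 : Integrable (fun y => ∫ t in (0 : ℝ)..1,
      (1 - t) * (Real.sin (t * (T * (x - y))) / t)) ν := by
    have := hI.integral_prod_right
    simp only [Function.uncurry] at this
    simpa only [intervalIntegral.integral_of_le zero_le_one, uIoc_of_le (zero_le_one' ℝ)] using this
  rw [integral_add (integrable_const _) (hI2.div_const _), integral_div,
    ← intervalIntegral_integral_swap hI]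
  simp only [integral_const, probReal_univ, one_smul]
  congr 2
  refine intervalIntegral.integral_congr fun t _ => ?_
  rw [integral_const_mul, integral_div, ← integral_sin_sub]
  simp_rw [← mul_assoc]
  ring

lemma measurable_measureReal_Iic (ν : Measure ℝ) [IsFiniteMeasure ν] :
    Measurable fun x => ν.real (Iic x) :=
  Monotone.measurable fun _ _ h => measureReal_mono (Iic_subset_Iic.2 h)

/-- Both sides are the probability that $y+u/T\le x$ for independent $y\sim\nu$ and $u\sim\kappa$.
-/
lemma integral_measureReal_Iic_sub (ν κ : Measure ℝ) [IsProbabilityMeasure ν]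
    [IsProbabilityMeasure κ] {T : ℝ} (hT : 0 < T) (x : ℝ) :
    ∫ u, ν.real (Iic (x - u / T)) ∂κ = ∫ y, κ.real (Iic (T * (x - y))) ∂ν := by
  have hs : MeasurableSet {p : ℝ × ℝ | p.2 ≤ x - p.1 / T} :=
    measurableSet_le (by fun_prop) (by fun_prop)
  have hI : Integrable (Function.uncurry fun u y : ℝ =>
      {p : ℝ × ℝ | p.2 ≤ x - p.1 / T}.indicator (fun _ => (1 : ℝ)) (u, y)) (κ.prod ν) :=
    (integrable_const (1 : ℝ)).indicator hs
  have h := integral_integral_swap hI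
  have h1 : ∀ u, ∫ y, {p : ℝ × ℝ | p.2 ≤ x - p.1 / T}.indicator (fun _ => (1 : ℝ)) (u, y) ∂ν
      = ν.real (Iic (x - u / T)) := by
    intro u
    rw [← integral_indicator_one measurableSet_Iic]
    rfl
  have h2 : ∀ y, ∫ u, {p : ℝ × ℝ | p.2 ≤ x - p.1 / T}.indicator (fun _ => (1 : ℝ)) (u, y) ∂κ
      = κ.real (Iic (T * (x - y))) := by
    intro y
    rw [← integral_indicator_one measurableSet_Iic]
    congr 1
    ext u
    have : y ≤ x - u / T ↔ u ≤ T * (x - y) := by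
      rw [le_sub_comm, div_le_iff₀ hT, mul_comm]
    simp [indicator, this]
  simp_rw [h1, h2] at h
  exact h

/-- The constant terms of the two Fourier representations cancel. What remains is an integral
against a weight bounded by $1/t$, which the factor $t$ in the hypothesis absorbs. -/
lemma abs_integral_fejerMeasure_sub_le (ν₁ ν₂ : Measure ℝ) [IsProbabilityMeasure ν₁]
    [IsProbabilityMeasure ν₂] (h₁ : Integrable (fun y => y) ν₁) (h₂ : Integrable (fun y => y) ν₂)
    {T : ℝ} (b : ℝ → ℝ) (hb : IntervalIntegrable b volume 0 1)
    (hφ : ∀ t ∈ Ioc (0 : ℝ) 1, ‖charFun ν₁ (t * T) - charFun ν₂ (t * T)‖ ≤ t * b t) (x : ℝ) :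
    |∫ y, fejerMeasure.real (Iic (T * (x - y))) ∂ν₁ -
      ∫ y, fejerMeasure.real (Iic (T * (x - y))) ∂ν₂| ≤ (∫ t in (0 : ℝ)..1, b t) / ∫ v, fejer v := by
  have hA := fejer_integral_pos
  have hint : ∀ (ν : Measure ℝ) [IsProbabilityMeasure ν], Integrable (fun y => y) ν →
      IntervalIntegrable (fun t : ℝ => (1 - t) / t *
        (Complex.exp ((t * T : ℝ) * x * Complex.I) * charFun ν (-(t * T))).im) volume 0 1 := by
    intro ν _ hν
    have hle : ∀ t ∈ Ioc (0 : ℝ) 1, ‖(1 - t) / t *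
        (Complex.exp ((t * T : ℝ) * x * Complex.I) * charFun ν (-(t * T))).im‖
        ≤ ∫ y, |T * (x - y)| ∂ν := by
      intro t ht
      rw [← integral_sin_sub, ← integral_const_mul]
      refine (norm_integral_le_integral_norm _).trans (integral_mono_of_nonneg
        (Eventually.of_forall fun _ => norm_nonneg _)
        (((integrable_const x).sub hν).const_mul T).abs (Eventually.of_forall fun y => ?_))
      simp only
      rw [show (1 - t) / t * Real.sin (t * T * (x - y))
        = (1 - t) * (Real.sin (t * (T * (x - y))) / t) by rw [mul_assoc]; ring, Real.norm_eq_abs,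
        abs_mul]
      have h1 : |1 - t| ≤ 1 := by rw [abs_le]; constructor <;> linarith [ht.1, ht.2]
      calc _ ≤ 1 * |T * (x - y)| := mul_le_mul h1 (abs_sin_mul_div_le _ _) (abs_nonneg _) zero_le_one
        _ = _ := one_mul _
    rw [intervalIntegrable_iff_integrableOn_Ioc_of_le zero_le_one]
    refine Measure.integrableOn_of_bounded (M := ∫ y, |T * (x - y)| ∂ν) (by simp) ?_ ?_
    · have hm : Measurable (charFun ν) := measurable_charFun
      refine Measurable.aestronglyMeasurable ?_
      have h3 : Measurable fun t : ℝ => Complex.exp ((t * T : ℝ) * x * Complex.I) :=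
        Continuous.measurable (by fun_prop)
      have h4 : Measurable fun t : ℝ => charFun ν (-(t * T)) := hm.comp (by fun_prop)
      exact (by fun_prop : Measurable fun t : ℝ => (1 - t) / t).mul
        (Complex.measurable_im.comp (h3.mul h4))
    · filter_upwards [ae_restrict_mem measurableSet_Ioc] with t ht using hle t ht
  rw [integral_fejerMeasure_Iic ν₁ h₁, integral_fejerMeasure_Iic ν₂ h₂, add_sub_add_left_eq_sub,
    ← sub_div, abs_div, abs_of_pos hA, ← intervalIntegral.integral_sub (hint ν₁ h₁) (hint ν₂ h₂)]
  gcongr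
  rw [← Real.norm_eq_abs]
  refine intervalIntegral.norm_integral_le_of_norm_le zero_le_one
    (Eventually.of_forall fun t ht => ?_) hb
  rw [← mul_sub, ← Complex.sub_im, ← mul_sub, norm_mul, Real.norm_eq_abs, Real.norm_eq_abs]
  have h0 : 0 < t := ht.1
  have h1 : |(1 - t) / t| ≤ 1 / t := by
    rw [abs_div, abs_of_pos h0]
    gcongr
    rw [abs_le]; constructor <;> linarith [ht.1, ht.2]
  have h2 : |(Complex.exp ((t * T : ℝ) * x * Complex.I) *
      (charFun ν₁ (-(t * T)) - charFun ν₂ (-(t * T)))).im| ≤ t * b t := by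
    refine (Complex.abs_im_le_norm _).trans ?_
    rw [norm_mul]
    have h3 : ‖Complex.exp ((t * T : ℝ) * x * Complex.I)‖ = 1 := by
      exact_mod_cast Complex.norm_exp_ofReal_mul_I (t * T * x)
    rw [h3, one_mul, charFun_neg, charFun_neg, ← map_sub, RCLike.norm_conj]
    exact hφ t ht
  calc _ ≤ 1 / t * (t * b t) := by gcongr
    _ = b t := by field_simp

/-- **Esseen's smoothing inequality.** -/
theorem esseen_smoothing (ν₁ ν₂ : Measure ℝ) [IsProbabilityMeasure ν₁]
    [IsProbabilityMeasure ν₂] (h₁ : Integrable (fun y => y) ν₁) (h₂ : Integrable (fun y => y) ν₂)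
    {m : ℝ} (hm : 0 < m) (hL : ∀ x y, x ≤ y → ν₂.real (Iic y) - ν₂.real (Iic x) ≤ m * (y - x))
    {T : ℝ} (hT : 0 < T) (b : ℝ → ℝ) (hb : IntervalIntegrable b volume 0 1)
    (hφ : ∀ t ∈ Ioc (0 : ℝ) 1, ‖charFun ν₁ (t * T) - charFun ν₂ (t * T)‖ ≤ t * b t) (x : ℝ) :
    |ν₁.real (Iic x) - ν₂.real (Iic x)| ≤
      4 / 3 * ((∫ t in (0 : ℝ)..1, b t) / (∫ v, fejer v) + 64 * m / (∫ v, fejer v) / T) := by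
  have hA := fejer_integral_pos
  set A := ∫ v, fejer v with hAdef
  set E := (∫ t in (0 : ℝ)..1, b t) / A with hE
  set Δ : ℝ → ℝ := fun x => ν₁.real (Iic x) - ν₂.real (Iic x) with hΔ
  have hΔ1 : ∀ x, |Δ x| ≤ 1 := by
    intro x
    rw [abs_le]
    constructor <;> simp only [hΔ] <;>
      linarith [measureReal_nonneg (μ := ν₁) (s := Iic x), measureReal_nonneg (μ := ν₂) (s := Iic x),
        measureReal_le_one (μ := ν₁) (s := Iic x), measureReal_le_one (μ := ν₂) (s := Iic x)]
  have hbdd : BddAbove (range fun x => |Δ x|) := ⟨1, by rintro _ ⟨y, rfl⟩; exact hΔ1 y⟩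
  set D := ⨆ x, |Δ x| with hD
  have hDle : ∀ x, |Δ x| ≤ D := fun x => le_ciSup hbdd x
  have hmeas : Measurable Δ := (measurable_measureReal_Iic ν₁).sub (measurable_measureReal_Iic ν₂)
  have hconv : ∀ x, |∫ u, Δ (x - u / T) ∂fejerMeasure| ≤ E := by
    intro x
    have := abs_integral_fejerMeasure_sub_le ν₁ ν₂ h₁ h₂ b hb hφ x
    rw [← integral_measureReal_Iic_sub ν₁ fejerMeasure hT,
      ← integral_measureReal_Iic_sub ν₂ fejerMeasure hT, ← integral_sub] at this
    · exact this
    all_goals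
      refine Integrable.of_bound (C := 1) ?_ (Eventually.of_forall fun u => ?_)
      · exact ((measurable_measureReal_Iic _).comp (by fun_prop)).aestronglyMeasurable
      · rw [Real.norm_of_nonneg measureReal_nonneg]; exact measureReal_le_one
  have hint : ∀ x, Integrable (fun u => Δ (x - u / T)) fejerMeasure := fun x =>
    Integrable.of_bound (C := 1) (hmeas.comp (by fun_prop)).aestronglyMeasurable
      (Eventually.of_forall fun u => hΔ1 _)
  have hmono : ∀ (ν : Measure ℝ) [IsProbabilityMeasure ν] (y z : ℝ), y ≤ z →
      ν.real (Iic y) ≤ ν.real (Iic z) := fun ν _ y z h => measureReal_mono (Iic_subset_Iic.2 h)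
  rcases (show 0 ≤ D from (abs_nonneg _).trans (hDle 0)).eq_or_lt with hD0 | hDpos
  · have hE0 : 0 ≤ E := (abs_nonneg _).trans (hconv 0)
    have : |Δ x| ≤ 0 := hD0 ▸ hDle x
    refine this.trans ?_
    positivity
  -- On a window of length $2h$ the second distribution function grows by at most $2mh=D/4$.
  set h := D / (8 * m) with hh
  have hpos : 0 < h := by positivity
  have htail := fejerMeasure_tail (r := h * T) (by positivity)
  set τ := fejerMeasure.real {u | h * T ≤ |u|} with hτ
  have hmset : MeasurableSet {u : ℝ | h * T ≤ |u|} := measurableSet_le (by fun_prop) (by fun_prop)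
  have hind : Integrable ({u : ℝ | h * T ≤ |u|}.indicator (1 : ℝ → ℝ)) fejerMeasure :=
    (integrable_const (1 : ℝ)).indicator hmset
  have hτb : 2 * D * τ ≤ 64 * m / A / T := by
    calc 2 * D * τ ≤ 2 * D * (4 / A / (h * T)) := by gcongr
      _ = 64 * m / A / T := by rw [hh]; field_simp; ring
  have hloc : ∀ u, |u| < h * T → |u / T| < h := by
    intro u hu
    rwa [abs_div, abs_of_pos hT, div_lt_iff₀ hT]
  -- If the discrepancy is at least $v-D/4$ on the window, so is its average, up to the kernel's
  -- tail. On the tail it is at least $-D$ while $v-D/4\le D$, so the loss there is at most $2D$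
  -- times the tail mass.
  have key : ∀ x v : ℝ, (∀ u, |u| < h → v - D / 4 ≤ Δ (x - u)) → v ≤ D → v ≤ E + D / 4 + 64 * m / A / T := by
    intro x v hv hvD
    have hlow : ∫ u, ((v - D / 4) - 2 * D * {u : ℝ | h * T ≤ |u|}.indicator 1 u) ∂fejerMeasure
        ≤ ∫ u, Δ (x - u / T) ∂fejerMeasure := by
      refine integral_mono ((integrable_const _).sub
        (hind.const_mul (2 * D))) (hint x) fun u => ?_
      by_cases hu : h * T ≤ |u|
      · have := (abs_le.1 (hDle (x - u / T))).1
        simp only [indicator, mem_ofPred_eq, hu, if_true, Pi.one_apply]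
        linarith
      · simp only [indicator, mem_ofPred_eq, hu, if_false, mul_zero, sub_zero]
        exact hv _ (hloc u (not_le.1 hu))
    rw [integral_sub (integrable_const _)
      (hind.const_mul (2 * D)), integral_const_mul,
      integral_indicator_one hmset] at hlow
    simp only [integral_const, probReal_univ, one_smul] at hlow
    have := (abs_le.1 (hconv x)).2
    linarith
  have key2 : ∀ x v : ℝ, (∀ u, |u| < h → Δ (x - u) ≤ -(v - D / 4)) → v ≤ D → v ≤ E + D / 4 + 64 * m / A / T := by
    intro x v hv hvD
    have hlow : ∫ u, Δ (x - u / T) ∂fejerMeasure ≤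
        ∫ u, (2 * D * {u : ℝ | h * T ≤ |u|}.indicator 1 u - (v - D / 4)) ∂fejerMeasure := by
      refine integral_mono (hint x) ((hind.const_mul (2 * D)).sub
        (integrable_const _)) fun u => ?_
      by_cases hu : h * T ≤ |u|
      · have := (abs_le.1 (hDle (x - u / T))).2
        simp only [indicator, mem_ofPred_eq, hu, if_true, Pi.one_apply]
        linarith
      · simp only [indicator, mem_ofPred_eq, hu, if_false, mul_zero, zero_sub]
        exact hv _ (hloc u (not_le.1 hu))
    rw [integral_sub (hind.const_mul (2 * D))
      (integrable_const _), integral_const_mul, integral_indicator_one hmset] at hlow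
    simp only [integral_const, probReal_univ, one_smul] at hlow
    have := (abs_le.1 (hconv x)).1
    linarith
  have hmh : 2 * (m * h) = D / 4 := by rw [hh]; field_simp; norm_num
  have hall : ∀ x, |Δ x| ≤ E + D / 4 + 64 * m / A / T := by
    intro x
    rw [abs_le']
    constructor
    -- The window is centred at $x+h$ so that it lies to the right of $x$, where monotonicity of the
    -- first distribution function preserves a positive discrepancy. A negative one uses $x-h$.
    · refine key (x + h) (Δ x) (fun u hu => ?_) ((le_abs_self _).trans (hDle x))
      have hu' := abs_lt.1 hu
      have h3 := hL x (x + h - u) (by linarith)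
      have h4 := hmono ν₁ x (x + h - u) (by linarith)
      have h5 : m * (x + h - u - x) ≤ m * (2 * h) := by gcongr; linarith
      simp only [hΔ]
      linarith
    · refine key2 (x - h) (-Δ x) (fun u hu => ?_) ((neg_le_abs _).trans (hDle x))
      have hu' := abs_lt.1 hu
      have h3 := hL (x - h - u) x (by linarith)
      have h4 := hmono ν₁ (x - h - u) x (by linarith)
      have h5 : m * (x - (x - h - u)) ≤ m * (2 * h) := by gcongr; linarith
      simp only [hΔ]
      linarith
  have hDfin : D ≤ E + D / 4 + 64 * m / A / T := ciSup_le hall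
  have := hDle x
  simp only [hΔ] at this
  linarith

/-! ### Limit theorems from quasi-powers -/

/-- The complex moment generating functions of the bounded centred variables `S t` are, near `0`,
close to the powers `exp (t * ℓ z)` for a holomorphic function `ℓ`. -/
structure QuasiPower {Ω : Type*} [MeasurableSpace Ω] (P : Measure Ω) (S : ℕ → Ω → ℝ)
    (ℓ : ℂ → ℂ) (δ C : ℝ) : Prop where
  aemeasurable : ∀ t, AEMeasurable (S t) P
  bounded : ∀ t, ∃ G : ℝ, ∀ᵐ ω ∂P, |S t ω| ≤ G
  centred : ∀ t, ∫ ω, S t ω ∂P = 0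
  δ_pos : 0 < δ
  differentiableOn : DifferentiableOn ℂ ℓ (Metric.ball 0 δ)
  map_zero : ℓ 0 = 0
  bound : ∀ t : ℕ, ∀ z ∈ Metric.ball (0 : ℂ) δ,
    ‖complexMGF (S t) P z - Complex.exp (t * ℓ z)‖ ≤ C * ‖z‖ * ‖Complex.exp (t * ℓ z)‖

namespace QuasiPower

variable {Ω : Type*} [MeasurableSpace Ω] {P : Measure Ω} {S : ℕ → Ω → ℝ}
  {ℓ : ℂ → ℂ} {δ C : ℝ}

section

lemma integrableExpSet_eq [IsProbabilityMeasure P] (H : QuasiPower P S ℓ δ C) (t : ℕ) :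
    integrableExpSet (S t) P = univ := by
  obtain ⟨G, hG⟩ := H.bounded t
  refine eq_univ_of_forall fun x => ?_
  refine Integrable.of_bound (C := Real.exp (|x| * G))
    (Real.measurable_exp.comp_aemeasurable
      ((H.aemeasurable t).const_mul x)).aestronglyMeasurable ?_
  filter_upwards [hG] with ω hω
  rw [Real.norm_of_nonneg (Real.exp_pos _).le, Real.exp_le_exp]
  calc x * S t ω ≤ |x * S t ω| := le_abs_self _
    _ = |x| * |S t ω| := abs_mul _ _
    _ ≤ |x| * G := by gcongr

lemma mem_interior [IsProbabilityMeasure P] (H : QuasiPower P S ℓ δ C) (t : ℕ) (x : ℝ) :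
    x ∈ interior (integrableExpSet (S t) P) := by
  simp [H.integrableExpSet_eq]

lemma differentiable_complexMGF [IsProbabilityMeasure P] (H : QuasiPower P S ℓ δ C) (t : ℕ) :
    Differentiable ℂ (complexMGF (S t) P) := fun z =>
  (hasDerivAt_complexMGF (H.mem_interior t z.re)).differentiableAt

lemma integrable [IsProbabilityMeasure P] (H : QuasiPower P S ℓ δ C) (t : ℕ) : Integrable (S t) P :=
  integrable_of_mem_interior_integrableExpSet (H.mem_interior t 0)

lemma analyticAt (H : QuasiPower P S ℓ δ C) {z : ℂ} (hz : z ∈ Metric.ball 0 δ) : AnalyticAt ℂ ℓ z :=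
  H.differentiableOn.analyticAt (Metric.isOpen_ball.mem_nhds hz)

lemma analyticAt_zero (H : QuasiPower P S ℓ δ C) : AnalyticAt ℂ ℓ 0 :=
  H.analyticAt (Metric.mem_ball_self H.δ_pos)

/-- The relative error of the quasi-power approximation. -/
lemma norm_relative_error_le (H : QuasiPower P S ℓ δ C) (t : ℕ) {z : ℂ} (hz : z ∈ Metric.ball 0 δ) :
    ‖complexMGF (S t) P z * Complex.exp (-(t * ℓ z)) - 1‖ ≤ C * ‖z‖ := by
  have h := H.bound t z hz
  have he : complexMGF (S t) P z * Complex.exp (-(t * ℓ z)) - 1 =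
      (complexMGF (S t) P z - Complex.exp (t * ℓ z)) * Complex.exp (-(t * ℓ z)) := by
    rw [sub_mul, ← Complex.exp_add, add_neg_cancel, Complex.exp_zero]
  rw [he, norm_mul]
  calc _ ≤ C * ‖z‖ * ‖Complex.exp (t * ℓ z)‖ * ‖Complex.exp (-(t * ℓ z))‖ := by gcongr
    _ = C * ‖z‖ := by
      rw [mul_assoc, ← norm_mul, ← Complex.exp_add, add_neg_cancel, Complex.exp_zero]; simp

lemma C_nonneg (H : QuasiPower P S ℓ δ C) : 0 ≤ C := by
  have h0 := H.δ_pos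
  have hz : ((δ / 2 : ℝ) : ℂ) ∈ Metric.ball (0 : ℂ) δ := by
    rw [mem_ball_zero_iff, Complex.norm_of_nonneg (by positivity)]; linarith
  have := (norm_nonneg _).trans (H.norm_relative_error_le 0 hz)
  rw [Complex.norm_of_nonneg (by positivity)] at this
  exact nonneg_of_mul_nonneg_left this (by positivity)

/-- Cauchy's estimate on the circle of radius $\delta/2$. The point is that the bound does not
depend on $t$. -/
lemma norm_iteratedDeriv_relative_error_le [IsProbabilityMeasure P] (H : QuasiPower P S ℓ δ C)
    (t n : ℕ) :
    ‖iteratedDeriv n (fun z => complexMGF (S t) P z * Complex.exp (-(t * ℓ z)) - 1) 0‖ ≤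
      n.factorial * (C * δ) / (δ / 2) ^ n := by
  have h0 := H.δ_pos
  have hsub : Metric.closedBall (0 : ℂ) (δ / 2) ⊆ Metric.ball 0 δ :=
    Metric.closedBall_subset_ball (by linarith)
  refine Complex.norm_iteratedDeriv_le_of_forall_mem_sphere_norm_le n (by positivity) ?_ ?_
  · refine DifferentiableOn.diffContOnCl (s := Metric.ball (0 : ℂ) (δ / 2)) ?_
    rw [closure_ball _ (by positivity)]
    have := H.differentiableOn.mono hsub
    have h2 := (H.differentiable_complexMGF t).differentiableOn (s := Metric.closedBall 0 (δ / 2))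
    fun_prop
  · intro z hz
    refine (H.norm_relative_error_le t (hsub (Metric.sphere_subset_closedBall hz))).trans ?_
    have hC := H.C_nonneg
    gcongr
    rw [mem_sphere_zero_iff_norm.1 hz]; linarith

lemma complexMGF_zero [IsProbabilityMeasure P] (t : ℕ) :
    complexMGF (S t) P 0 = 1 := by simp [complexMGF]

lemma deriv_complexMGF_zero [IsProbabilityMeasure P] (H : QuasiPower P S ℓ δ C) (t : ℕ) :
    deriv (complexMGF (S t) P) 0 = 0 := by
  rw [(hasDerivAt_complexMGF (H.mem_interior t _)).deriv]
  simp only [zero_mul, Complex.exp_zero, mul_one]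
  rw [integral_complex_ofReal, H.centred t, Complex.ofReal_zero]

lemma deriv_deriv_complexMGF_zero [IsProbabilityMeasure P] (H : QuasiPower P S ℓ δ C) (t : ℕ) :
    deriv (deriv (complexMGF (S t) P)) 0 = ((∫ ω, S t ω ^ 2 ∂P : ℝ) : ℂ) := by
  have := iteratedDeriv_complexMGF (z := 0) (H.mem_interior t _) 2
  rw [iteratedDeriv_succ, iteratedDeriv_one] at this
  rw [this]
  simp only [zero_mul, Complex.exp_zero, mul_one]
  rw [← integral_complex_ofReal]
  simp only [Complex.ofReal_pow]

lemma hasDerivAt_relative_error [IsProbabilityMeasure P] (H : QuasiPower P S ℓ δ C)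
    (t : ℕ) {z : ℂ} (hz : z ∈ Metric.ball 0 δ) :
    HasDerivAt (fun z => complexMGF (S t) P z * Complex.exp (-(t * ℓ z)) - 1)
      ((deriv (complexMGF (S t) P) z - t * deriv ℓ z * complexMGF (S t) P z) *
        Complex.exp (-(t * ℓ z))) z := by
  have h1 := (H.differentiable_complexMGF t z).hasDerivAt
  have h2 := (((H.analyticAt hz).differentiableAt.hasDerivAt.const_mul (t : ℂ)).fun_neg).cexp
  convert! (h1.mul h2).sub_const 1 using 1
  ring

/-- For centred variables the relative error has derivative $-t\,\ell'(0)$ at $0$, and this stays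
bounded as $t$ grows. -/
lemma deriv_zero [IsProbabilityMeasure P] (H : QuasiPower P S ℓ δ C) : deriv ℓ 0 = 0 := by
  have h0 := H.δ_pos
  have hb : ∀ t : ℕ, (t : ℝ) * ‖deriv ℓ 0‖ ≤ 2 * C := by
    intro t
    have := H.norm_iteratedDeriv_relative_error_le t 1
    rw [iteratedDeriv_one, (H.hasDerivAt_relative_error t (Metric.mem_ball_self h0)).deriv,
      H.deriv_complexMGF_zero, complexMGF_zero, H.map_zero] at this
    simp only [mul_zero, neg_zero, Complex.exp_zero, mul_one, zero_sub, norm_neg, norm_mul,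
      Complex.norm_natCast, Nat.factorial_one, Nat.cast_one, one_mul, pow_one] at this
    refine this.trans (le_of_eq ?_)
    field_simp
  by_contra hne
  have hpos : 0 < ‖deriv ℓ 0‖ := norm_pos_iff.2 hne
  obtain ⟨n, hn⟩ := exists_nat_gt (2 * C / ‖deriv ℓ 0‖)
  rw [div_lt_iff₀ hpos] at hn
  linarith [hb n]

/-- With vanishing first derivatives, the second derivative of the relative error at $0$ is exactly
$\mathbb E S_t^2-t\,\ell''(0)$, and Cauchy's estimate bounds it uniformly in $t$. -/
lemma norm_moment_sub_le [IsProbabilityMeasure P] (H : QuasiPower P S ℓ δ C) (t : ℕ) :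
    ‖((∫ ω, S t ω ^ 2 ∂P : ℝ) : ℂ) - t * deriv (deriv ℓ) 0‖ ≤
      2 * (C * δ) / (δ / 2) ^ 2 := by
  have h0 := H.δ_pos
  have h2 := H.norm_iteratedDeriv_relative_error_le t 2
  have hev : deriv (fun z => complexMGF (S t) P z * Complex.exp (-(t * ℓ z)) - 1) =ᶠ[𝓝 0]
      fun z => (deriv (complexMGF (S t) P) z - t * deriv ℓ z * complexMGF (S t) P z) *
        Complex.exp (-(t * ℓ z)) := by
    filter_upwards [Metric.isOpen_ball.mem_nhds (Metric.mem_ball_self h0)] with z hz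
    exact (H.hasDerivAt_relative_error t hz).deriv
  have hM : HasDerivAt (complexMGF (S t) P) 0 0 := by
    have := (H.differentiable_complexMGF t 0).hasDerivAt
    rwa [H.deriv_complexMGF_zero] at this
  have hM2 : HasDerivAt (deriv (complexMGF (S t) P)) ((∫ ω, S t ω ^ 2 ∂P : ℝ) : ℂ) 0 := by
    have := ((H.differentiable_complexMGF t).analyticAt 0).deriv.differentiableAt.hasDerivAt
    rwa [H.deriv_deriv_complexMGF_zero] at this
  have hl : HasDerivAt ℓ 0 0 := by
    have := H.analyticAt_zero.differentiableAt.hasDerivAt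
    rwa [H.deriv_zero] at this
  have hl2 := H.analyticAt_zero.deriv.differentiableAt.hasDerivAt
  have hd := ((hM2.sub ((hl2.const_mul (t : ℂ)).mul hM)).mul ((hl.const_mul (t : ℂ)).fun_neg).cexp)
  rw [iteratedDeriv_succ, iteratedDeriv_one, hev.deriv_eq] at h2
  erw [hd.deriv] at h2
  simp only [H.deriv_zero, H.map_zero, complexMGF_zero, H.deriv_complexMGF_zero, mul_zero,
    neg_zero, Complex.exp_zero, mul_one, add_zero, Pi.sub_apply, Pi.mul_apply,
    Nat.factorial_two, Nat.cast_ofNat] at h2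
  exact h2

lemma deriv_deriv_zero [IsProbabilityMeasure P] (H : QuasiPower P S ℓ δ C) {v : ℝ}
    (hv : Tendsto (fun t : ℕ => (1 / (t : ℝ)) * ∫ ω, S t ω ^ 2 ∂P) atTop (𝓝 v)) :
    deriv (deriv ℓ) 0 = v := by
  set K := 2 * (C * δ) / (δ / 2) ^ 2
  have h1 : Tendsto (fun t : ℕ => (((1 / (t : ℝ)) * ∫ ω, S t ω ^ 2 ∂P : ℝ) : ℂ)) atTop
      (𝓝 (v : ℂ)) := (Complex.continuous_ofReal.tendsto v).comp hv
  refine tendsto_nhds_unique ?_ h1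
  rw [tendsto_iff_norm_sub_tendsto_zero]
  refine squeeze_zero' (Eventually.of_forall fun _ => norm_nonneg _) ?_
    (tendsto_const_div_atTop_nhds_zero_nat K)
  filter_upwards [eventually_gt_atTop 0] with t ht
  have ht' : (0 : ℝ) < t := by exact_mod_cast ht
  rw [le_div_iff₀ ht']
  have := H.norm_moment_sub_le t
  refine le_trans (le_of_eq ?_) this
  have htc : (t : ℂ) ≠ 0 := by exact_mod_cast ht.ne'
  nth_rewrite 2 [← Complex.norm_natCast]
  rw [← norm_mul]
  congr 1
  push_cast
  field_simp

/-- Taylor expansion to third order: the constant and linear terms vanish. -/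
lemma exists_norm_sub_sq_le [IsProbabilityMeasure P] (H : QuasiPower P S ℓ δ C) {v : ℝ}
    (hv : deriv (deriv ℓ) 0 = v) :
    ∃ r B : ℝ, 0 < r ∧ r ≤ δ ∧ 0 < B ∧
      ∀ z ∈ Metric.ball (0 : ℂ) r, ‖ℓ z - v * z ^ 2 / 2‖ ≤ B * ‖z‖ ^ 3 := by
  have h := H.analyticAt_zero.hasFPowerSeriesAt.isBigO_sub_partialSum_pow 3
  obtain ⟨B, hB, hO⟩ := h.exists_pos
  rw [Asymptotics.IsBigOWith] at hO
  obtain ⟨r, hr, hball⟩ := Metric.eventually_nhds_iff_ball.1 hO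
  refine ⟨min r δ, B, lt_min hr H.δ_pos, min_le_right _ _, hB, fun z hz => ?_⟩
  have := hball z (Metric.ball_subset_ball (min_le_left _ _) hz)
  rw [zero_add, Real.norm_of_nonneg (by positivity)] at this
  refine le_trans (le_of_eq ?_) this
  congr 2
  simp [FormalMultilinearSeries.partialSum, Finset.sum_range_succ,
    FormalMultilinearSeries.ofScalars, iteratedDeriv_succ, H.map_zero, H.deriv_zero, hv]
  ring

end

end QuasiPower

/-! ### Central limit theorem and Berry–Esseen bound -/

namespace QuasiPower

variable {Ω : Type*} [MeasurableSpace Ω] {P : Measure Ω} {S : ℕ → Ω → ℝ}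
  {ℓ : ℂ → ℂ} {δ C : ℝ}

section

lemma charFun_map_eq (H : QuasiPower P S ℓ δ C) (t : ℕ) (s : ℝ) :
    charFun (P.map fun ω => S t ω / √(t : ℝ)) s =
      complexMGF (S t) P ((s / √(t : ℝ) : ℝ) * Complex.I) := by
  rw [complexMGF_mul_I (H.aemeasurable t), charFun_apply_real, charFun_apply_real,
    integral_map ((H.aemeasurable t).div_const _) (Continuous.aestronglyMeasurable (by fun_prop)),
    integral_map (H.aemeasurable t) (Continuous.aestronglyMeasurable (by fun_prop))]
  congr 1
  ext ω
  push_cast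
  ring_nf

/-- At $z=is/\sqrt t$ one has $t\,\ell(z)=-vs^2/2+w$ with $w=O(|s|^3/\sqrt t)$. Two errors arise:
the relative error $O(|z|)$ of the quasi-power and the factor $e^w-1$. The explicit factor $|s|$ in
the bound is what Esseen's inequality needs near $s=0$. -/
lemma exists_norm_charFun_sub_le [IsProbabilityMeasure P] (H : QuasiPower P S ℓ δ C) {v : ℝ}
    (hv0 : 0 < v) (hv : deriv (deriv ℓ) 0 = v) :
    ∃ c B : ℝ, 0 < c ∧ 0 < B ∧ ∀ t : ℕ, 1 ≤ t → ∀ s : ℝ, |s| ≤ c * √(t : ℝ) →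
      ‖charFun (P.map fun ω => S t ω / √(t : ℝ)) s -
        charFun (gaussianReal 0 (Real.toNNReal v)) s‖ ≤
          B / √(t : ℝ) * (|s| * ((1 + s ^ 2) * Real.exp (-(v / 4) * s ^ 2))) := by
  obtain ⟨r, B, hr, hrδ, hB, hT⟩ := H.exists_norm_sub_sq_le hv
  have hC := H.C_nonneg
  -- The bound $r/2$ keeps $z$ in the Taylor disc. The bound $v/(4B)$ forces $|w|\le vs^2/4$, so
  -- half of the Gaussian exponent survives.
  refine ⟨min (r / 2) (v / (4 * B)), B + C, by positivity, by positivity, fun t ht s hs => ?_⟩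
  have ht0 : (0 : ℝ) < t := by exact_mod_cast ht
  set q := √(t : ℝ) with hq
  have hq0 : 0 < q := Real.sqrt_pos.2 ht0
  have hqq : q ^ 2 = t := Real.sq_sqrt ht0.le
  rw [H.charFun_map_eq, charFun_gaussianReal]
  set z : ℂ := (s / q : ℝ) * Complex.I with hz
  have hzn : ‖z‖ = |s| / q := by
    rw [hz, norm_mul, Complex.norm_I, mul_one, Complex.norm_real, Real.norm_eq_abs, abs_div,
      abs_of_pos hq0]
  have hzc : ‖z‖ ≤ min (r / 2) (v / (4 * B)) := by rw [hzn, div_le_iff₀ hq0]; exact hs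
  have hzr : z ∈ Metric.ball (0 : ℂ) r := by
    rw [mem_ball_zero_iff]
    linarith [hzc.trans (min_le_left _ _)]
  have hzδ : z ∈ Metric.ball (0 : ℂ) δ := Metric.ball_subset_ball hrδ hzr
  set w : ℂ := t * (ℓ z - v * z ^ 2 / 2) with hw
  have hwn : ‖w‖ ≤ B / q * |s| ^ 3 := by
    rw [hw, norm_mul, Complex.norm_natCast]
    calc (t : ℝ) * ‖ℓ z - v * z ^ 2 / 2‖ ≤ t * (B * ‖z‖ ^ 3) := by gcongr; exact hT z hzr
      _ = B / q * |s| ^ 3 := by rw [hzn, ← hqq]; field_simp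
  have hwn2 : ‖w‖ ≤ v / 4 * s ^ 2 := by
    have h1 : |s| / q ≤ v / (4 * B) := hzn ▸ hzc.trans (min_le_right _ _)
    calc ‖w‖ ≤ B / q * |s| ^ 3 := hwn
      _ = B * (|s| / q) * |s| ^ 2 := by field_simp
      _ ≤ B * (v / (4 * B)) * |s| ^ 2 := by gcongr
      _ = v / 4 * s ^ 2 := by rw [sq_abs]; field_simp
  have hexp : (t : ℂ) * ℓ z = ((-(v / 2) * s ^ 2 : ℝ) : ℂ) + w := by
    have hz2 : z ^ 2 * t = -(s : ℂ) ^ 2 := by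
      have hqc : (q : ℂ) ≠ 0 := by exact_mod_cast hq0.ne'
      rw [hz, mul_pow, Complex.I_sq, ← Complex.ofReal_natCast, ← hqq]
      push_cast
      field_simp
    rw [hw, mul_sub]
    push_cast
    linear_combination (v / 2 : ℂ) * hz2
  set E := Real.exp (-(v / 4) * s ^ 2) with hE
  have hEE : Real.exp (-(v / 2) * s ^ 2) * Real.exp ‖w‖ ≤ E := by
    rw [← Real.exp_add, hE, Real.exp_le_exp]; linarith
  have hn1 : ‖Complex.exp (t * ℓ z)‖ ≤ E := by
    rw [hexp, Complex.exp_add, norm_mul, ← Complex.ofReal_exp, Complex.norm_of_nonneg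
      (Real.exp_pos _).le]
    refine le_trans ?_ hEE
    gcongr
    exact Complex.norm_exp_le_exp_norm w
  have hn2 : ‖Complex.exp (t * ℓ z) - Complex.exp ((-(v / 2) * s ^ 2 : ℝ) : ℂ)‖ ≤ ‖w‖ * E := by
    have h1 := Complex.norm_exp_sub_sum_le_norm_mul_exp w 1
    simp only [Finset.range_one, Finset.sum_singleton, pow_zero, Nat.factorial_zero, Nat.cast_one,
      div_one, pow_one] at h1
    rw [hexp, Complex.exp_add, ← mul_sub_one, norm_mul, ← Complex.ofReal_exp,
      Complex.norm_of_nonneg (Real.exp_pos _).le]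
    calc _ ≤ Real.exp (-(v / 2) * s ^ 2) * (‖w‖ * Real.exp ‖w‖) := by gcongr
      _ = ‖w‖ * (Real.exp (-(v / 2) * s ^ 2) * Real.exp ‖w‖) := by ring
      _ ≤ _ := by gcongr
  have hg : (s : ℂ) * ((0 : ℝ) : ℂ) * Complex.I - ((Real.toNNReal v : NNReal) : ℝ) * (s : ℂ) ^ 2 / 2
      = ((-(v / 2) * s ^ 2 : ℝ) : ℂ) := by
    rw [Real.coe_toNNReal _ hv0.le]; push_cast; ring
  have hE0 : 0 ≤ E := (Real.exp_pos _).le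
  have hmain := (norm_sub_le_norm_sub_add_norm_sub (complexMGF (S t) P z) (Complex.exp (t * ℓ z))
    (Complex.exp ((-(v / 2) * s ^ 2 : ℝ) : ℂ)))
  erw [hg]
  refine hmain.trans ?_
  calc _ ≤ C * ‖z‖ * E + (B / q * |s| ^ 3) * E := by
        refine add_le_add ((H.bound t z hzδ).trans ?_) (hn2.trans ?_) <;> gcongr
    _ = (C + B * s ^ 2) / q * (|s| * E) := by rw [hzn, ← sq_abs s]; ring
    _ ≤ ((B + C) * (1 + s ^ 2)) / q * (|s| * E) := by
        gcongr
        nlinarith [mul_nonneg hC (sq_nonneg s)]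
    _ = _ := by ring

/-- Lévy's continuity theorem: any fixed $s$ eventually lies in the range $|s|\le c\sqrt t$, where
the difference of characteristic functions is $O(1/\sqrt t)$. -/
theorem tendstoInDistribution [IsProbabilityMeasure P] (H : QuasiPower P S ℓ δ C) {v : ℝ}
    (hv0 : 0 < v) (hv : deriv (deriv ℓ) 0 = v) :
    TendstoInDistribution (fun (t : ℕ) ω => S t ω / √(t : ℝ)) atTop
      (id : ℝ → ℝ) (fun _ => P) (gaussianReal 0 (Real.toNNReal v)) where
  forall_aemeasurable t := (H.aemeasurable t).div_const _
  tendsto := by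
    refine ProbabilityMeasure.tendsto_iff_tendsto_charFun.2 fun s => ?_
    obtain ⟨c, B, hc, hB, hest⟩ := H.exists_norm_charFun_sub_le hv0 hv
    simp only [ProbabilityMeasure.coe_mk, Measure.map_id]
    rw [tendsto_iff_norm_sub_tendsto_zero]
    have hsq : Tendsto (fun t : ℕ => √(t : ℝ)) atTop atTop :=
      Real.tendsto_sqrt_atTop.comp tendsto_natCast_atTop_atTop
    have hlim : Tendsto (fun t : ℕ => B / √(t : ℝ) *
        (|s| * ((1 + s ^ 2) * Real.exp (-(v / 4) * s ^ 2)))) atTop (𝓝 0) := by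
      have := (hsq.const_div_atTop B).mul_const
        (|s| * ((1 + s ^ 2) * Real.exp (-(v / 4) * s ^ 2)))
      rwa [zero_mul] at this
    refine squeeze_zero' (Eventually.of_forall fun _ => norm_nonneg _) ?_ hlim
    filter_upwards [eventually_ge_atTop 1, hsq.eventually_ge_atTop (|s| / c)] with t ht hts
    refine hest t ht s ?_
    rwa [div_le_iff₀ hc, mul_comm] at hts

lemma gaussianReal_Iic_sub_le {v : NNReal} (hv : v ≠ 0) {x y : ℝ} (hxy : x ≤ y) :
    (gaussianReal 0 v).real (Iic y) - (gaussianReal 0 v).real (Iic x) ≤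
      (√(2 * Real.pi * v))⁻¹ * (y - x) := by
  have hI : ∀ z : ℝ, (gaussianReal 0 v).real (Iic z) = ∫ u in Iic z, gaussianPDFReal 0 v u := by
    intro z
    rw [Measure.real, gaussianReal_apply_eq_integral _ hv, ENNReal.toReal_ofReal]
    exact integral_nonneg fun u => gaussianPDFReal_nonneg _ _ _
  have hint := integrable_gaussianPDFReal 0 v
  rw [hI, hI, intervalIntegral.integral_Iic_sub_Iic hint.integrableOn hint.integrableOn]
  calc ∫ u in x..y, gaussianPDFReal 0 v u ≤ ∫ u in x..y, (√(2 * Real.pi * v))⁻¹ := by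
        refine intervalIntegral.integral_mono_on hxy hint.intervalIntegrable (by simp) fun u _ => ?_
        rw [gaussianPDFReal]
        refine mul_le_of_le_one_right (by positivity) ?_
        rw [Real.exp_le_one_iff]
        have : 0 ≤ (u - 0) ^ 2 / (2 * (v : ℝ)) := by positivity
        rw [neg_div]; linarith
    _ = _ := by rw [intervalIntegral.integral_const, smul_eq_mul, mul_comm]

/-- **Berry–Esseen inequality** for quasi-powers. -/
theorem berry_esseen [IsProbabilityMeasure P] (H : QuasiPower P S ℓ δ C) {v : ℝ} (hv0 : 0 < v)
    (hv : deriv (deriv ℓ) 0 = v) :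
    ∃ D : ℝ, 0 < D ∧ ∀ t : ℕ, 1 ≤ t → ∀ r : ℝ,
      |P.real {ω | S t ω / √(t : ℝ) ≤ r} - (gaussianReal 0 (Real.toNNReal v)).real (Iic r)|
        ≤ D / √(t : ℝ) := by
  obtain ⟨c, B, hc, hB, hest⟩ := H.exists_norm_charFun_sub_le hv0 hv
  have hA := fejer_integral_pos
  set A := ∫ u, fejer u with hAdef
  have hvN : Real.toNNReal v ≠ 0 := (Real.toNNReal_pos.2 hv0).ne'
  set m : ℝ := (√(2 * Real.pi * (Real.toNNReal v : NNReal)))⁻¹ with hm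
  have hm0 : 0 < m := by
    have : (0 : ℝ) < (Real.toNNReal v : NNReal) := by
      rw [Real.coe_toNNReal _ hv0.le]; exact hv0
    positivity
  set ψ : ℝ → ℝ := fun s => (1 + s ^ 2) * Real.exp (-(v / 4) * s ^ 2) with hψ
  have hψ0 : ∀ s, 0 ≤ ψ s := fun s => by simp only [hψ]; positivity
  have hψI : Integrable ψ := by
    have h1 := integrable_exp_neg_mul_sq (b := v / 4) (by positivity)
    have h2 := integrable_rpow_mul_exp_neg_mul_sq (b := v / 4) (by positivity) (s := 2)
      (by norm_num)
    refine (h1.add h2).congr (Eventually.of_forall fun s => ?_)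
    simp only [hψ, Pi.add_apply, Real.rpow_two]
    ring
  have hψc : Continuous ψ := by simp only [hψ]; fun_prop
  set J := ∫ s, ψ s with hJ
  have hJ0 : 0 ≤ J := integral_nonneg hψ0
  refine ⟨4 / 3 * (B * J / A + 64 * m / A / c), by positivity, fun t ht r => ?_⟩
  have ht0 : (0 : ℝ) < t := by exact_mod_cast ht
  set q := √(t : ℝ) with hq
  have hq0 : 0 < q := Real.sqrt_pos.2 ht0
  have hae : AEMeasurable (fun ω => S t ω / q) P := (H.aemeasurable t).div_const _
  have hpm : IsProbabilityMeasure (P.map fun ω => S t ω / q) := Measure.isProbabilityMeasure_map hae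
  have h₁ : Integrable (fun y => y) (P.map fun ω => S t ω / q) :=
    (integrable_map_measure (by fun_prop) hae).2 ((H.integrable t).div_const _)
  have h₂ : Integrable (fun y => y) (gaussianReal 0 (Real.toNNReal v)) :=
    integrable_of_mem_interior_integrableExpSet (by simp)
  -- The cut-off is the largest frequency at which the characteristic function estimate holds. Being
  -- of order $\sqrt t$, it makes the kernel's tail term $O(1/\sqrt t)$ too.
  set T := c * q with hT
  have hT0 : 0 < T := by positivity
  set b : ℝ → ℝ := fun u => B / q * (T * ψ (u * T)) with hb
  have hbc : Continuous b := by simp only [hb]; fun_prop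
  have hφ : ∀ u ∈ Ioc (0 : ℝ) 1, ‖charFun (P.map fun ω => S t ω / q) (u * T) -
      charFun (gaussianReal 0 (Real.toNNReal v)) (u * T)‖ ≤ u * b u := by
    intro u hu
    have habs : |u * T| = u * T := abs_of_pos (mul_pos hu.1 hT0)
    refine (hest t ht (u * T) ?_).trans (le_of_eq ?_)
    · rw [habs]
      exact mul_le_of_le_one_left hT0.le hu.2
    · rw [habs]
      simp only [hb, hψ]
      ring
  have hes := esseen_smoothing _ _ h₁ h₂ hm0
    (fun x y hxy => gaussianReal_Iic_sub_le hvN hxy) hT0 b (hbc.intervalIntegrable _ _) hφ r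
  have hbint : ∫ u in (0 : ℝ)..1, b u ≤ B / q * J := by
    simp only [hb]
    rw [intervalIntegral.integral_const_mul, intervalIntegral.integral_const_mul,
      intervalIntegral.mul_integral_comp_mul_right (f := ψ)]
    gcongr
    rw [zero_mul, one_mul, intervalIntegral.integral_of_le hT0.le]
    exact setIntegral_le_integral hψI (Eventually.of_forall hψ0)
  rw [map_measureReal_apply_of_aemeasurable hae measurableSet_Iic] at hes
  refine hes.trans ?_
  calc _ ≤ 4 / 3 * (B / q * J / A + 64 * m / A / T) := by gcongr
    _ = _ := by rw [hT]; field_simp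

end

end QuasiPower

/-! ### Legendre duality on the line -/

/-- The Legendre transform of `∫ ψ` for an increasing homeomorphism `ψ` of the line fixing `0`. -/
lemma exists_legendre_rate {ψ : ℝ → ℝ} (hψc : Continuous ψ) (hψm : StrictMono ψ)
    (hψs : Function.Surjective ψ) (hψ0 : ψ 0 = 0) :
    ∃ R : ℝ → ℝ, (∀ x, 0 ≤ R x) ∧ Continuous R ∧ StrictConvexOn ℝ univ R ∧
      (∀ x, R x = 0 ↔ x = 0) ∧ ∀ z, R (ψ z) = z * ψ z - ∫ u in (0 : ℝ)..z, ψ u := by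
  set Λ : ℝ → ℝ := fun z => ∫ u in (0 : ℝ)..z, ψ u with hΛ
  set e := StrictMono.orderIsoOfSurjective ψ hψm hψs with he
  set ζ : ℝ → ℝ := fun x => e.symm x with hζ
  have hψζ : ∀ x, ψ (ζ x) = x := fun x => e.apply_symm_apply x
  have hζψ : ∀ z, ζ (ψ z) = z := fun x => e.symm_apply_apply x
  have hζc : Continuous ζ := e.symm.continuous
  have hζm : StrictMono ζ := e.symm.strictMono
  have htan : ∀ z w, Λ z + ψ z * (w - z) ≤ Λ w := by
    intro z w
    have hi : ∀ x y, IntervalIntegrable ψ volume x y := fun x y => hψc.intervalIntegrable x y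
    have h1 : Λ w - Λ z = ∫ u in z..w, ψ u := intervalIntegral.integral_interval_sub_left
      (hi _ _) (hi _ _)
    have h2 : ψ z * (w - z) = ∫ u in z..w, ψ z := by simp [mul_comm]
    have h3 : ∫ u in z..w, ψ z ≤ ∫ u in z..w, ψ u := by
      rcases le_total z w with h | h
      · exact intervalIntegral.integral_mono_on h (by simp) (hi _ _)
          fun u hu => hψm.monotone hu.1
      · rw [intervalIntegral.integral_symm w z, intervalIntegral.integral_symm w z]
        exact neg_le_neg (intervalIntegral.integral_mono_on h (hi _ _) (by simp)
          fun u hu => hψm.monotone hu.2)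
    linarith
  set R : ℝ → ℝ := fun x => ζ x * x - Λ (ζ x) with hR
  -- Duality: the tangent inequality for $\int\psi$ at `ζ y` becomes the subgradient inequality for
  -- `R` at `x`.
  have hsub : ∀ x y, R x + ζ x * (y - x) ≤ R y := by
    intro x y
    have := htan (ζ y) (ζ x)
    rw [hψζ] at this
    simp only [hR]
    linarith
  -- The subgradient inequalities at `x` and at `y` squeeze the remainder by
  -- $|\zeta(y)-\zeta(x)||y-x|$, so continuity of `ζ` suffices; `ψ` need not be differentiable.
  have hder : ∀ x, HasDerivAt R (ζ x) x := by
    intro x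
    rw [hasDerivAt_iff_isLittleO]
    rw [Asymptotics.isLittleO_iff]
    intro c hc
    have hev : ∀ᶠ y in 𝓝 x, |ζ y - ζ x| < c := by
      have := Metric.continuous_iff'.1 hζc x c hc
      simpa only [Real.dist_eq] using this
    filter_upwards [hev] with y hy
    have h1 := hsub x y
    have h2 := hsub y x
    have h3 : |R y - R x - (y - x) * ζ x| ≤ |ζ y - ζ x| * |y - x| := by
      rw [← abs_mul, abs_of_nonneg (by linarith)]
      refine le_trans ?_ (le_abs_self _)
      linarith
    simp only [Real.norm_eq_abs, smul_eq_mul]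
    exact h3.trans (by gcongr)
  have hζ0 : ζ 0 = 0 := by rw [← hψ0, hζψ, hψ0]
  have hR0 : R 0 = 0 := by simp [hR, hζ0, hΛ]
  have hnn : ∀ x, 0 ≤ R x := by
    intro x
    have := hsub 0 x
    rw [hζ0, hR0] at this
    linarith
  have hcont : Continuous R := continuous_iff_continuousAt.2 fun x => (hder x).continuousAt
  have hconv : StrictConvexOn ℝ univ R := by
    refine StrictMono.strictConvexOn_univ_of_deriv hcont ?_
    have : deriv R = ζ := funext fun x => (hder x).deriv
    rw [this]
    exact hζm
  refine ⟨R, hnn, hcont, hconv, fun x => ⟨fun hx => ?_, fun hx => hx ▸ hR0⟩, fun z => ?_⟩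
  · by_contra hne
    have := hconv.2 (mem_univ x) (mem_univ 0) hne (by norm_num : (0 : ℝ) < 1 / 2)
      (by norm_num : (0 : ℝ) < 1 / 2) (by norm_num)
    rw [hx, hR0] at this
    simp only [smul_eq_mul, mul_zero, add_zero] at this
    linarith [hnn (1 / 2 * x)]
  · simp only [hR, hζψ, hΛ]

/-- A strictly increasing continuous function on `[0, a]` extends to an increasing homeomorphism
of the line. -/
lemma exists_strictMono_extension {f : ℝ → ℝ} {a : ℝ} (ha : 0 < a)
    (hc : ContinuousOn f (Icc 0 a)) (hm : StrictMonoOn f (Icc 0 a)) :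
    ∃ ψ : ℝ → ℝ, Continuous ψ ∧ StrictMono ψ ∧ Function.Surjective ψ ∧
      ∀ z ∈ Icc 0 a, ψ z = f z := by
  set p : ℝ → ℝ := fun z => max 0 (min a z) with hp
  have hpm : ∀ z, p z ∈ Icc 0 a := fun z =>
    ⟨le_max_left _ _, max_le ha.le (min_le_left _ _)⟩
  have hpc : Continuous p := by fun_prop
  have hpmono : Monotone p := fun x y h => max_le_max le_rfl (min_le_min le_rfl h)
  have hp1 : ∀ x y, x ≤ y → p y - p x ≤ y - x := by
    intro x y h
    simp only [hp]
    rcases max_cases 0 (min a x) with h1 | h1 <;> rcases max_cases 0 (min a y) with h2 | h2 <;>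
      rcases min_cases a x with h3 | h3 <;> rcases min_cases a y with h4 | h4 <;> linarith
  have hfp : Continuous fun z => f (p z) := hc.comp_continuous hpc hpm
  -- Outside $[0,a]$ the extension continues with slope one.
  have hψc : Continuous fun z => f (p z) + (z - p z) := hfp.add (continuous_id.sub hpc)
  refine ⟨fun z => f (p z) + (z - p z), hψc, ?_, ?_, ?_⟩
  · intro x y hxy
    have h1 := hp1 x y hxy.le
    rcases (hpmono hxy.le).eq_or_lt with h | h
    · simp only [h]; linarith
    · have := hm (hpm x) (hpm y) h
      simp only; linarith
  · have hmono := hm.monotoneOn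
    have hz : ∀ z, f 0 ≤ f (p z) ∧ f (p z) ≤ f a := fun z =>
      ⟨hmono ⟨le_rfl, ha.le⟩ (hpm z) (hpm z).1, hmono (hpm z) ⟨ha.le, le_rfl⟩ (hpm z).2⟩
    refine hψc.surjective ?_ ?_
    · refine tendsto_atTop_mono (f := fun z => z + (f 0 - a)) (fun z => ?_)
        (tendsto_atTop_add_const_right _ _ tendsto_id)
      linarith [(hz z).1, (hpm z).2]
    · refine tendsto_atBot_mono (f := fun z => z + f a) (fun z => ?_)
        (tendsto_atBot_add_const_right _ _ tendsto_id)
      linarith [(hz z).2, (hpm z).1]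
  · intro z hz
    have : p z = z := by
      simp only [hp]; rw [min_eq_right hz.2, max_eq_right hz.1]
    simp only [this, sub_self, add_zero]

/-! ### Large deviations -/

/-- Split $e^{yX}$ according to $X\le\alpha$, $\alpha<X\le\beta$ and $X>\beta$. The outer pieces are
compared with the exponentials at `x` and `z`. This is Cramér's tilting argument without a change of
measure. -/
lemma measureReal_lower_bound {Ω : Type*} [MeasurableSpace Ω] {P : Measure Ω}
    [IsProbabilityMeasure P] {X : Ω → ℝ} (hX : AEMeasurable X P)
    (hint : ∀ x, Integrable (fun ω => Real.exp (x * X ω)) P) {x y z α β : ℝ}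
    (hxy : x ≤ y) (hyz : y ≤ z) (hy : 0 ≤ y) :
    mgf X P y ≤ Real.exp ((y - x) * α) * mgf X P x + Real.exp (y * β) * P.real {ω | α < X ω} +
      Real.exp (-(z - y) * β) * mgf X P z := by
  have hms : NullMeasurableSet {ω | α < X ω} P := nullMeasurableSet_lt aemeasurable_const hX
  have hind : Integrable ({ω | α < X ω}.indicator (1 : Ω → ℝ)) P :=
    (integrable_const (1 : ℝ)).indicator₀ hms
  have hP : ∫ ω, {ω | α < X ω}.indicator (1 : Ω → ℝ) ω ∂P = P.real {ω | α < X ω} := by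
    rw [integral_indicator₀ hms]
    simp
  have hle : mgf X P y ≤ ∫ ω, (Real.exp ((y - x) * α) * Real.exp (x * X ω) +
      Real.exp (y * β) * {ω | α < X ω}.indicator (1 : Ω → ℝ) ω +
      Real.exp (-(z - y) * β) * Real.exp (z * X ω)) ∂P := by
    refine integral_mono (hint y) ((((hint x).const_mul _).add (hind.const_mul _)).add
      ((hint z).const_mul _)) fun ω => ?_
    have e1 : 0 ≤ Real.exp ((y - x) * α) * Real.exp (x * X ω) := by positivity
    have e2 : 0 ≤ Real.exp (y * β) * {ω | α < X ω}.indicator (1 : Ω → ℝ) ω :=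
      mul_nonneg (Real.exp_pos _).le (indicator_nonneg (fun _ _ => zero_le_one) _)
    have e3 : 0 ≤ Real.exp (-(z - y) * β) * Real.exp (z * X ω) := by positivity
    rcases le_or_gt (X ω) α with h1 | h1
    · have : Real.exp (y * X ω) ≤ Real.exp ((y - x) * α) * Real.exp (x * X ω) := by
        rw [← Real.exp_add, Real.exp_le_exp]
        nlinarith
      simp only at e2 ⊢
      linarith
    · rcases le_or_gt (X ω) β with h2 | h2
      · have : Real.exp (y * X ω) ≤
            Real.exp (y * β) * {ω | α < X ω}.indicator (1 : Ω → ℝ) ω := by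
          rw [indicator_of_mem (show ω ∈ {ω | α < X ω} from h1), Pi.one_apply, mul_one,
            Real.exp_le_exp]
          gcongr
        simp only at e2 ⊢
        linarith
      · have : Real.exp (y * X ω) ≤ Real.exp (-(z - y) * β) * Real.exp (z * X ω) := by
          rw [← Real.exp_add, Real.exp_le_exp]
          nlinarith
        simp only at e2 ⊢
        linarith
  have h12 : Integrable (fun ω => Real.exp ((y - x) * α) * Real.exp (x * X ω) +
      Real.exp (y * β) * {ω | α < X ω}.indicator (1 : Ω → ℝ) ω) P :=
    ((hint x).const_mul _).add (hind.const_mul _)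
  rw [integral_add h12 ((hint z).const_mul _), integral_add ((hint x).const_mul _) (hind.const_mul _), integral_const_mul,
    integral_const_mul, integral_const_mul, hP] at hle
  exact hle

/-- A local Gärtner–Ellis theorem on the line. -/
theorem tendsto_log_measureReal {Ω : Type*} [MeasurableSpace Ω] {P : Measure Ω}
    [IsProbabilityMeasure P] {S : ℕ → Ω → ℝ} (hS : ∀ t, AEMeasurable (S t) P)
    (hint : ∀ t x, Integrable (fun ω => Real.exp (x * S t ω)) P) {a : ℝ} {Λ ψ : ℝ → ℝ}
    (hlow : ∀ t : ℕ, ∀ x ∈ Icc 0 a, 1 / 2 * Real.exp (t * Λ x) ≤ mgf (S t) P x)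
    (hupp : ∀ t : ℕ, ∀ x ∈ Icc 0 a, mgf (S t) P x ≤ 2 * Real.exp (t * Λ x))
    (hΛc : ContinuousOn Λ (Icc 0 a)) (hψc : ContinuousOn ψ (Icc 0 a))
    (htan : ∀ x ∈ Icc 0 a, ∀ y ∈ Icc 0 a, x ≠ y → Λ x + ψ x * (y - x) < Λ y)
    {z : ℝ} (hz0 : 0 < z) (hza : z < a) :
    Tendsto (fun t : ℕ => (1 / (t : ℝ)) * Real.log (P.real {ω | (t : ℝ) * ψ z < S t ω}))
      atTop (𝓝 (-(z * ψ z - Λ z))) := by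
  have hzm : z ∈ Icc 0 a := ⟨hz0.le, hza.le⟩
  have hnb : Icc 0 a ∈ 𝓝 z := Icc_mem_nhds hz0 hza
  have hlower : ∀ κ > 0, ∃ γ : ℝ, γ < z * ψ z - Λ z + κ ∧ ∀ᶠ t : ℕ in atTop,
      1 / 4 * Real.exp (-(t * γ)) ≤ P.real {ω | (t : ℝ) * ψ z < S t ω} := by
    intro κ hκ
    -- The tilt is the midpoint $y$ of $z$ and some $s>z$, and `φ s` is the resulting cost. It tends
    -- to the rate as $s\downarrow z$.
    set φ : ℝ → ℝ := fun s => (z + s) / 2 * ψ s - Λ ((z + s) / 2) with hφ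
    have hφc : ContinuousAt φ z := by
      have h1 : ContinuousAt (fun s : ℝ => (z + s) / 2) z := by fun_prop
      have h2 : ContinuousAt (fun s => Λ ((z + s) / 2)) z := by
        refine ContinuousAt.comp (g := Λ) ?_ h1
        rw [show (z + z) / 2 = z by ring]
        exact hΛc.continuousAt hnb
      exact (h1.mul (hψc.continuousAt hnb)).sub h2
    have hφz : φ z = z * ψ z - Λ z := by
      simp only [hφ]; rw [show (z + z) / 2 = z by ring]
    have hev : ∀ᶠ s in 𝓝[>] z, φ s < z * ψ z - Λ z + κ ∧ s < a ∧ z < s := by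
      have h1 : ∀ᶠ s in 𝓝 z, φ s < z * ψ z - Λ z + κ :=
        hφc.eventually_lt continuousAt_const (by rw [hφz]; linarith)
      have h2 : ∀ᶠ s in 𝓝 z, s < a := eventually_lt_nhds hza
      filter_upwards [nhdsWithin_le_nhds h1, nhdsWithin_le_nhds h2, self_mem_nhdsWithin]
        with s h1 h2 h3 using ⟨h1, h2, h3⟩
    obtain ⟨s, hs1, hsa, hzs⟩ := hev.exists
    set y := (z + s) / 2 with hy
    have hzy : z < y := by rw [hy]; linarith
    have hys : y < s := by rw [hy]; linarith
    have hym : y ∈ Icc 0 a := ⟨by linarith, by linarith⟩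
    have hsm : s ∈ Icc 0 a := ⟨by linarith, by linarith⟩
    have hg1 := htan z hzm y hym hzy.ne
    have hg2 := htan s hsm y hym hys.ne'
    refine ⟨y * ψ s - Λ y, hs1, ?_⟩
    -- The gaps between `Λ` and its tangents at $z$ and $s$ are positive by strict convexity. They
    -- make both outer pieces exponentially smaller than the middle one.
    set c1 := Λ y - (Λ z + ψ z * (y - z)) with hc1
    set c2 := Λ y - (Λ s + ψ s * (y - s)) with hc2
    have hc1p : 0 < c1 := by rw [hc1]; linarith
    have hc2p : 0 < c2 := by rw [hc2]; linarith
    have hlim : ∀ c : ℝ, 0 < c → ∀ᶠ t : ℕ in atTop, Real.exp (-(t * c)) < 1 / 16 := by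
      intro c hc
      have h1 : Tendsto (fun t : ℕ => -((t : ℝ) * c)) atTop atBot :=
        tendsto_neg_atTop_atBot.comp (tendsto_natCast_atTop_atTop.atTop_mul_const hc)
      exact (Real.tendsto_exp_atBot.comp h1).eventually_lt_const (by norm_num)
    filter_upwards [hlim c1 hc1p, hlim c2 hc2p] with t ht1 ht2
    have hb := measureReal_lower_bound (hS t) (hint t) (x := z) (y := y) (z := s)
      (α := t * ψ z) (β := t * ψ s) hzy.le hys.le hym.1
    have hM := hlow t y hym
    have hMz := hupp t z hzm
    have hMs := hupp t s hsm
    set p := P.real {ω | (t : ℝ) * ψ z < S t ω} with hp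
    have q1 : Real.exp ((y - z) * (t * ψ z)) * mgf (S t) P z ≤
        2 * (Real.exp (t * Λ y) * Real.exp (-(t * c1))) := by
      calc _ ≤ Real.exp ((y - z) * (t * ψ z)) * (2 * Real.exp (t * Λ z)) := by gcongr
        _ = _ := by
          rw [mul_left_comm, ← Real.exp_add, ← Real.exp_add, hc1]
          congr 2; ring
    have q2 : Real.exp (-(s - y) * (t * ψ s)) * mgf (S t) P s ≤
        2 * (Real.exp (t * Λ y) * Real.exp (-(t * c2))) := by
      calc _ ≤ Real.exp (-(s - y) * (t * ψ s)) * (2 * Real.exp (t * Λ s)) := by gcongr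
        _ = _ := by
          rw [mul_left_comm, ← Real.exp_add, ← Real.exp_add, hc2]
          congr 2; ring
    have hEpos := Real.exp_pos (t * Λ y)
    -- The moment generating function is at least one half of the exponential and each outer piece
    -- is at most $2/16$ of it, which leaves one quarter.
    have q3 : 1 / 4 * Real.exp (t * Λ y) ≤ Real.exp (y * (t * ψ s)) * p := by
      nlinarith
    have q4 : Real.exp (-(t * (y * ψ s - Λ y))) =
        Real.exp (t * Λ y) * Real.exp (-(y * (t * ψ s))) := by
      rw [← Real.exp_add]; congr 1; ring
    rw [q4, ← mul_assoc]
    calc _ ≤ Real.exp (y * (t * ψ s)) * p * Real.exp (-(y * (t * ψ s))) := by gcongr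
      _ = p := by
        rw [mul_right_comm, ← Real.exp_add, add_neg_cancel, Real.exp_zero, one_mul]
  have hupper : ∀ t : ℕ, P.real {ω | (t : ℝ) * ψ z < S t ω} ≤
      2 * Real.exp (-(t * (z * ψ z - Λ z))) := by
    intro t
    have h1 : P.real {ω | (t : ℝ) * ψ z < S t ω} ≤ P.real {ω | (t : ℝ) * ψ z ≤ S t ω} :=
      measureReal_mono fun ω (hω : (t : ℝ) * ψ z < S t ω) => hω.le
    refine h1.trans ((measure_ge_le_exp_mul_mgf _ hz0.le (hint t z)).trans ?_)
    calc _ ≤ Real.exp (-z * (t * ψ z)) * (2 * Real.exp (t * Λ z)) := by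
          gcongr; exact hupp t z hzm
      _ = _ := by
        rw [mul_left_comm, ← Real.exp_add]; congr 2; ring
  have hconst : ∀ c : ℝ, Tendsto (fun t : ℕ => (1 / (t : ℝ)) * c) atTop (𝓝 0) := by
    intro c
    simpa using tendsto_one_div_atTop_nhds_zero_nat.mul_const c
  set R := z * ψ z - Λ z with hR
  refine tendsto_order.2 ⟨fun b hb => ?_, fun b hb => ?_⟩
  · obtain ⟨γ, hγ, hev⟩ := hlower (-b - R) (by linarith)
    have h1 : ∀ᶠ t : ℕ in atTop, b + γ < (1 / (t : ℝ)) * Real.log (1 / 4) :=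
      (hconst _).eventually_const_lt (by linarith)
    filter_upwards [hev, h1, eventually_gt_atTop 0] with t ht h1 ht0
    have ht' : (0 : ℝ) < t := by exact_mod_cast ht0
    have h2 := Real.log_le_log (by positivity) ht
    rw [Real.log_mul (by norm_num) (Real.exp_pos _).ne', Real.log_exp] at h2
    have h3 : (1 / (t : ℝ)) * (Real.log (1 / 4) + -(t * γ)) ≤
        (1 / (t : ℝ)) * Real.log (P.real {ω | (t : ℝ) * ψ z < S t ω}) := by gcongr
    have h4 : (1 / (t : ℝ)) * (Real.log (1 / 4) + -(t * γ)) =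
        (1 / (t : ℝ)) * Real.log (1 / 4) - γ := by field_simp; ring
    linarith
  -- Here the lower bound only serves to make the probability positive, so that its logarithm is
  -- monotone.
  · obtain ⟨γ, -, hev⟩ := hlower 1 one_pos
    have h1 : ∀ᶠ t : ℕ in atTop, (1 / (t : ℝ)) * Real.log 2 < b + R :=
      (hconst _).eventually_lt_const (by linarith)
    filter_upwards [hev, h1, eventually_gt_atTop 0] with t ht h1 ht0
    have ht' : (0 : ℝ) < t := by exact_mod_cast ht0
    have hpos : 0 < P.real {ω | (t : ℝ) * ψ z < S t ω} := lt_of_lt_of_le (by positivity) ht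
    have h2 := Real.log_le_log hpos (hupper t)
    rw [Real.log_mul (by norm_num) (Real.exp_pos _).ne', Real.log_exp] at h2
    have h3 : (1 / (t : ℝ)) * Real.log (P.real {ω | (t : ℝ) * ψ z < S t ω}) ≤
        (1 / (t : ℝ)) * (Real.log 2 + -(t * R)) := by gcongr
    have h4 : (1 / (t : ℝ)) * (Real.log 2 + -(t * R)) =
        (1 / (t : ℝ)) * Real.log 2 - R := by field_simp; ring
    linarith

namespace QuasiPower

variable {Ω : Type*} [MeasurableSpace Ω] {P : Measure Ω} {S : ℕ → Ω → ℝ}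
  {ℓ : ℂ → ℂ} {δ C : ℝ}

lemma mgf_bounds (H : QuasiPower P S ℓ δ C) (t : ℕ) {x : ℝ} (hx : |x| < δ) (hxC : C * |x| ≤ 1 / 2) :
    1 / 2 * Real.exp (t * (ℓ x).re) ≤ mgf (S t) P x ∧
      mgf (S t) P x ≤ 2 * Real.exp (t * (ℓ x).re) := by
  have hball : (x : ℂ) ∈ Metric.ball (0 : ℂ) δ := by
    rwa [mem_ball_zero_iff, Complex.norm_real, Real.norm_eq_abs]
  have h := H.bound t x hball
  rw [complexMGF_ofReal, Complex.norm_exp, Complex.norm_real, Real.norm_eq_abs] at h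
  have hre : ((t : ℂ) * ℓ x).re = t * (ℓ x).re := by simp
  rw [hre] at h
  have hE := Real.exp_pos (t * (ℓ x).re)
  have hn : ‖Complex.exp (t * ℓ x)‖ = Real.exp (t * (ℓ x).re) := by rw [Complex.norm_exp, hre]
  have hm : ‖(mgf (S t) P x : ℂ)‖ = mgf (S t) P x := by
    rw [Complex.norm_of_nonneg mgf_nonneg]
  have h1 := norm_sub_norm_le (mgf (S t) P x : ℂ) (Complex.exp (t * ℓ x))
  have h2 := norm_sub_norm_le (Complex.exp (t * ℓ x)) (mgf (S t) P x : ℂ)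
  rw [norm_sub_rev] at h2
  rw [hm, hn] at h1 h2
  have h3 : C * |x| * Real.exp (t * (ℓ x).re) ≤ 1 / 2 * Real.exp (t * (ℓ x).re) := by gcongr
  constructor <;> linarith

/-- **Large deviations** for quasi-powers. -/
theorem large_deviations [IsProbabilityMeasure P] (H : QuasiPower P S ℓ δ C) {v : ℝ} (hv0 : 0 < v)
    (hv : deriv (deriv ℓ) 0 = v) :
    ∃ R : ℝ → ℝ, (∀ x, 0 ≤ R x) ∧ Continuous R ∧ StrictConvexOn ℝ univ R ∧
      (∀ x, R x = 0 ↔ x = 0) ∧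
      ∃ ε₀ : ℝ, 0 < ε₀ ∧ ∀ ε : ℝ, 0 < ε → ε < ε₀ →
        Tendsto (fun t : ℕ => (1 / (t : ℝ)) *
            Real.log (P.real {ω | (t : ℝ) * ε < S t ω})) atTop (𝓝 (-R ε)) := by
  have hδ := H.δ_pos
  have hC := H.C_nonneg
  have hcont2 : ContinuousAt (fun z => (deriv (deriv ℓ) z).re) 0 :=
    Complex.continuous_re.continuousAt.comp H.analyticAt_zero.deriv.deriv.continuousAt
  have hpos : ∀ᶠ z : ℂ in 𝓝 0, 0 < (deriv (deriv ℓ) z).re := by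
    refine continuousAt_const.eventually_lt hcont2 ?_
    rw [hv]; simpa using hv0
  obtain ⟨r, hr, hball⟩ := Metric.eventually_nhds_iff_ball.1 hpos
  -- On $[0,a]$ the function $\ell$ is holomorphic with $\operatorname{Re}\ell''>0$, and $Ca\le1/2$
  -- bounds the relative error by one half.
  set a : ℝ := min (min (r / 2) (δ / 2)) (1 / (2 * (C + 1))) with ha
  have ha0 : 0 < a := by positivity
  have har : a < r := lt_of_le_of_lt ((min_le_left _ _).trans (min_le_left _ _)) (by linarith)
  have haδ : a < δ := lt_of_le_of_lt ((min_le_left _ _).trans (min_le_right _ _)) (by linarith)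
  have haC : C * a ≤ 1 / 2 := by
    calc C * a ≤ C * (1 / (2 * (C + 1))) := by gcongr; exact min_le_right _ _
      _ ≤ 1 / 2 := by
        rw [mul_one_div, div_le_div_iff₀ (by positivity) (by norm_num)]; linarith
  have habs : ∀ x ∈ Icc 0 a, |x| ≤ a := fun x hx => by rw [abs_of_nonneg hx.1]; exact hx.2
  have hmem : ∀ ρ : ℝ, a < ρ → ∀ x ∈ Icc 0 a, (x : ℂ) ∈ Metric.ball (0 : ℂ) ρ := by
    intro ρ hρ x hx
    rw [mem_ball_zero_iff, Complex.norm_real, Real.norm_eq_abs]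
    linarith [habs x hx]
  set Λ : ℝ → ℝ := fun x => (ℓ x).re with hΛ
  set f : ℝ → ℝ := fun x => (deriv ℓ x).re with hf
  have hd1 : ∀ x ∈ Icc 0 a, HasDerivAt Λ (f x) x := fun x hx =>
    (H.analyticAt (hmem δ haδ x hx)).differentiableAt.hasDerivAt.real_of_complex
  have hd2 : ∀ x ∈ Icc 0 a, HasDerivAt f (deriv (deriv ℓ) x).re x := fun x hx =>
    (H.analyticAt (hmem δ haδ x hx)).deriv.differentiableAt.hasDerivAt.real_of_complex
  have hfc : ContinuousOn f (Icc 0 a) := fun x hx => (hd2 x hx).continuousAt.continuousWithinAt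
  have hΛc : ContinuousOn Λ (Icc 0 a) := fun x hx => (hd1 x hx).continuousAt.continuousWithinAt
  have hfm : StrictMonoOn f (Icc 0 a) := by
    refine strictMonoOn_of_deriv_pos (convex_Icc 0 a) hfc fun x hx => ?_
    have hx' := interior_subset hx
    rw [(hd2 x hx').deriv]
    exact hball _ (hmem r har x hx')
  -- The extension makes the rate finite and strictly convex on the whole line. Only its values at
  -- `ψ z` with $0<z<a$ enter the limit.
  obtain ⟨ψ, hψc, hψm, hψs, hψf⟩ := exists_strictMono_extension ha0 hfc hfm
  have h0m : (0 : ℝ) ∈ Icc 0 a := ⟨le_rfl, ha0.le⟩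
  have hψ0 : ψ 0 = 0 := by
    rw [hψf 0 h0m]; simp [hf, H.deriv_zero]
  obtain ⟨R, hR0, hRc, hRs, hRz, hRψ⟩ := exists_legendre_rate hψc hψm hψs hψ0
  have hΛint : ∀ x ∈ Icc 0 a, ∀ y ∈ Icc 0 a, ∫ u in x..y, ψ u = Λ y - Λ x := by
    intro x hx y hy
    have hsub : uIcc x y ⊆ Icc 0 a := by
      rw [← uIcc_of_le ha0.le] at hx hy ⊢
      exact uIcc_subset_uIcc hx hy
    refine intervalIntegral.integral_eq_sub_of_hasDerivAt (fun u hu => ?_)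
      (hψc.intervalIntegrable _ _)
    rw [hψf u (hsub hu)]
    exact hd1 u (hsub hu)
  have htan : ∀ x ∈ Icc 0 a, ∀ y ∈ Icc 0 a, x ≠ y → Λ x + ψ x * (y - x) < Λ y := by
    have hconv : StrictConvexOn ℝ (Icc 0 a) Λ := by
      refine StrictMonoOn.strictConvexOn_of_deriv (convex_Icc 0 a) hΛc ?_
      refine (hfm.mono interior_subset).congr fun x hx => ?_
      exact (hd1 x (interior_subset hx)).deriv.symm
    intro x hx y hy hxy
    rw [hψf x hx]
    rcases lt_or_gt_of_ne hxy with h | h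
    · have := StrictConvexOn.lt_slope_of_hasDerivAt hconv hx hy h (hd1 x hx)
      rw [slope_def_field, lt_div_iff₀ (by linarith)] at this
      linarith
    · have := StrictConvexOn.slope_lt_of_hasDerivAt hconv hy hx h (hd1 x hx)
      rw [slope_def_field, div_lt_iff₀ (by linarith)] at this
      linarith
  have hint : ∀ t x, Integrable (fun ω => Real.exp (x * S t ω)) P := by
    intro t x
    have : x ∈ integrableExpSet (S t) P := by rw [H.integrableExpSet_eq]; trivial
    exact this
  have hb := fun (t : ℕ) x (hx : x ∈ Icc 0 a) => H.mgf_bounds t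
    (lt_of_le_of_lt (habs x hx) haδ) ((mul_le_mul_of_nonneg_left (habs x hx) hC).trans haC)
  refine ⟨R, hR0, hRc, hRs, hRz, ψ a, by rw [← hψ0]; exact hψm ha0, fun ε hε hεa => ?_⟩
  obtain ⟨z, rfl⟩ := hψs ε
  have hz0 : 0 < z := by rwa [← hψ0, hψm.lt_iff_lt] at hε
  have hza : z < a := hψm.lt_iff_lt.1 hεa
  have := tendsto_log_measureReal H.aemeasurable hint (fun t x hx => (hb t x hx).1)
    (fun t x hx => (hb t x hx).2) hΛc hψc.continuousOn htan hz0 hza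
  rw [hRψ, hΛint 0 h0m z ⟨hz0.le, hza.le⟩]
  simpa [hΛ, H.map_zero] using this

end QuasiPower

/-! ### Perturbation of operators with a spectral gap -/

/-- `U` fixes the unit vector `e`, preserves the functional `m` and contracts its kernel
exponentially fast. -/
structure SpectralGap {B : Type*} [NormedAddCommGroup B] [NormedSpace ℂ B] (U : B →L[ℂ] B)
    (m : B →L[ℂ] ℂ) (e : B) (C ρ : ℝ) : Prop where
  norm_unit : ‖e‖ ≤ 1
  map_unit : m e = 1
  fix_unit : U e = e
  map_comp : ∀ f, m (U f) = m f
  norm_le : ∀ f, ‖U f‖ ≤ ‖f‖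
  norm_map_le : ∀ f, ‖m f‖ ≤ ‖f‖
  C_pos : 0 < C
  ρ_nonneg : 0 ≤ ρ
  ρ_lt_one : ρ < 1
  decay : ∀ (n : ℕ) (f : B), m f = 0 → ‖(U ^ n) f‖ ≤ C * ρ ^ n * ‖f‖

namespace SpectralGap

variable {B : Type*} [NormedAddCommGroup B] [NormedSpace ℂ B] {U : B →L[ℂ] B}
  {m : B →L[ℂ] ℂ} {e : B} {C ρ : ℝ}

/-- The normalized action of `L` on vectors with `m f = 1`. -/
def normalize (m : B →L[ℂ] ℂ) (L : B →L[ℂ] B) (f : B) : B := (m (L f))⁻¹ • L f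

section Step

variable {L : B →L[ℂ] B} {η : ℝ}

lemma norm_map_sub_one_le (H : SpectralGap U m e C ρ)
    (hL : ∀ f, ‖L f - U f‖ ≤ η * ‖f‖) {f : B} (hf : m f = 1) :
    ‖m (L f) - 1‖ ≤ η * ‖f‖ := by
  have : m (L f) - 1 = m (L f - U f) := by rw [map_sub, H.map_comp, hf]
  rw [this]
  exact (H.norm_map_le _).trans (hL f)

lemma map_ne_zero (H : SpectralGap U m e C ρ) (hη : η ≤ 1 / 4)
    (hL : ∀ f, ‖L f - U f‖ ≤ η * ‖f‖) {f : B} (hf : m f = 1) (hf2 : ‖f‖ ≤ 2) :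
    1 / 2 ≤ ‖m (L f)‖ := by
  have h1 := H.norm_map_sub_one_le hL hf
  have h2 := norm_sub_norm_le (1 : ℂ) (1 - m (L f))
  rw [sub_sub_cancel, norm_sub_rev, norm_one] at h2
  have h3 : η * ‖f‖ ≤ 1 / 4 * 2 := by gcongr
  linarith

lemma map_normalize (L : B →L[ℂ] B) {f : B} (hf : 1 / 2 ≤ ‖m (L f)‖) :
    m (normalize m L f) = 1 := by
  have : m (L f) ≠ 0 := by
    intro h; rw [h, norm_zero] at hf; norm_num at hf
  rw [normalize, map_smul, smul_eq_mul, inv_mul_cancel₀ this]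

lemma norm_normalize_le (H : SpectralGap U m e C ρ) (hη : η ≤ 1 / 4)
    (hL : ∀ f, ‖L f - U f‖ ≤ η * ‖f‖) {f : B} (hf : m f = 1) (hf2 : ‖f‖ ≤ 2) :
    ‖normalize m L f‖ ≤ 5 := by
  have h1 := H.map_ne_zero hη hL hf hf2
  have h2 : ‖L f‖ ≤ 5 / 2 := by
    calc ‖L f‖ = ‖(L f - U f) + U f‖ := by rw [sub_add_cancel]
      _ ≤ ‖L f - U f‖ + ‖U f‖ := norm_add_le _ _
      _ ≤ η * ‖f‖ + ‖f‖ := add_le_add (hL f) (H.norm_le f)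
      _ ≤ 1 / 4 * 2 + 2 := by gcongr
      _ = 5 / 2 := by norm_num
  have h3 : ‖(m (L f))⁻¹‖ ≤ 2 := by
    rw [norm_inv]
    exact inv_le_of_inv_le₀ (by norm_num) (by linarith)
  rw [normalize, norm_smul]
  calc _ ≤ 2 * (5 / 2 : ℝ) := by gcongr
    _ = 5 := by norm_num

/-- The normalized iteration is nonlinear, but its increments evolve by `U` up to a relative error
$O(\eta)$. With $a=m(Lf)$, $b=m(Lf_1)$ and $d=f_1-f$, the identity is
$a(f_2-f_1-Ud)=(Ld-Ud)+(1-a)Ud-(b-a)f_2$. Since $m(d)=0$, also $b-a=m(Ld-Ud)$ is $O(\eta\|d\|)$. -/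
lemma norm_difference_le (H : SpectralGap U m e C ρ) (hη0 : 0 ≤ η) (hη : η ≤ 1 / 4)
    (hL : ∀ f, ‖L f - U f‖ ≤ η * ‖f‖) {f : B} (hf : m f = 1) (hf2 : ‖f‖ ≤ 2)
    (hf2' : ‖normalize m L f‖ ≤ 2) :
    ‖normalize m L (normalize m L f) - normalize m L f - U (normalize m L f - f)‖ ≤
      16 * η * ‖normalize m L f - f‖ := by
  have hl := H.map_ne_zero hη hL hf hf2
  have hf1 := map_normalize L hl
  have hl1 := H.map_ne_zero hη hL hf1 hf2'
  set f₁ := normalize m L f with hf₁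
  set f₂ := normalize m L f₁ with hf₂
  have hb2 : ‖f₂‖ ≤ 5 := H.norm_normalize_le hη hL hf1 hf2'
  set a := m (L f) with ha
  set b := m (L f₁) with hb
  have ha0 : a ≠ 0 := by intro h; rw [h, norm_zero] at hl; norm_num at hl
  have hb0 : b ≠ 0 := by intro h; rw [h, norm_zero] at hl1; norm_num at hl1
  have e1 : a • f₁ = L f := by rw [hf₁, normalize, ← ha, smul_inv_smul₀ ha0]
  have e2 : b • f₂ = L f₁ := by rw [hf₂, normalize, ← hb, smul_inv_smul₀ hb0]
  set d := f₁ - f with hd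
  have hmd : m d = 0 := by rw [hd, map_sub, hf1, hf, sub_self]
  have hba : b - a = m (L d - U d) := by
    rw [map_sub, H.map_comp, hmd, sub_zero, hd, map_sub, map_sub]
  have hid : a • (f₂ - f₁ - U d) = (L d - U d) + (1 - a) • U d - (b - a) • f₂ := by
    have hLd : L d = L f₁ - L f := by rw [hd, map_sub]
    rw [hLd, ← e1, ← e2]
    module
  have hba' : ‖b - a‖ ≤ η * ‖d‖ := by rw [hba]; exact (H.norm_map_le _).trans (hL d)
  have h1a : ‖1 - a‖ ≤ η * 2 := by
    rw [norm_sub_rev]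
    exact (H.norm_map_sub_one_le hL hf).trans (by gcongr)
  have hn : ‖a‖ * ‖f₂ - f₁ - U d‖ ≤ 8 * η * ‖d‖ := by
    rw [← norm_smul, hid]
    calc _ ≤ ‖L d - U d‖ + ‖(1 - a) • U d‖ + ‖(b - a) • f₂‖ :=
          (norm_sub_le _ _).trans (by gcongr; exact norm_add_le _ _)
      _ ≤ η * ‖d‖ + η * 2 * ‖d‖ + η * ‖d‖ * 5 := by
          rw [norm_smul, norm_smul]
          gcongr
          · exact hL d
          · exact H.norm_le d
      _ = 8 * η * ‖d‖ := by ring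
  have h5 : 1 / 2 * ‖f₂ - f₁ - U d‖ ≤ ‖a‖ * ‖f₂ - f₁ - U d‖ := by gcongr
  linarith

lemma norm_normalize_unit_sub_le (H : SpectralGap U m e C ρ) (hη0 : 0 ≤ η) (hη : η ≤ 1 / 4)
    (hL : ∀ f, ‖L f - U f‖ ≤ η * ‖f‖) : ‖normalize m L e - e‖ ≤ 4 * η := by
  have hl := H.map_ne_zero hη hL H.map_unit (H.norm_unit.trans (by norm_num))
  set a := m (L e) with ha
  have ha0 : a ≠ 0 := by intro h; rw [h, norm_zero] at hl; norm_num at hl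
  have hid : a • (normalize m L e - e) = (L e - U e) + (1 - a) • e := by
    rw [smul_sub, normalize, ← ha, smul_inv_smul₀ ha0, H.fix_unit]
    module
  have h1 : ‖L e - U e‖ ≤ η := (hL e).trans (mul_le_of_le_one_right hη0 H.norm_unit)
  have h2 : ‖1 - a‖ ≤ η := by
    rw [norm_sub_rev]
    exact (H.norm_map_sub_one_le hL H.map_unit).trans (mul_le_of_le_one_right hη0 H.norm_unit)
  have hn : ‖a‖ * ‖normalize m L e - e‖ ≤ 2 * η := by
    rw [← norm_smul, hid]
    refine (norm_add_le _ _).trans ?_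
    rw [norm_smul]
    have : ‖1 - a‖ * ‖e‖ ≤ η * 1 := by gcongr; exact H.norm_unit
    linarith
  have h5 : 1 / 2 * ‖normalize m L e - e‖ ≤ ‖a‖ * ‖normalize m L e - e‖ := by gcongr
  linarith

/-- Along the normalized orbit of `e` under a small perturbation `L` of `U`, consecutive vectors
approach each other exponentially fast. -/
lemma orbit_estimates (H : SpectralGap U m e C ρ) (hη0 : 0 ≤ η) (hη : η ≤ 1 / 4)
    (hη1 : 16 * C * η ≤ (1 - ρ) / 2) (hη2 : 4 * C * η ≤ (1 - ρ) / 2)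
    (hL : ∀ f, ‖L f - U f‖ ≤ η * ‖f‖) (t : ℕ) :
    m ((normalize m L)^[t] e) = 1 ∧ ‖(normalize m L)^[t] e - e‖ ≤ 1 - ((1 + ρ) / 2) ^ t ∧
      ∀ n : ℕ, ‖(U ^ n) ((normalize m L)^[t + 1] e - (normalize m L)^[t] e)‖ ≤
        ρ ^ n * (4 * C * η * ((1 + ρ) / 2) ^ t) := by
  have hρ := H.ρ_nonneg
  have hρ1 := H.ρ_lt_one
  have hC := H.C_pos
  have two_of : ∀ f : B, ‖f - e‖ ≤ 1 → ‖f‖ ≤ 2 := by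
    intro f hf
    have := norm_add_le (f - e) e
    rw [sub_add_cancel] at this
    linarith [H.norm_unit]
  -- Since `C` may exceed one, `U` need not contract its kernel in one step. The induction therefore
  -- carries a bound on every `U ^ n` of the increment. The bound $1-q^t$, with $q=(1+\rho)/2$, sums
  -- the increments and keeps the orbit in norm at most two.
  induction t with
  | zero =>
    refine ⟨H.map_unit, by simp, fun n => ?_⟩
    simp only [zero_add, Function.iterate_one, Function.iterate_zero, id, pow_zero, mul_one]
    have hl := H.map_ne_zero hη hL H.map_unit (H.norm_unit.trans (by norm_num))
    have h0 : m (normalize m L e - e) = 0 := by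
      rw [map_sub, map_normalize L hl, H.map_unit, sub_self]
    calc _ ≤ C * ρ ^ n * ‖normalize m L e - e‖ := H.decay n _ h0
      _ ≤ C * ρ ^ n * (4 * η) := by
        gcongr; exact H.norm_normalize_unit_sub_le hη0 hη hL
      _ = _ := by ring
  | succ t ih =>
    obtain ⟨h1, h2, h3⟩ := ih
    set f := (normalize m L)^[t] e with hf
    set q := (1 + ρ) / 2 with hq
    have hq0 : 0 ≤ q := by positivity
    have hqt : 0 ≤ q ^ t := by positivity
    have hs1 : (normalize m L)^[t + 1] e = normalize m L f := by
      rw [Function.iterate_succ_apply']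
    have hs2 : (normalize m L)^[t + 1 + 1] e = normalize m L (normalize m L f) := by
      rw [Function.iterate_succ_apply', hs1]
    rw [hs1] at h3
    rw [hs1, hs2]
    have hf2 : ‖f‖ ≤ 2 := two_of f (by linarith)
    have hl := H.map_ne_zero hη hL h1 hf2
    have hm1 := map_normalize L hl
    set f₁ := normalize m L f with hf₁
    have hd0 := h3 0
    simp only [pow_zero, one_mul] at hd0
    have hd0' : ‖f₁ - f‖ ≤ 4 * C * η * q ^ t := hd0
    have hn1 : ‖f₁ - e‖ ≤ 1 - q ^ (t + 1) := by
      have : f₁ - e = (f₁ - f) + (f - e) := by abel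
      rw [this]
      refine (norm_add_le _ _).trans ?_
      have h6 : 4 * C * η * q ^ t ≤ (1 - ρ) / 2 * q ^ t := by gcongr
      have h7 : q ^ (t + 1) = (1 - (1 - ρ) / 2) * q ^ t := by rw [pow_succ, hq]; ring
      linarith
    have hf12 : ‖f₁‖ ≤ 2 := two_of f₁ (hn1.trans (by linarith [pow_nonneg hq0 (t + 1)]))
    refine ⟨hm1, hn1, fun n => ?_⟩
    have hl1 := H.map_ne_zero hη hL hm1 hf12
    have hr := H.norm_difference_le hη0 hη hL h1 hf2 hf12
    rw [← hf₁] at hr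
    set r := normalize m L f₁ - f₁ - U (f₁ - f) with hrdef
    have hmr : m r = 0 := by
      rw [hrdef, map_sub, H.map_comp, map_sub, map_sub, map_normalize L hl1, hm1, h1]; simp
    have hdec : normalize m L f₁ - f₁ = U (f₁ - f) + r := by rw [hrdef]; abel
    have hU : (U ^ n) (U (f₁ - f)) = (U ^ (n + 1)) (f₁ - f) := by
      rw [pow_succ]; rfl
    rw [hdec, map_add, hU]
    calc _ ≤ ‖(U ^ (n + 1)) (f₁ - f)‖ + ‖(U ^ n) r‖ := norm_add_le _ _
      _ ≤ ρ ^ (n + 1) * (4 * C * η * q ^ t) + C * ρ ^ n * (16 * η * (4 * C * η * q ^ t)) := by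
          refine add_le_add (h3 (n + 1)) ((H.decay n r hmr).trans ?_)
          gcongr
          exact hr.trans (by gcongr)
      _ = ρ ^ n * (4 * C * η * ((ρ + 16 * C * η) * q ^ t)) := by ring
      _ ≤ ρ ^ n * (4 * C * η * ((ρ + (1 - ρ) / 2) * q ^ t)) := by gcongr
      _ = _ := by rw [pow_succ, hq]; ring

/-- The numbers `m (L ^ t e)` are products of factors close to `1` which converge exponentially
fast. -/
lemma exists_factors (H : SpectralGap U m e C ρ) (hη0 : 0 ≤ η) (hη : η ≤ 1 / 4)
    (hη1 : 16 * C * η ≤ (1 - ρ) / 2) (hη2 : 4 * C * η ≤ (1 - ρ) / 2)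
    (hL : ∀ f, ‖L f - U f‖ ≤ η * ‖f‖) (t : ℕ) :
    m ((L ^ t) e) ≠ 0 ∧ ‖m ((L ^ (t + 1)) e) / m ((L ^ t) e) - 1‖ ≤ 2 * η ∧
      ‖m ((L ^ (t + 2)) e) / m ((L ^ (t + 1)) e) - m ((L ^ (t + 1)) e) / m ((L ^ t) e)‖ ≤
        4 * C * η * ((1 + ρ) / 2) ^ t := by
  have hρ := H.ρ_nonneg
  have hC := H.C_pos
  have hest := H.orbit_estimates hη0 hη hη1 hη2 hL
  have hf2 : ∀ t, ‖(normalize m L)^[t] e‖ ≤ 2 := by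
    intro t
    have := norm_add_le ((normalize m L)^[t] e - e) e
    rw [sub_add_cancel] at this
    have h := (hest t).2.1
    have : 0 ≤ ((1 + ρ) / 2) ^ t := by positivity
    linarith [H.norm_unit]
  have hl : ∀ t, m (L ((normalize m L)^[t] e)) ≠ 0 := by
    intro t h
    have := H.map_ne_zero hη hL (hest t).1 (hf2 t)
    rw [h, norm_zero] at this
    norm_num at this
  -- Normalization only rescales: the linear orbit is its own `m`-value times the normalized orbit,
  -- so ratios of successive values are `m (L f)` along the latter.
  have hpow : ∀ t, m ((L ^ t) e) ≠ 0 ∧ (L ^ t) e = m ((L ^ t) e) • (normalize m L)^[t] e := by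
    intro t
    induction t with
    | zero => simp [H.map_unit]
    | succ t ih =>
      have h1 : (L ^ (t + 1)) e = m ((L ^ t) e) • L ((normalize m L)^[t] e) := by
        rw [pow_succ', mul_apply_eq_comp, ih.2, map_smul, ← ih.2]
      have h2 : m ((L ^ (t + 1)) e) = m ((L ^ t) e) * m (L ((normalize m L)^[t] e)) := by
        rw [h1, map_smul, smul_eq_mul]
      refine ⟨by rw [h2]; exact mul_ne_zero ih.1 (hl t), ?_⟩
      rw [h2, Function.iterate_succ_apply', normalize, smul_smul, mul_assoc,
        mul_inv_cancel₀ (hl t), mul_one, h1]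
  have hratio : ∀ t, m ((L ^ (t + 1)) e) / m ((L ^ t) e) = m (L ((normalize m L)^[t] e)) := by
    intro t
    rw [div_eq_iff (hpow t).1, pow_succ', mul_apply_eq_comp, (hpow t).2, map_smul,
      map_smul, ← (hpow t).2, smul_eq_mul, mul_comm]
  refine ⟨(hpow t).1, ?_, ?_⟩
  · rw [hratio]
    refine (H.norm_map_sub_one_le hL (hest t).1).trans ?_
    have := hf2 t
    nlinarith
  · rw [show t + 2 = t + 1 + 1 from rfl, hratio (t + 1), hratio t, ← map_sub, ← map_sub]
    set d := (normalize m L)^[t + 1] e - (normalize m L)^[t] e with hd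
    have hmd : m d = 0 := by rw [hd, map_sub, (hest t).1, (hest (t + 1)).1, sub_self]
    have h1 : m (L d) = m (L d - U d) := by rw [map_sub m, H.map_comp, hmd, sub_zero]
    have h2 := (hest t).2.2 0
    simp only [pow_zero, one_mul] at h2
    rw [h1]
    refine ((H.norm_map_le _).trans (hL d)).trans ?_
    calc η * ‖d‖ ≤ 1 * ‖d‖ := by gcongr; linarith
      _ ≤ _ := by rw [one_mul]; exact h2

end Step

/-- Mean value inequality on a disc where the real part, hence the modulus, is at least one half. -/
lemma norm_log_sub_log_le {x y : ℂ} (hx : ‖x - 1‖ ≤ 1 / 2) (hy : ‖y - 1‖ ≤ 1 / 2) :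
    ‖Complex.log x - Complex.log y‖ ≤ 2 * ‖x - y‖ := by
  have hre : ∀ w ∈ Metric.closedBall (1 : ℂ) (1 / 2), 1 / 2 ≤ w.re := by
    intro w hw
    rw [mem_closedBall_iff_norm] at hw
    have h1 := (abs_le.1 ((Complex.abs_re_le_norm (w - 1)).trans hw)).1
    rw [Complex.sub_re, Complex.one_re] at h1
    linarith
  refine Convex.norm_image_sub_le_of_norm_hasDerivWithin_le (s := Metric.closedBall (1 : ℂ) (1 / 2))
    (f' := fun w => w⁻¹) (fun w hw => ?_) (fun w hw => ?_) (convex_closedBall _ _) ?_ ?_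
  · exact (Complex.hasDerivAt_log (Or.inl (by linarith [hre w hw]))).hasDerivWithinAt
  · rw [norm_inv]
    refine inv_le_of_inv_le₀ (by norm_num) ?_
    have := (hre w hw).trans ((le_abs_self _).trans (Complex.abs_re_le_norm w))
    linarith
  · rwa [mem_closedBall_iff_norm]
  · rwa [mem_closedBall_iff_norm]

/-- Quasi-powers for a holomorphic perturbation of an operator with a spectral gap. -/
theorem exists_quasiPower (H : SpectralGap U m e C ρ) {L : ℂ → B →L[ℂ] B} {κ : ℝ} (hκ : 0 < κ)
    (hL : ∀ z : ℂ, ‖z‖ ≤ 1 → ∀ f, ‖L z f - U f‖ ≤ κ * ‖z‖ * ‖f‖)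
    (hd : ∀ t : ℕ, Differentiable ℂ fun z => m ((L z ^ t) e)) :
    ∃ (ℓ : ℂ → ℂ) (δ K : ℝ), 0 < δ ∧ DifferentiableOn ℂ ℓ (Metric.ball 0 δ) ∧ ℓ 0 = 0 ∧
      ∀ t : ℕ, ∀ z ∈ Metric.ball (0 : ℂ) δ,
        ‖m ((L z ^ t) e) - Complex.exp (t * ℓ z)‖ ≤ K * ‖z‖ * ‖Complex.exp (t * ℓ z)‖ := by
  have hρ := H.ρ_nonneg
  have hρ1 := H.ρ_lt_one
  have hC := H.C_pos
  set q := (1 + ρ) / 2 with hq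
  have hq0 : 0 ≤ q := by positivity
  have hq1 : q < 1 := by rw [hq]; linarith
  have hρ2 : 0 < 1 - ρ := by linarith
  -- With $\eta=\kappa|z|$, the three terms give $|z|\le1$, $\eta\le1/4$ and $16C\eta\le(1-\rho)/2$;
  -- the last also covers the bound with $4C\eta$.
  set δ : ℝ := min 1 (min (1 / (4 * κ)) ((1 - ρ) / (32 * C * κ))) with hδ
  have hδ0 : 0 < δ := by positivity
  have hδ1 : δ ≤ 1 := min_le_left _ _
  have hδ2 : κ * δ ≤ 1 / 4 := by
    have : δ ≤ 1 / (4 * κ) := (min_le_right _ _).trans (min_le_left _ _)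
    calc κ * δ ≤ κ * (1 / (4 * κ)) := by gcongr
      _ = 1 / 4 := by field_simp
  have hδ3 : 16 * C * (κ * δ) ≤ (1 - ρ) / 2 := by
    have : δ ≤ (1 - ρ) / (32 * C * κ) := (min_le_right _ _).trans (min_le_right _ _)
    calc 16 * C * (κ * δ) ≤ 16 * C * (κ * ((1 - ρ) / (32 * C * κ))) := by gcongr
      _ = (1 - ρ) / 2 := by field_simp; ring
  set M : ℕ → ℂ → ℂ := fun t z => m ((L z ^ t) e) with hM
  set lam : ℕ → ℂ → ℂ := fun t z => M (t + 1) z / M t z with hlam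
  have hfac : ∀ z ∈ Metric.ball (0 : ℂ) δ, ∀ t, M t z ≠ 0 ∧ ‖lam t z - 1‖ ≤ 1 / 2 ∧
      ‖lam (t + 1) z - lam t z‖ ≤ 4 * C * (κ * ‖z‖) * q ^ t := by
    intro z hz t
    rw [mem_ball_zero_iff] at hz
    have hη : κ * ‖z‖ ≤ κ * δ := by gcongr
    have hη0 : 0 ≤ κ * ‖z‖ := by positivity
    have h1 : 16 * C * (κ * ‖z‖) ≤ 16 * C * (κ * δ) := by gcongr
    have h2 : 4 * C * (κ * ‖z‖) ≤ 16 * C * (κ * ‖z‖) := by gcongr; norm_num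
    have := H.exists_factors hη0 (hη.trans hδ2) (h1.trans hδ3) (h2.trans (h1.trans hδ3))
      (hL z (by linarith)) t
    exact ⟨this.1, this.2.1.trans (by linarith), this.2.2⟩
  set ℓs : ℕ → ℂ → ℂ := fun t z => Complex.log (lam t z) with hℓs
  set K₀ : ℝ := 8 * C * κ with hK₀
  have hK₀p : 0 < K₀ := by positivity
  have hstep : ∀ z ∈ Metric.ball (0 : ℂ) δ, ∀ t, dist (ℓs t z) (ℓs (t + 1) z) ≤
      K₀ * ‖z‖ * q ^ t := by
    intro z hz t
    rw [dist_comm, dist_eq_norm]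
    refine (norm_log_sub_log_le (hfac z hz (t + 1)).2.1 (hfac z hz t).2.1).trans ?_
    calc _ ≤ 2 * (4 * C * (κ * ‖z‖) * q ^ t) := by gcongr; exact (hfac z hz t).2.2
      _ = _ := by rw [hK₀]; ring
  have hlim : ∀ z ∈ Metric.ball (0 : ℂ) δ, ∃ w, Tendsto (fun t => ℓs t z) atTop (𝓝 w) :=
    fun z hz => cauchySeq_tendsto_of_complete (cauchySeq_of_le_geometric q _ hq1 (hstep z hz))
  choose! ℓ hℓ using hlim
  set K₁ := K₀ / (1 - q) with hK₁
  have hq2 : 0 < 1 - q := by linarith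
  have hK₁p : 0 < K₁ := by positivity
  -- The geometric factor allows summation over all times and the factor $|z|$ survives it. This
  -- gives the final relative error $O(|z|)$, uniform in $t$.
  have hdist : ∀ z ∈ Metric.ball (0 : ℂ) δ, ∀ t, ‖ℓs t z - ℓ z‖ ≤ K₁ * ‖z‖ * q ^ t := by
    intro z hz t
    have := dist_le_of_le_geometric_of_tendsto q _ hq1 (hstep z hz) (hℓ z hz) t
    rw [dist_eq_norm] at this
    refine this.trans (le_of_eq ?_)
    rw [hK₁]; ring
  have hslit : ∀ z ∈ Metric.ball (0 : ℂ) δ, ∀ t, lam t z ∈ Complex.slitPlane := by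
    intro z hz t
    left
    have h1 := (abs_le.1 ((Complex.abs_re_le_norm _).trans (hfac z hz t).2.1)).1
    rw [Complex.sub_re, Complex.one_re] at h1
    linarith
  have hdiff : DifferentiableOn ℂ ℓ (Metric.ball 0 δ) := by
    have hu : TendstoUniformlyOn ℓs ℓ atTop (Metric.ball 0 δ) := by
      rw [Metric.tendstoUniformlyOn_iff]
      intro ε hε
      have h0 : Tendsto (fun t : ℕ => K₁ * 1 * q ^ t) atTop (𝓝 0) := by
        simpa using (tendsto_pow_atTop_nhds_zero_of_lt_one hq0 hq1).const_mul (K₁ * 1)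
      filter_upwards [h0.eventually_lt_const hε] with t ht z hz
      rw [dist_comm, dist_eq_norm]
      refine (hdist z hz t).trans_lt (lt_of_le_of_lt ?_ ht)
      rw [mem_ball_zero_iff] at hz
      gcongr
      linarith
    refine hu.tendstoLocallyUniformlyOn.differentiableOn (Eventually.of_forall fun t => ?_)
      Metric.isOpen_ball
    refine DifferentiableOn.clog ?_ fun z hz => hslit z hz t
    exact DifferentiableOn.div (hd (t + 1)).differentiableOn (hd t).differentiableOn
      fun z hz => (hfac z hz t).1
  have hprod : ∀ z ∈ Metric.ball (0 : ℂ) δ, ∀ t,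
      M t z = Complex.exp (∑ j ∈ Finset.range t, ℓs j z) := by
    intro z hz t
    induction t with
    | zero => simp [hM, H.map_unit]
    | succ t ih =>
      have hne : lam t z ≠ 0 := Complex.slitPlane_ne_zero (hslit z hz t)
      rw [Finset.sum_range_succ, Complex.exp_add, ← ih, Complex.exp_log hne]
      rw [hlam, mul_div_cancel₀ _ (hfac z hz t).1]
  set K₂ := K₁ / (1 - q) with hK₂
  have hK₂p : 0 < K₂ := by positivity
  refine ⟨ℓ, δ, K₂ * Real.exp K₂, hδ0, hdiff, ?_, fun t z hz => ?_⟩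
  · have h0 : (0 : ℂ) ∈ Metric.ball (0 : ℂ) δ := Metric.mem_ball_self hδ0
    have hL0 : L 0 = U := by
      ext f
      have := hL 0 (by simp) f
      rw [norm_zero, mul_zero, zero_mul] at this
      exact sub_eq_zero.1 (norm_le_zero_iff.1 this)
    have hM0 : ∀ t, M t 0 = 1 := by
      intro t
      simp only [hM, hL0]
      induction t with
      | zero => simp [H.map_unit]
      | succ t ih => rw [pow_succ', mul_apply_eq_comp, H.map_comp, ih]
    refine tendsto_nhds_unique (hℓ 0 h0) ?_
    have : (fun t => ℓs t 0) = fun _ => 0 := by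
      funext t; simp [hℓs, hlam, hM0]
    rw [this]
    exact tendsto_const_nhds
  · set s : ℂ := ∑ j ∈ Finset.range t, (ℓs j z - ℓ z) with hs
    have hz1 : ‖z‖ ≤ 1 := by rw [mem_ball_zero_iff] at hz; linarith
    have hsn : ‖s‖ ≤ K₂ * ‖z‖ := by
      calc ‖s‖ ≤ ∑ j ∈ Finset.range t, K₁ * ‖z‖ * q ^ j :=
            norm_sum_le_of_le _ fun j _ => hdist z hz j
        _ = K₁ * ‖z‖ * ∑ j ∈ Finset.range t, q ^ j := by rw [Finset.mul_sum]
        _ ≤ K₁ * ‖z‖ * (1 - q)⁻¹ := by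
            gcongr
            rw [← tsum_geometric_of_lt_one hq0 hq1]
            exact (summable_geometric_of_lt_one hq0 hq1).sum_le_tsum _ fun _ _ => by positivity
        _ = K₂ * ‖z‖ := by rw [hK₂]; ring
    have hexp : m ((L z ^ t) e) = Complex.exp (t * ℓ z) * Complex.exp s := by
      have h1 : M t z = Complex.exp (t * ℓ z) * Complex.exp s := by
        rw [hprod z hz t, ← Complex.exp_add, hs, Finset.sum_sub_distrib]
        congr 1
        simp
      exact h1
    rw [hexp, ← mul_sub_one, norm_mul, mul_comm]
    gcongr
    have h1 := Complex.norm_exp_sub_sum_le_norm_mul_exp s 1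
    simp only [Finset.range_one, Finset.sum_singleton, pow_zero, Nat.factorial_zero, Nat.cast_one,
      div_one, pow_one] at h1
    calc _ ≤ ‖s‖ * Real.exp ‖s‖ := h1
      _ ≤ K₂ * ‖z‖ * Real.exp K₂ := by
          gcongr
          exact hsn.trans (mul_le_of_le_one_right hK₂p.le hz1)
      _ = _ := by ring

/-- A minorization condition for a power of `U` yields a spectral gap. -/
theorem exists_of_minorization (hnu : ‖e‖ ≤ 1) (hme : m e = 1) (hUe : U e = e)
    (hmU : ∀ f, m (U f) = m f) (hU : ∀ f, ‖U f‖ ≤ ‖f‖) (hm : ∀ f, ‖m f‖ ≤ ‖f‖)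
    {N : ℕ} (hN : 0 < N) {γ : ℝ} (hγ0 : 0 < γ) (hγ1 : γ < 1) (ν : B → ℂ)
    (hν : ∀ f, ‖(U ^ N) f - ν f • e‖ ≤ γ * ‖f‖) : ∃ C ρ : ℝ, SpectralGap U m e C ρ := by
  have hUn : ∀ (n : ℕ) f, ‖(U ^ n) f‖ ≤ ‖f‖ := by
    intro n f
    induction n with
    | zero => simp
    | succ n ih => rw [pow_succ', mul_apply_eq_comp]; exact (hU _).trans ih
  have hmn : ∀ (n : ℕ) f, m ((U ^ n) f) = m f := by
    intro n f
    induction n with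
    | zero => simp
    | succ n ih => rw [pow_succ', mul_apply_eq_comp, hmU, ih]
  have hen : ∀ n : ℕ, (U ^ n) e = e := by
    intro n
    induction n with
    | zero => simp
    | succ n ih => rw [pow_succ', mul_apply_eq_comp, ih, hUe]
  -- Modulo multiples of `e`, the operator `U ^ N` contracts by `γ`. As `e` is fixed, the subtracted
  -- multiples accumulate.
  have hblock : ∀ (k : ℕ) f, ∃ c : ℂ, ‖(U ^ (N * k)) f - c • e‖ ≤ γ ^ k * ‖f‖ := by
    intro k f
    induction k with
    | zero => exact ⟨0, by simp⟩
    | succ k ih =>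
      obtain ⟨c, hc⟩ := ih
      set w := (U ^ (N * k)) f - c • e with hw
      refine ⟨c + ν w, ?_⟩
      have h1 : (U ^ (N * (k + 1))) f - (c + ν w) • e = (U ^ N) w - ν w • e := by
        rw [hw, map_sub, map_smul, hen, ← hw, mul_add, mul_one, add_comm, pow_add,
          mul_apply_eq_comp]
        module
      rw [h1]
      calc _ ≤ γ * ‖w‖ := hν w
        _ ≤ γ * (γ ^ k * ‖f‖) := by gcongr
        _ = _ := by rw [pow_succ]; ring
  -- Applying the invariant functional shows that the accumulated multiple is itself at most
  -- $\gamma^k\|f\|$.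
  have hzero : ∀ (k : ℕ) f, m f = 0 → ‖(U ^ (N * k)) f‖ ≤ 2 * γ ^ k * ‖f‖ := by
    intro k f hf
    obtain ⟨c, hc⟩ := hblock k f
    have h1 : ‖c‖ ≤ γ ^ k * ‖f‖ := by
      have h2 := (hm ((U ^ (N * k)) f - c • e)).trans hc
      rwa [map_sub, hmn, hf, map_smul, hme, zero_sub, norm_neg, smul_eq_mul, mul_one] at h2
    calc ‖(U ^ (N * k)) f‖ = ‖((U ^ (N * k)) f - c • e) + c • e‖ := by rw [sub_add_cancel]
      _ ≤ ‖(U ^ (N * k)) f - c • e‖ + ‖c • e‖ := norm_add_le _ _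
      _ ≤ γ ^ k * ‖f‖ + γ ^ k * ‖f‖ * 1 := by
          rw [norm_smul]
          gcongr
      _ = _ := by ring
  -- The rate per step is the `N`-th root; the factor $1/\gamma$ in the constant pays for the
  -- incomplete last block.
  set ρ : ℝ := γ ^ ((N : ℝ)⁻¹) with hρ
  have hρ0 : 0 < ρ := Real.rpow_pos_of_pos hγ0 _
  have hρ1 : ρ < 1 := Real.rpow_lt_one hγ0.le hγ1 (by positivity)
  have hρN : ρ ^ N = γ := Real.rpow_inv_natCast_pow hγ0.le hN.ne'
  refine ⟨2 / γ, ρ, hnu, hme, hUe, hmU, hU, hm, by positivity, hρ0.le, hρ1, fun n f hf => ?_⟩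
  have hn : n = n % N + N * (n / N) := (Nat.mod_add_div n N).symm
  have hmod : γ ≤ ρ ^ (n % N) := by
    rw [← hρN]
    exact pow_le_pow_of_le_one hρ0.le hρ1.le (Nat.mod_lt n hN).le
  calc ‖(U ^ n) f‖ = ‖(U ^ (n % N)) ((U ^ (N * (n / N))) f)‖ := by
        rw [← mul_apply_eq_comp, ← pow_add, ← hn]
    _ ≤ ‖(U ^ (N * (n / N))) f‖ := hUn _ _
    _ ≤ 2 * γ ^ (n / N) * ‖f‖ := hzero _ _ hf
    _ = 2 / γ * (γ * γ ^ (n / N)) * ‖f‖ := by field_simp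
    _ ≤ 2 / γ * (ρ ^ (n % N) * γ ^ (n / N)) * ‖f‖ := by gcongr
    _ = 2 / γ * ρ ^ n * ‖f‖ := by
        rw [← hρN, ← pow_mul, ← pow_add, ← hn]

end SpectralGap

/-! ### Random iterations: the path measure -/

/-- The sequence `η, ω 0, ω 1, …`. -/
def consSeq {Y : Type*} (η : Y) (ω : ℕ → Y) : ℕ → Y
  | 0 => η
  | k + 1 => ω k

lemma measurable_consSeq {Y : Type*} [MeasurableSpace Y] :
    Measurable fun p : Y × (ℕ → Y) => consSeq p.1 p.2 := by
  refine measurable_pi_lambda _ fun k => ?_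
  cases k with
  | zero => exact measurable_fst
  | succ k => exact (measurable_pi_apply k).comp measurable_snd

/-- Prepending an independent noise preserves the product law. All conditioning on the first noise
rests on this. -/
lemma measurePreserving_consSeq {Y : Type*} [MeasurableSpace Y] (θ : Measure Y)
    [IsProbabilityMeasure θ] :
    MeasurePreserving (fun p : Y × (ℕ → Y) => consSeq p.1 p.2)
      (θ.prod (Measure.infinitePi fun _ : ℕ => θ)) (Measure.infinitePi fun _ : ℕ => θ) := by
  refine ⟨measurable_consSeq, Measure.eq_infinitePi _ fun s t ht => ?_⟩
  classical
  -- Padding by `univ` turns an arbitrary finite index set into an initial segment, from which the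
  -- zeroth factor splits off.
  set t' : ℕ → Set Y := fun i => if i ∈ s then t i else univ with ht'
  have ht'm : ∀ i, MeasurableSet (t' i) := by
    intro i
    simp only [ht']
    split_ifs
    · exact ht i
    · exact MeasurableSet.univ
  obtain ⟨n, hn⟩ := s.exists_nat_subset_range
  have hpre : (fun p : Y × (ℕ → Y) => consSeq p.1 p.2) ⁻¹' (Set.pi s t) =
      t' 0 ×ˢ Set.pi (Finset.range n) (fun i => t' (i + 1)) := by
    ext ⟨η, ω⟩
    simp only [mem_preimage, Set.mem_pi, Finset.mem_coe, mem_prod, Finset.mem_range, ht']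
    constructor
    · intro h
      refine ⟨?_, fun i _ => ?_⟩
      · split_ifs with h0
        · exact h 0 h0
        · trivial
      · split_ifs with h0
        · exact h (i + 1) h0
        · trivial
    · rintro ⟨h0, h1⟩ i hi
      cases i with
      | zero =>
        rw [if_pos hi] at h0
        exact h0
      | succ i =>
        have := h1 i (by have := Finset.mem_range.1 (hn hi); omega)
        rw [if_pos hi] at this
        exact this
  rw [Measure.map_apply measurable_consSeq (MeasurableSet.pi s.countable_toSet fun i _ => ht i),
    hpre, Measure.prod_prod,
    Measure.infinitePi_pi _ fun i _ => ht'm (i + 1), mul_comm,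
    ← Finset.prod_range_succ' (fun i => θ (t' i))]
  rw [← Finset.prod_subset (hn.trans (Finset.range_mono (Nat.le_succ n)))]
  · exact Finset.prod_congr rfl fun i hi => by simp [ht', hi]
  · intro i _ hi
    simp [ht', hi]

/-- The random orbit `F (ω (k-1)) ∘ ⋯ ∘ F (ω 0)` of `x`. -/
def randomOrbit {X Y : Type*} (F : Y → X → X) (ω : ℕ → Y) (x : X) : ℕ → X
  | 0 => x
  | k + 1 => F (ω k) (randomOrbit F ω x k)

/-- Orbits are defined by applying the newest noise last, whereas powers of the averaging operator
peel off the first noise. This lemma reconciles the two. -/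
lemma randomOrbit_consSeq {X Y : Type*} (F : Y → X → X) (η : Y) (ω : ℕ → Y) (x : X) (k : ℕ) :
    randomOrbit F (consSeq η ω) x (k + 1) = randomOrbit F ω (F η x) k := by
  induction k with
  | zero => rfl
  | succ k ih =>
    rw [randomOrbit, ih]
    rfl

/-- The Birkhoff sums of `g` along the random orbit. -/
def randomSum {X Y : Type*} (F : Y → X → X) (g : X → ℝ) (t : ℕ) (p : (ℕ → Y) × X) : ℝ :=
  ∑ k ∈ Finset.range t, g (randomOrbit F p.1 p.2 k)

lemma randomSum_consSeq {X Y : Type*} (F : Y → X → X) (g : X → ℝ) (t : ℕ) (η : Y) (ω : ℕ → Y)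
    (x : X) : randomSum F g (t + 1) (consSeq η ω, x) = g x + randomSum F g t (ω, F η x) := by
  simp only [randomSum]
  rw [Finset.sum_range_succ', add_comm]
  simp only [randomOrbit_consSeq]
  rfl

/-- A measurable random map with noise law `θ` and stationary measure `μ`. -/
structure StationarySystem {X Y : Type*} [MeasurableSpace X] [MeasurableSpace Y]
    (F : Y → X → X) (θ : Measure Y) (μ : Measure X) : Prop where
  measurable : Measurable fun p : Y × X => F p.1 p.2
  map_eq : (θ.prod μ).map (fun p => F p.1 p.2) = μ

/-- Bounded measurable real functions. -/
structure BddMeasurable {X : Type*} [MeasurableSpace X] (g : X → ℝ) : Prop where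
  measurable : Measurable g
  bounded : ∃ G : ℝ, ∀ x, |g x| ≤ G

/-- The averaging operator `f ↦ ∫ f (F η ·) dθ(η)`. -/
def averageOp {X Y : Type*} [MeasurableSpace Y] (F : Y → X → X) (θ : Measure Y) (f : X → ℝ)
    (x : X) : ℝ := ∫ η, f (F η x) ∂θ

namespace BddMeasurable

variable {X Y : Type*} [MeasurableSpace X] [MeasurableSpace Y] {f g : X → ℝ}

lemma integrable (hg : BddMeasurable g) (μ : Measure X) [IsFiniteMeasure μ] : Integrable g μ := by
  obtain ⟨G, hG⟩ := hg.bounded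
  exact Integrable.of_bound hg.measurable.aestronglyMeasurable G (Eventually.of_forall hG)

lemma add (hf : BddMeasurable f) (hg : BddMeasurable g) : BddMeasurable fun x => f x + g x := by
  obtain ⟨G, hG⟩ := hg.bounded
  obtain ⟨K, hK⟩ := hf.bounded
  exact ⟨hf.measurable.add hg.measurable, K + G, fun x =>
    (abs_add_le _ _).trans (add_le_add (hK x) (hG x))⟩

lemma mul (hf : BddMeasurable f) (hg : BddMeasurable g) : BddMeasurable fun x => f x * g x := by
  obtain ⟨G, hG⟩ := hg.bounded
  obtain ⟨K, hK⟩ := hf.bounded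
  refine ⟨hf.measurable.mul hg.measurable, K * G, fun x => ?_⟩
  rw [abs_mul]
  exact mul_le_mul (hK x) (hG x) (abs_nonneg _) ((abs_nonneg _).trans (hK x))

lemma const (c : ℝ) : BddMeasurable fun _ : X => c := ⟨measurable_const, |c|, fun _ => le_rfl⟩

lemma pow_two (hf : BddMeasurable f) : BddMeasurable fun x => f x ^ 2 := by
  simpa only [sq] using hf.mul hf

lemma sum {ι : Type*} (s : Finset ι) {f : ι → X → ℝ} (hf : ∀ i ∈ s, BddMeasurable (f i)) :
    BddMeasurable fun x => ∑ i ∈ s, f i x := by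
  classical
  induction s using Finset.induction_on with
  | empty => simpa using const 0
  | insert a s ha ih =>
    simp only [Finset.sum_insert ha]
    exact (hf a (Finset.mem_insert_self a s)).add
      (ih fun i hi => hf i (Finset.mem_insert_of_mem hi))

lemma comp {Z : Type*} [MeasurableSpace Z] (hf : BddMeasurable f) {φ : Z → X} (hφ : Measurable φ) :
    BddMeasurable fun z => f (φ z) := by
  obtain ⟨G, hG⟩ := hf.bounded
  exact ⟨hf.measurable.comp hφ, G, fun z => hG _⟩

lemma integral_left {f : Y × X → ℝ} (hf : BddMeasurable f) (θ : Measure Y)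
    [IsProbabilityMeasure θ] : BddMeasurable fun x => ∫ η, f (η, x) ∂θ := by
  obtain ⟨G, hG⟩ := hf.bounded
  refine ⟨hf.measurable.stronglyMeasurable.integral_prod_left'.measurable, G, fun x => ?_⟩
  have := norm_integral_le_of_norm_le_const (μ := θ) (f := fun η => f (η, x)) (C := G)
    (Eventually.of_forall fun η => hG _)
  simpa using this

end BddMeasurable

namespace StationarySystem

variable {X Y : Type*} [MeasurableSpace X] [MeasurableSpace Y] {F : Y → X → X} {θ : Measure Y}
  {μ : Measure X} [IsProbabilityMeasure θ] [IsProbabilityMeasure μ]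

/-- The law of the noise sequence and the initial point. -/
abbrev path (θ : Measure Y) (μ : Measure X) [IsProbabilityMeasure θ] : Measure ((ℕ → Y) × X) :=
  (Measure.infinitePi fun _ : ℕ => θ).prod μ

lemma measurable_randomOrbit (hF : Measurable fun p : Y × X => F p.1 p.2) (k : ℕ) :
    Measurable fun p : (ℕ → Y) × X => randomOrbit F p.1 p.2 k := by
  induction k with
  | zero => exact measurable_snd
  | succ k ih =>
    exact hF.comp (((measurable_pi_apply k).comp measurable_fst).prodMk ih)

lemma bddMeasurable_randomSum (hF : Measurable fun p : Y × X => F p.1 p.2) {g : X → ℝ}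
    (hg : BddMeasurable g) (t : ℕ) : BddMeasurable (randomSum F g t) :=
  BddMeasurable.sum _ fun k _ => hg.comp (measurable_randomOrbit hF k)

lemma bddMeasurable_averageOp (hF : Measurable fun p : Y × X => F p.1 p.2) {g : X → ℝ}
    (hg : BddMeasurable g) : BddMeasurable (averageOp F θ g) :=
  (hg.comp hF).integral_left θ

lemma bddMeasurable_averageOp_iterate (hF : Measurable fun p : Y × X => F p.1 p.2) {g : X → ℝ}
    (hg : BddMeasurable g) (k : ℕ) : BddMeasurable ((averageOp F θ)^[k] g) := by
  induction k with
  | zero => exact hg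
  | succ k ih => rw [Function.iterate_succ_apply']; exact bddMeasurable_averageOp hF ih

/-- Integration over noise sequences, conditioned on the first noise. -/
lemma integral_infinitePi_eq {E : Type*} [NormedAddCommGroup E] [NormedSpace ℝ E]
    {φ : (ℕ → Y) → E} (hφ : StronglyMeasurable φ) (hb : ∃ G, ∀ ω, ‖φ ω‖ ≤ G) :
    ∫ ω, φ ω ∂(Measure.infinitePi fun _ : ℕ => θ) =
      ∫ η, ∫ ω, φ (consSeq η ω) ∂(Measure.infinitePi fun _ : ℕ => θ) ∂θ := by
  obtain ⟨G, hG⟩ := hb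
  have hmp := measurePreserving_consSeq θ
  rw [← integral_prod (fun p : Y × (ℕ → Y) => φ (consSeq p.1 p.2))
    (Integrable.of_bound (hφ.comp_measurable hmp.measurable).aestronglyMeasurable G
      (Eventually.of_forall fun p => hG _))]
  conv_lhs => rw [← hmp.map_eq]
  rw [integral_map hmp.measurable.aemeasurable hφ.aestronglyMeasurable]

lemma integral_averageOp (H : StationarySystem F θ μ) {g : X → ℝ} (hg : BddMeasurable g) :
    ∫ x, averageOp F θ g x ∂μ = ∫ x, g x ∂μ := by
  unfold averageOp
  rw [← integral_prod_symm (fun p : Y × X => g (F p.1 p.2)) ((hg.comp H.measurable).integrable _)]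
  conv_rhs => rw [← H.map_eq]
  rw [integral_map H.measurable.aemeasurable hg.measurable.aestronglyMeasurable]

/-- Peel off the first noise: the point at time $k+1$ is the point at time $k$ of an independent
orbit started at $F_\eta(x)$, which again has law `μ`. -/
lemma measurePreserving_randomOrbit (H : StationarySystem F θ μ) (k : ℕ) :
    MeasurePreserving (fun p : (ℕ → Y) × X => randomOrbit F p.1 p.2 k) (path θ μ) μ := by
  refine ⟨measurable_randomOrbit H.measurable k, ?_⟩
  induction k with
  | zero =>
    have : (fun p : (ℕ → Y) × X => randomOrbit F p.1 p.2 0) = Prod.snd := rfl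
    rw [this, Measure.map_snd_prod]
    simp
  | succ k ih =>
    ext A hA
    have hm := measurable_randomOrbit H.measurable k
    have hm1 := measurable_randomOrbit H.measurable (k + 1)
    have hmp := measurePreserving_consSeq θ
    have hI : Measurable (A.indicator (fun _ => (1 : ENNReal))) := measurable_const.indicator hA
    have e1 : ∀ B : Set X, MeasurableSet B → ∀ j, ((path θ μ).map
        fun p : (ℕ → Y) × X => randomOrbit F p.1 p.2 j) B = ∫⁻ x, ∫⁻ ω, B.indicator
          (fun _ => (1 : ENNReal)) (randomOrbit F ω x j)
            ∂(Measure.infinitePi fun _ : ℕ => θ) ∂μ := by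
      intro B hB j
      rw [← lintegral_indicator_one hB, lintegral_map (measurable_one.indicator hB)
        (measurable_randomOrbit H.measurable j), lintegral_prod_symm _
        (show Measurable fun p : (ℕ → Y) × X => B.indicator (1 : X → ENNReal)
          (randomOrbit F p.1 p.2 j) from (measurable_one.indicator hB).comp
            (measurable_randomOrbit H.measurable j)).aemeasurable]
      rfl
    have e2 : ∀ x, ∫⁻ ω, A.indicator (fun _ => (1 : ENNReal)) (randomOrbit F ω x (k + 1))
          ∂(Measure.infinitePi fun _ : ℕ => θ) =
        ∫⁻ η, ∫⁻ ω, A.indicator (fun _ => (1 : ENNReal)) (randomOrbit F ω (F η x) k)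
          ∂(Measure.infinitePi fun _ : ℕ => θ) ∂θ := by
      intro x
      have hx : Measurable fun ω : ℕ → Y => A.indicator (fun _ => (1 : ENNReal))
          (randomOrbit F ω x (k + 1)) := hI.comp (hm1.comp measurable_prodMk_right)
      conv_lhs => rw [← hmp.map_eq]
      rw [lintegral_map hx hmp.measurable, lintegral_prod _ (show Measurable fun p : Y × (ℕ → Y) =>
        A.indicator (fun _ => (1 : ENNReal)) (randomOrbit F (consSeq p.1 p.2) x (k + 1)) from
          hx.comp hmp.measurable).aemeasurable]
      simp only [randomOrbit_consSeq]
    have hh : Measurable fun x => ∫⁻ ω, A.indicator (fun _ => (1 : ENNReal)) (randomOrbit F ω x k)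
          ∂(Measure.infinitePi fun _ : ℕ => θ) :=
      (hI.comp hm).lintegral_prod_left'
    rw [e1 A hA (k + 1)]
    simp_rw [e2]
    rw [← lintegral_prod_symm (fun p : Y × X => ∫⁻ ω, A.indicator (fun _ => (1 : ENNReal))
        (randomOrbit F ω (F p.1 p.2) k) ∂(Measure.infinitePi fun _ : ℕ => θ))
        (hh.comp H.measurable).aemeasurable,
      ← lintegral_map (f := fun x => ∫⁻ ω, A.indicator (fun _ => (1 : ENNReal))
        (randomOrbit F ω x k) ∂(Measure.infinitePi fun _ : ℕ => θ)) hh H.measurable, H.map_eq,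
      ← e1 A hA k, ih]

end StationarySystem

/-! ### The space of bounded measurable functions -/

/-- The bounded measurable functions as a subspace of all bounded functions. -/
def measurableSubmodule (X : Type*) [MeasurableSpace X] :
    Submodule ℂ (lp (fun _ : X => ℂ) ⊤) where
  carrier := {f | Measurable (f : X → ℂ)}
  add_mem' := fun {f g} (hf : Measurable (f : X → ℂ)) (hg : Measurable (g : X → ℂ)) => by
    change Measurable ((f + g : lp (fun _ : X => ℂ) ⊤) : X → ℂ)
    rw [lp.coeFn_add]
    exact hf.add hg
  zero_mem' := by
    change Measurable ((0 : lp (fun _ : X => ℂ) ⊤) : X → ℂ)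
    rw [lp.coeFn_zero]
    exact measurable_zero
  smul_mem' := fun c f (hf : Measurable (f : X → ℂ)) => by
    change Measurable ((c • f : lp (fun _ : X => ℂ) ⊤) : X → ℂ)
    rw [lp.coeFn_smul]
    exact hf.const_smul c

/-- Bounded measurable complex functions with the supremum norm. -/
def BoundedMeasurable (X : Type*) [MeasurableSpace X] : Type _ := measurableSubmodule X

namespace BoundedMeasurable

variable {X : Type*} [MeasurableSpace X]

instance : NormedAddCommGroup (BoundedMeasurable X) :=
  inferInstanceAs (NormedAddCommGroup (measurableSubmodule X))

instance : NormedSpace ℂ (BoundedMeasurable X) :=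
  inferInstanceAs (NormedSpace ℂ (measurableSubmodule X))

/-- The value of a bounded measurable function at a point. -/
def eval (f : BoundedMeasurable X) (x : X) : ℂ := (f.1 : lp (fun _ : X => ℂ) ⊤) x

lemma measurable_eval (f : BoundedMeasurable X) : Measurable (eval f) := f.2

lemma norm_eval_le (f : BoundedMeasurable X) (x : X) : ‖eval f x‖ ≤ ‖f‖ :=
  lp.norm_apply_le_norm ENNReal.top_ne_zero _ x

lemma norm_le {f : BoundedMeasurable X} {c : ℝ} (hc : 0 ≤ c) (h : ∀ x, ‖eval f x‖ ≤ c) :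
    ‖f‖ ≤ c :=
  lp.norm_le_of_forall_le hc h

@[ext]
lemma ext {f g : BoundedMeasurable X} (h : ∀ x, eval f x = eval g x) : f = g :=
  Subtype.ext (lp.ext (funext h))

/-- The element of the space given by a bounded measurable function. -/
def mk (f : X → ℂ) (hf : Measurable f) (hb : ∃ c : ℝ, ∀ x, ‖f x‖ ≤ c) : BoundedMeasurable X :=
  ⟨⟨f, memℓp_infty (by
    obtain ⟨c, hc⟩ := hb
    exact ⟨c, by rintro _ ⟨x, rfl⟩; exact hc x⟩)⟩, hf⟩

@[simp] lemma eval_mk (f : X → ℂ) (hf : Measurable f) (hb : ∃ c : ℝ, ∀ x, ‖f x‖ ≤ c) (x : X) :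
    eval (mk f hf hb) x = f x := rfl

@[simp] lemma eval_add (f g : BoundedMeasurable X) (x : X) :
    eval (f + g) x = eval f x + eval g x := rfl

@[simp] lemma eval_sub (f g : BoundedMeasurable X) (x : X) :
    eval (f - g) x = eval f x - eval g x := rfl

@[simp] lemma eval_smul (c : ℂ) (f : BoundedMeasurable X) (x : X) :
    eval (c • f) x = c * eval f x := rfl

lemma integrable_eval (f : BoundedMeasurable X) (μ : Measure X) [IsFiniteMeasure μ] :
    Integrable (eval f) μ :=
  Integrable.of_bound f.measurable_eval.aestronglyMeasurable _ (Eventually.of_forall f.norm_eval_le)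

/-- The constant function `1`. -/
def one (X : Type*) [MeasurableSpace X] : BoundedMeasurable X :=
  mk (fun _ => 1) measurable_const ⟨1, by simp⟩

@[simp] lemma eval_one (x : X) : eval (one X) x = 1 := rfl

/-- Integration against a probability measure. -/
def integralCLM (μ : Measure X) [IsProbabilityMeasure μ] : BoundedMeasurable X →L[ℂ] ℂ :=
  LinearMap.mkContinuous
    { toFun := fun f => ∫ x, eval f x ∂μ
      map_add' := fun f g => by
        simp only [eval_add]
        exact integral_add (f.integrable_eval μ) (g.integrable_eval μ)
      map_smul' := fun c f => by
        simp only [eval_smul, RingHom.id_apply, smul_eq_mul]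
        exact integral_const_mul _ _ } 1 fun f => by
      simpa using norm_integral_le_of_norm_le_const (μ := μ)
        (Eventually.of_forall f.norm_eval_le)

lemma integralCLM_apply (μ : Measure X) [IsProbabilityMeasure μ] (f : BoundedMeasurable X) :
    integralCLM μ f = ∫ x, eval f x ∂μ := rfl

lemma norm_integralCLM_le (μ : Measure X) [IsProbabilityMeasure μ] (f : BoundedMeasurable X) :
    ‖integralCLM μ f‖ ≤ ‖f‖ := by
  rw [integralCLM_apply]
  simpa using norm_integral_le_of_norm_le_const (μ := μ) (Eventually.of_forall f.norm_eval_le)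

variable {Y : Type*} [MeasurableSpace Y] {F : Y → X → X} (θ : Measure Y) [IsProbabilityMeasure θ]

lemma integrable_eval_comp (hF : Measurable fun p : Y × X => F p.1 p.2) (f : BoundedMeasurable X)
    (x : X) : Integrable (fun η => eval f (F η x)) θ :=
  Integrable.of_bound (f.measurable_eval.comp (hF.comp measurable_prodMk_right)).aestronglyMeasurable
    _ (Eventually.of_forall fun _ => f.norm_eval_le _)

lemma norm_integral_eval_le (f : BoundedMeasurable X) (x : X) :
    ‖∫ η, eval f (F η x) ∂θ‖ ≤ ‖f‖ := by
  simpa using norm_integral_le_of_norm_le_const (μ := θ) (f := fun η => eval f (F η x))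
    (Eventually.of_forall fun η => f.norm_eval_le _)

/-- The weighted averaging operator `f ↦ w · ∫ f (F η ·) dθ(η)`. -/
def weightedOp (hF : Measurable fun p : Y × X => F p.1 p.2) (w : BoundedMeasurable X) :
    BoundedMeasurable X →L[ℂ] BoundedMeasurable X :=
  LinearMap.mkContinuous
    { toFun := fun f => mk (fun x => eval w x * ∫ η, eval f (F η x) ∂θ)
        (w.measurable_eval.mul ((f.measurable_eval.comp hF).stronglyMeasurable
          |>.integral_prod_left'.measurable))
        ⟨‖w‖ * ‖f‖, fun x => by
          rw [norm_mul]
          exact mul_le_mul (w.norm_eval_le x) (norm_integral_eval_le θ f x) (norm_nonneg _)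
            (norm_nonneg _)⟩
      map_add' := fun f g => by
        ext x
        simp only [eval_mk, eval_add]
        rw [integral_add (integrable_eval_comp θ hF f x) (integrable_eval_comp θ hF g x), mul_add]
      map_smul' := fun c f => by
        ext x
        simp only [eval_mk, eval_smul, RingHom.id_apply]
        rw [integral_const_mul]
        ring } ‖w‖ fun f => norm_le (by positivity) fun x => by
      rw [LinearMap.coe_mk, AddHom.coe_mk, eval_mk, norm_mul]
      exact mul_le_mul (w.norm_eval_le x) (norm_integral_eval_le θ f x) (norm_nonneg _)
        (norm_nonneg _)

@[simp] lemma eval_weightedOp (hF : Measurable fun p : Y × X => F p.1 p.2)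
    (w f : BoundedMeasurable X) (x : X) :
    eval (weightedOp θ hF w f) x = eval w x * ∫ η, eval f (F η x) ∂θ := rfl

/-- The averaging operator `f ↦ ∫ f (F η ·) dθ(η)`. -/
abbrev averageCLM (hF : Measurable fun p : Y × X => F p.1 p.2) :
    BoundedMeasurable X →L[ℂ] BoundedMeasurable X := weightedOp θ hF (one X)

lemma norm_averageCLM_le (hF : Measurable fun p : Y × X => F p.1 p.2) (f : BoundedMeasurable X) :
    ‖averageCLM θ hF f‖ ≤ ‖f‖ :=
  norm_le (norm_nonneg _) fun x => by
    rw [eval_weightedOp, eval_one, one_mul]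
    exact norm_integral_eval_le θ f x

lemma averageCLM_one (hF : Measurable fun p : Y × X => F p.1 p.2) :
    averageCLM θ hF (one X) = one X := by
  ext x
  simp

lemma norm_one_le : ‖one X‖ ≤ 1 := norm_le zero_le_one fun x => by simp

/-- A bounded measurable real function as an element of the space. -/
def ofReal (g : X → ℝ) (hg : BddMeasurable g) : BoundedMeasurable X :=
  mk (fun x => (g x : ℂ)) (Complex.measurable_ofReal.comp hg.measurable) (by
    obtain ⟨G, hG⟩ := hg.bounded
    exact ⟨G, fun x => by rw [Complex.norm_real]; exact hG x⟩)

/-- The weight `exp (z g)`. -/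
def expWeight (g : X → ℝ) (hg : BddMeasurable g) (z : ℂ) : BoundedMeasurable X :=
  mk (fun x => Complex.exp (z * g x))
    (Complex.measurable_exp.comp ((Complex.measurable_ofReal.comp hg.measurable).const_mul z)) (by
      obtain ⟨G, hG⟩ := hg.bounded
      refine ⟨Real.exp (‖z‖ * G), fun x => (Complex.norm_exp_le_exp_norm _).trans ?_⟩
      rw [norm_mul, Complex.norm_real]
      gcongr
      exact hG x)

lemma averageCLM_pow_ofReal (hF : Measurable fun p : Y × X => F p.1 p.2) {g : X → ℝ}
    (hg : BddMeasurable g) (k : ℕ) (x : X) :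
    eval ((averageCLM θ hF ^ k) (ofReal g hg)) x = ((averageOp F θ)^[k] g x : ℝ) := by
  induction k generalizing x with
  | zero => rfl
  | succ k ih =>
    rw [pow_succ', mul_apply_eq_comp, eval_weightedOp, eval_one, one_mul,
      Function.iterate_succ_apply', averageOp]
    simp_rw [ih]
    exact integral_complex_ofReal

end BoundedMeasurable

/-! ### Twisted averaging operators and moment generating functions -/

namespace StationarySystem

open BoundedMeasurable

variable {X Y : Type*} [MeasurableSpace X] [MeasurableSpace Y] {F : Y → X → X} {θ : Measure Y}
  {μ : Measure X} [IsProbabilityMeasure θ] [IsProbabilityMeasure μ]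

lemma integralCLM_averageCLM (H : StationarySystem F θ μ) (f : BoundedMeasurable X) :
    integralCLM μ (averageCLM θ H.measurable f) = integralCLM μ f := by
  simp only [integralCLM_apply, eval_weightedOp, eval_one, one_mul]
  rw [← integral_prod_symm (fun p : Y × X => eval f (F p.1 p.2))
    (Integrable.of_bound (f.measurable_eval.comp H.measurable).aestronglyMeasurable ‖f‖
      (Eventually.of_forall fun p => f.norm_eval_le _))]
  conv_rhs => rw [← H.map_eq]
  rw [integral_map H.measurable.aemeasurable f.measurable_eval.aestronglyMeasurable]

/-- Powers of the weighted operator compute the moment generating function along the orbit. -/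
lemma eval_weightedOp_pow (hF : Measurable fun p : Y × X => F p.1 p.2) {g : X → ℝ}
    (hg : BddMeasurable g) (z : ℂ) (t : ℕ) (x : X) :
    eval ((weightedOp θ hF (expWeight g hg z) ^ t) (one X)) x =
      ∫ ω, Complex.exp (z * randomSum F g t (ω, x)) ∂(Measure.infinitePi fun _ : ℕ => θ) := by
  induction t generalizing x with
  | zero => simp [randomSum]
  | succ t ih =>
    rw [pow_succ', mul_apply_eq_comp, eval_weightedOp]
    simp_rw [ih]
    have hS := bddMeasurable_randomSum hF hg (t + 1)
    obtain ⟨G, hG⟩ := hS.bounded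
    rw [integral_infinitePi_eq (φ := fun ω => Complex.exp (z * randomSum F g (t + 1) (ω, x)))
      (Measurable.stronglyMeasurable (Complex.measurable_exp.comp
        ((Complex.measurable_ofReal.comp (hS.measurable.comp measurable_prodMk_right)).const_mul z)))
      ⟨Real.exp (‖z‖ * G), fun ω => (Complex.norm_exp_le_exp_norm _).trans (by
        rw [norm_mul, Complex.norm_real]
        gcongr
        exact hG _)⟩]
    simp_rw [randomSum_consSeq, expWeight, eval_mk, Complex.ofReal_add, mul_add, Complex.exp_add]
    simp_rw [integral_const_mul]

lemma integralCLM_weightedOp_pow (hF : Measurable fun p : Y × X => F p.1 p.2) {g : X → ℝ}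
    (hg : BddMeasurable g) (z : ℂ) (t : ℕ) :
    integralCLM μ ((weightedOp θ hF (expWeight g hg z) ^ t) (one X)) =
      complexMGF (randomSum F g t) (path θ μ) z := by
  have hS := bddMeasurable_randomSum hF hg t
  obtain ⟨G, hG⟩ := hS.bounded
  rw [integralCLM_apply, complexMGF]
  simp_rw [eval_weightedOp_pow]
  rw [← integral_prod_symm (fun p : (ℕ → Y) × X => Complex.exp (z * randomSum F g t p))]
  exact Integrable.of_bound (Measurable.aestronglyMeasurable (Complex.measurable_exp.comp
    ((Complex.measurable_ofReal.comp hS.measurable).const_mul z))) (Real.exp (‖z‖ * G))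
    (Eventually.of_forall fun p => (Complex.norm_exp_le_exp_norm _).trans (by
        rw [norm_mul, Complex.norm_real]
        gcongr
        exact hG _))

lemma norm_weightedOp_sub_le (hF : Measurable fun p : Y × X => F p.1 p.2) {g : X → ℝ}
    (hg : BddMeasurable g) {G : ℝ} (hG : ∀ x, |g x| ≤ G) {z : ℂ} (hz : ‖z‖ ≤ 1)
    (f : BoundedMeasurable X) :
    ‖weightedOp θ hF (expWeight g hg z) f - averageCLM θ hF f‖ ≤
      G * Real.exp G * ‖z‖ * ‖f‖ := by
  by_cases hX : Nonempty X
  · have hG0 : 0 ≤ G := (abs_nonneg _).trans (hG hX.some)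
    refine norm_le (by positivity) fun x => ?_
    rw [eval_sub, eval_weightedOp, eval_weightedOp, eval_one, ← sub_mul, norm_mul]
    refine mul_le_mul ?_ (norm_integral_eval_le θ f x) (norm_nonneg _) (by positivity)
    rw [expWeight, eval_mk]
    have h1 := Complex.norm_exp_sub_sum_le_norm_mul_exp (z * g x) 1
    simp only [Finset.range_one, Finset.sum_singleton, pow_zero, Nat.factorial_zero, Nat.cast_one,
      div_one, pow_one] at h1
    have h2 : ‖z * (g x : ℂ)‖ ≤ ‖z‖ * G := by
      rw [norm_mul, Complex.norm_real]; gcongr; exact hG x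
    calc _ ≤ ‖z * (g x : ℂ)‖ * Real.exp ‖z * (g x : ℂ)‖ := h1
      _ ≤ (‖z‖ * G) * Real.exp G := by
          gcongr
          exact h2.trans (mul_le_of_le_one_left hG0 hz)
      _ = _ := by ring
  · have : f = 0 := by
      ext x
      exact (hX ⟨x⟩).elim
    simp [this]

lemma integral_randomSum (H : StationarySystem F θ μ) {g : X → ℝ} (hg : BddMeasurable g)
    (h0 : ∫ x, g x ∂μ = 0) (t : ℕ) : ∫ p, randomSum F g t p ∂(path θ μ) = 0 := by
  unfold randomSum
  rw [integral_finsetSum _ fun k _ =>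
    (hg.comp (measurable_randomOrbit H.measurable k)).integrable _]
  refine Finset.sum_eq_zero fun k _ => ?_
  have hmp := H.measurePreserving_randomOrbit k
  rw [← h0]
  conv_rhs => rw [← hmp.map_eq]
  rw [integral_map hmp.measurable.aemeasurable hg.measurable.aestronglyMeasurable]

/-- A spectral gap on bounded measurable functions makes Birkhoff sums quasi-powers. -/
theorem exists_quasiPower (H : StationarySystem F θ μ) {C ρ : ℝ}
    (hgap : SpectralGap (averageCLM θ H.measurable) (integralCLM μ) (one X) C ρ) {g : X → ℝ}
    (hg : BddMeasurable g) (h0 : ∫ x, g x ∂μ = 0) :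
    ∃ (ℓ : ℂ → ℂ) (δ K : ℝ), QuasiPower (path θ μ) (randomSum F g) ℓ δ K := by
  obtain ⟨G, hG⟩ := hg.bounded
  -- The maximum keeps the perturbation constant positive even when $g$ vanishes.
  set G' := max G 1 with hG'
  have hG1 : ∀ x, |g x| ≤ G' := fun x => (hG x).trans (le_max_left _ _)
  have hGpos : 0 < G' := lt_of_lt_of_le one_pos (le_max_right _ _)
  have hd : ∀ t : ℕ, Differentiable ℂ fun z =>
      integralCLM μ ((weightedOp θ H.measurable (expWeight g hg z) ^ t) (one X)) := by
    intro t
    -- Only scalar holomorphy is required, and it comes from the moment generating function of a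
    -- bounded variable.
    simp_rw [integralCLM_weightedOp_pow]
    have hS := bddMeasurable_randomSum H.measurable hg t
    obtain ⟨K, hK⟩ := hS.bounded
    have huniv : integrableExpSet (randomSum F g t) (path θ μ) = univ := by
      refine eq_univ_of_forall fun x => ?_
      refine Integrable.of_bound (C := Real.exp (|x| * K))
        (Real.measurable_exp.comp (hS.measurable.const_mul x)).aestronglyMeasurable
        (Eventually.of_forall fun p => ?_)
      rw [Real.norm_of_nonneg (Real.exp_pos _).le, Real.exp_le_exp]
      calc x * randomSum F g t p ≤ |x * randomSum F g t p| := le_abs_self _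
        _ = |x| * |randomSum F g t p| := abs_mul _ _
        _ ≤ |x| * K := by gcongr; exact hK p
    intro z
    exact (hasDerivAt_complexMGF (by simp [huniv])).differentiableAt
  obtain ⟨ℓ, δ, K, hδ, hdiff, hℓ0, hb⟩ := hgap.exists_quasiPower (κ := G' * Real.exp G')
    (by positivity) (fun z hz f => norm_weightedOp_sub_le H.measurable hg hG1 hz f) hd
  refine ⟨ℓ, δ, K, ?_, ?_, ?_, hδ, hdiff, hℓ0, ?_⟩
  · exact fun t => (bddMeasurable_randomSum H.measurable hg t).measurable.aemeasurable
  · intro t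
    obtain ⟨K, hK⟩ := (bddMeasurable_randomSum H.measurable hg t).bounded
    exact ⟨K, Eventually.of_forall hK⟩
  · exact H.integral_randomSum hg h0
  · intro t z hz
    rw [← integralCLM_weightedOp_pow H.measurable hg]
    exact hb t z hz

end StationarySystem

/-! ### The Green–Kubo formula -/

namespace StationarySystem

open BoundedMeasurable

variable {X Y : Type*} [MeasurableSpace X] [MeasurableSpace Y] {F : Y → X → X} {θ : Measure Y}
  {μ : Measure X} [IsProbabilityMeasure θ] [IsProbabilityMeasure μ]

lemma averageOp_sum (hF : Measurable fun p : Y × X => F p.1 p.2) {ι : Type*} (s : Finset ι)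
    {f : ι → X → ℝ} (hf : ∀ i ∈ s, BddMeasurable (f i)) (x : X) :
    averageOp F θ (fun x => ∑ i ∈ s, f i x) x = ∑ i ∈ s, averageOp F θ (f i) x :=
  integral_finsetSum _ fun i hi =>
    ((hf i hi).comp (hF.comp measurable_prodMk_right)).integrable θ

lemma bddMeasurable_randomSum_right (hF : Measurable fun p : Y × X => F p.1 p.2) {g : X → ℝ}
    (hg : BddMeasurable g) (t : ℕ) (x : X) :
    BddMeasurable fun ω : ℕ → Y => randomSum F g t (ω, x) :=
  (bddMeasurable_randomSum hF hg t).comp measurable_prodMk_right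

/-- By conditioning on the first noise, each summand has conditional mean `averageOp` iterated,
given the starting point. -/
lemma integral_randomSum_right (hF : Measurable fun p : Y × X => F p.1 p.2) {g : X → ℝ}
    (hg : BddMeasurable g) (t : ℕ) (x : X) :
    ∫ ω, randomSum F g t (ω, x) ∂(Measure.infinitePi fun _ : ℕ => θ) =
      ∑ k ∈ Finset.range t, (averageOp F θ)^[k] g x := by
  induction t generalizing x with
  | zero => simp [randomSum]
  | succ t ih =>
    have hS := bddMeasurable_randomSum_right hF hg (t + 1) x
    rw [integral_infinitePi_eq hS.measurable.stronglyMeasurable hS.bounded]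
    simp_rw [randomSum_consSeq]
    have h1 : ∀ η, ∫ ω, (g x + randomSum F g t (ω, F η x))
        ∂(Measure.infinitePi fun _ : ℕ => θ) =
        g x + ∑ k ∈ Finset.range t, (averageOp F θ)^[k] g (F η x) := by
      intro η
      rw [integral_add (integrable_const _)
        ((bddMeasurable_randomSum_right hF hg t _).integrable _), ih]
      simp
    simp_rw [h1]
    have hb := BddMeasurable.sum (Finset.range t) fun k _ =>
      bddMeasurable_averageOp_iterate (θ := θ) hF hg k
    have hbi : Integrable (fun η => ∑ k ∈ Finset.range t, (averageOp F θ)^[k] g (F η x)) θ :=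
      (hb.comp (hF.comp (measurable_prodMk_right (y := x)))).integrable θ
    rw [integral_add (integrable_const _) hbi]
    have h2 := averageOp_sum (θ := θ) hF (Finset.range t)
      (fun k _ => bddMeasurable_averageOp_iterate (θ := θ) hF hg k) x
    simp only [averageOp] at h2
    rw [Finset.sum_range_succ', add_comm]
    simp only [Function.iterate_succ_apply', Function.iterate_zero, id]
    simp only [integral_const, probReal_univ, one_smul]
    congr 1

/-- The variances of successive Birkhoff sums differ by partial sums of the correlations. -/
lemma integral_randomSum_sq_succ (H : StationarySystem F θ μ) {g : X → ℝ} (hg : BddMeasurable g)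
    (t : ℕ) : ∫ p, randomSum F g (t + 1) p ^ 2 ∂(path θ μ) =
      ∫ x, g x ^ 2 ∂μ + 2 * ∑ k ∈ Finset.range t, ∫ x, g x * (averageOp F θ)^[k + 1] g x ∂μ +
        ∫ p, randomSum F g t p ^ 2 ∂(path θ μ) := by
  have hF := H.measurable
  have hfub : ∀ t, ∫ p, randomSum F g t p ^ 2 ∂(path θ μ) =
      ∫ x, ∫ ω, randomSum F g t (ω, x) ^ 2 ∂(Measure.infinitePi fun _ : ℕ => θ) ∂μ := fun t =>
    integral_prod_symm _ ((bddMeasurable_randomSum hF hg t).pow_two.integrable _)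
  set V : X → ℝ := fun x => ∑ k ∈ Finset.range t, (averageOp F θ)^[k] g x with hV
  set W : X → ℝ := fun x => ∫ ω, randomSum F g t (ω, x) ^ 2 ∂(Measure.infinitePi fun _ : ℕ => θ)
    with hW
  have hVb : BddMeasurable V := BddMeasurable.sum (Finset.range t) fun k _ =>
      bddMeasurable_averageOp_iterate (θ := θ) hF hg k
  have hWb : BddMeasurable W := (bddMeasurable_randomSum hF hg t).pow_two.integral_left _
  -- Condition on the first noise and expand $(g(x)+S_t)^2$. The last term loses its operator after
  -- integration, by stationarity.
  have hrec : ∀ x, ∫ ω, randomSum F g (t + 1) (ω, x) ^ 2 ∂(Measure.infinitePi fun _ : ℕ => θ) =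
      g x ^ 2 + 2 * (g x * averageOp F θ V x) + averageOp F θ W x := by
    intro x
    have hS := (bddMeasurable_randomSum_right hF hg (t + 1) x).pow_two
    rw [integral_infinitePi_eq hS.measurable.stronglyMeasurable hS.bounded]
    simp_rw [randomSum_consSeq]
    have h1 : ∀ η, ∫ ω, (g x + randomSum F g t (ω, F η x)) ^ 2
        ∂(Measure.infinitePi fun _ : ℕ => θ) = g x ^ 2 + 2 * g x * V (F η x) + W (F η x) := by
      intro η
      have hb := bddMeasurable_randomSum_right hF hg t (F η x)
      have e : ∀ ω, (g x + randomSum F g t (ω, F η x)) ^ 2 =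
          (g x ^ 2 + 2 * g x * randomSum F g t (ω, F η x)) + randomSum F g t (ω, F η x) ^ 2 :=
        fun ω => by ring
      simp_rw [e]
      have hi : Integrable (fun ω => 2 * g x * randomSum F g t (ω, F η x))
          (Measure.infinitePi fun _ : ℕ => θ) := (hb.integrable _).const_mul _
      have hi2 : Integrable (fun ω => g x ^ 2 + 2 * g x * randomSum F g t (ω, F η x))
          (Measure.infinitePi fun _ : ℕ => θ) := (integrable_const _).add hi
      rw [integral_add hi2 (hb.pow_two.integrable _), integral_add (integrable_const _) hi,
        integral_const_mul, integral_randomSum_right hF hg]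
      simp [hV, hW]
    simp_rw [h1]
    have hVi : Integrable (fun η => V (F η x)) θ :=
      (hVb.comp (hF.comp (measurable_prodMk_right (y := x)))).integrable θ
    have hWi : Integrable (fun η => W (F η x)) θ :=
      (hWb.comp (hF.comp (measurable_prodMk_right (y := x)))).integrable θ
    have hi : Integrable (fun η => 2 * g x * V (F η x)) θ := hVi.const_mul _
    have hi2 : Integrable (fun η => g x ^ 2 + 2 * g x * V (F η x)) θ := (integrable_const _).add hi
    rw [integral_add hi2 hWi, integral_add (integrable_const _) hi, integral_const_mul]
    simp only [integral_const, probReal_univ, one_smul, averageOp]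
    ring
  rw [hfub (t + 1), hfub t]
  simp_rw [hrec]
  have hgU := hg.mul (bddMeasurable_averageOp (θ := θ) hF hVb)
  have hi1 : Integrable (fun x => 2 * (g x * averageOp F θ V x)) μ := (hgU.integrable μ).const_mul _
  have hi2 : Integrable (fun x => g x ^ 2 + 2 * (g x * averageOp F θ V x)) μ :=
    (hg.pow_two.integrable μ).add hi1
  rw [integral_add hi2 ((bddMeasurable_averageOp hF hWb).integrable μ),
    integral_add (hg.pow_two.integrable μ) hi1, integral_const_mul, H.integral_averageOp hWb]
  congr 3
  rw [← integral_finsetSum _ fun k _ =>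
    (hg.mul (bddMeasurable_averageOp_iterate hF hg (k + 1))).integrable μ]
  congr 1
  ext x
  rw [← Finset.mul_sum]
  congr 1
  rw [hV, averageOp_sum hF _ fun k _ => bddMeasurable_averageOp_iterate (θ := θ) hF hg k]
  simp only [Function.iterate_succ_apply']

/-- The function `g` lies in the kernel of the invariant functional, so its iterates decay
geometrically in supremum norm. -/
lemma summable_correlations (H : StationarySystem F θ μ) {C ρ : ℝ}
    (hgap : SpectralGap (averageCLM θ H.measurable) (integralCLM μ) (one X) C ρ) {g : X → ℝ}
    (hg : BddMeasurable g) (h0 : ∫ x, g x ∂μ = 0) :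
    Summable fun t : ℕ => ∫ x, g x * (averageOp F θ)^[t + 1] g x ∂μ := by
  obtain ⟨G, hG⟩ := hg.bounded
  have hm : integralCLM μ (BoundedMeasurable.ofReal g hg) = 0 := by
    rw [integralCLM_apply]
    have : ∫ x, eval (BoundedMeasurable.ofReal g hg) x ∂μ = ((∫ x, g x ∂μ : ℝ) : ℂ) :=
      integral_complex_ofReal
    rw [this, h0, Complex.ofReal_zero]
  set N := ‖BoundedMeasurable.ofReal g hg‖ with hN
  have hb : ∀ (k : ℕ) x, |(averageOp F θ)^[k] g x| ≤ C * ρ ^ k * N := by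
    intro k x
    have h1 := (norm_eval_le _ x).trans (hgap.decay k _ hm)
    rw [averageCLM_pow_ofReal, Complex.norm_real] at h1
    exact h1
  have hρ := hgap.ρ_nonneg
  refine Summable.of_norm_bounded (g := fun t => (G * (C * ρ * N)) * ρ ^ t)
    ((summable_geometric_of_lt_one hρ hgap.ρ_lt_one).mul_left _) fun t => ?_
  have := norm_integral_le_of_norm_le_const (μ := μ)
    (f := fun x => g x * (averageOp F θ)^[t + 1] g x) (C := G * (C * ρ ^ (t + 1) * N))
    (Eventually.of_forall fun x => by
      rw [norm_mul]
      exact mul_le_mul (hG x) (hb _ x) (abs_nonneg _) ((abs_nonneg _).trans (hG x)))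
  rw [probReal_univ, mul_one] at this
  refine this.trans (le_of_eq ?_)
  rw [pow_succ]; ring

/-- **Green–Kubo formula.** -/
theorem tendsto_variance (H : StationarySystem F θ μ) {g : X → ℝ} (hg : BddMeasurable g)
    (hs : Summable fun t : ℕ => ∫ x, g x * (averageOp F θ)^[t + 1] g x ∂μ) :
    Tendsto (fun t : ℕ => (1 / (t : ℝ)) * ∫ p, randomSum F g t p ^ 2 ∂(path θ μ)) atTop
      (𝓝 (∫ x, g x ^ 2 ∂μ + 2 * ∑' t : ℕ, ∫ x, g x * (averageOp F θ)^[t + 1] g x ∂μ)) := by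
  have h1 : Tendsto (fun t : ℕ => ∫ x, g x ^ 2 ∂μ +
      2 * ∑ k ∈ Finset.range t, ∫ x, g x * (averageOp F θ)^[k + 1] g x ∂μ) atTop
      (𝓝 (∫ x, g x ^ 2 ∂μ + 2 * ∑' t : ℕ, ∫ x, g x * (averageOp F θ)^[t + 1] g x ∂μ)) :=
    (hs.hasSum.tendsto_sum_nat.const_mul 2).const_add _
  -- The second moment is the sum over $j<t$ of its increments, which are the partial sums of the
  -- Green–Kubo series; the variance per step is thus their Cesàro mean.
  refine h1.cesaro.congr fun t => ?_
  rw [one_div]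
  congr 1
  induction t with
  | zero => simp [randomSum]
  | succ t ih => rw [Finset.sum_range_succ, ih, H.integral_randomSum_sq_succ hg t, add_comm]

end StationarySystem

/-! ### Minorization of random iterations -/

/-- The law of the `n`-th point of the random orbit of `x`. -/
def orbitLaw {X Y : Type*} [MeasurableSpace X] [MeasurableSpace Y] (F : Y → X → X)
    (θ : Measure Y) [IsProbabilityMeasure θ] (n : ℕ) (x : X) : Measure X :=
  (Measure.infinitePi fun _ : ℕ => θ).map fun ω => randomOrbit F ω x n

section Minorization

open StationarySystem BoundedMeasurable

variable {X Y : Type*} [MeasurableSpace X] [MeasurableSpace Y] {F : Y → X → X} {θ : Measure Y}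
  [IsProbabilityMeasure θ]

lemma measurable_randomOrbit_right (hF : Measurable fun p : Y × X => F p.1 p.2) (n : ℕ) (x : X) :
    Measurable fun ω : ℕ → Y => randomOrbit F ω x n :=
  (measurable_randomOrbit hF n).comp measurable_prodMk_right

lemma isProbabilityMeasure_orbitLaw (hF : Measurable fun p : Y × X => F p.1 p.2) (n : ℕ) (x : X) :
    IsProbabilityMeasure (orbitLaw F θ n x) :=
  Measure.isProbabilityMeasure_map (measurable_randomOrbit_right hF n x).aemeasurable

lemma measurable_orbitLaw (hF : Measurable fun p : Y × X => F p.1 p.2) (n : ℕ) {A : Set X}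
    (hA : MeasurableSet A) : Measurable fun x => orbitLaw F θ n x A := by
  have : (fun x => orbitLaw F θ n x A) = fun x => (Measure.infinitePi fun _ : ℕ => θ)
      ((fun ω : ℕ → Y => (ω, x)) ⁻¹' ((fun p : (ℕ → Y) × X => randomOrbit F p.1 p.2 n) ⁻¹' A)) := by
    ext x
    rw [orbitLaw, Measure.map_apply (measurable_randomOrbit_right hF n x) hA]
    rfl
  rw [this]
  exact measurable_measure_prodMk_right (measurable_randomOrbit hF n hA)

lemma orbitLaw_zero (x : X) : orbitLaw F θ 0 x = Measure.dirac x := by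
  have : (fun ω : ℕ → Y => randomOrbit F ω x 0) = fun _ => x := rfl
  rw [orbitLaw, this, Measure.map_const, measure_univ, one_smul]

lemma orbitLaw_succ (hF : Measurable fun p : Y × X => F p.1 p.2) (n : ℕ) (x : X) {A : Set X}
    (hA : MeasurableSet A) :
    orbitLaw F θ (n + 1) x A = ∫⁻ η, orbitLaw F θ n (F η x) A ∂θ := by
  have hmp := measurePreserving_consSeq θ
  have hm := measurable_randomOrbit_right hF (n + 1) x
  rw [orbitLaw, ← hmp.map_eq, Measure.map_map hm hmp.measurable,
    Measure.map_apply (hm.comp hmp.measurable) hA,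
    Measure.prod_apply ((hm.comp hmp.measurable) hA)]
  refine lintegral_congr fun η => ?_
  rw [orbitLaw, Measure.map_apply (measurable_randomOrbit_right hF n _) hA]
  congr 1
  ext ω
  simp [randomOrbit_consSeq]

lemma orbitLaw_one (hF : Measurable fun p : Y × X => F p.1 p.2) (x : X) {A : Set X}
    (hA : MeasurableSet A) : orbitLaw F θ 1 x A = θ ((fun η => F η x) ⁻¹' A) := by
  have hm : Measurable fun η => F η x := hF.comp measurable_prodMk_right
  rw [orbitLaw_succ hF 0 x hA, ← lintegral_indicator_one (hm hA)]
  refine lintegral_congr fun η => ?_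
  rw [orbitLaw_zero, Measure.dirac_apply' _ hA]
  rfl

/-- The Chapman–Kolmogorov equation. -/
lemma orbitLaw_add (hF : Measurable fun p : Y × X => F p.1 p.2) (n m : ℕ) (x : X) {A : Set X}
    (hA : MeasurableSet A) :
    orbitLaw F θ (n + m) x A = ∫⁻ y, orbitLaw F θ m y A ∂(orbitLaw F θ n x) := by
  have hm := measurable_orbitLaw (θ := θ) hF m hA
  have key : ∀ n x, ∫⁻ y, orbitLaw F θ m y A ∂(orbitLaw F θ n x) =
      ∫⁻ ω, orbitLaw F θ m (randomOrbit F ω x n) A ∂(Measure.infinitePi fun _ : ℕ => θ) :=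
    fun n x => lintegral_map hm (measurable_randomOrbit_right hF n x)
  induction n generalizing x with
  | zero => rw [Nat.zero_add, key]; simp [randomOrbit]
  | succ n ih =>
    have hmp := measurePreserving_consSeq θ
    have h1 : Measurable fun ω => orbitLaw F θ m (randomOrbit F ω x (n + 1)) A :=
      hm.comp (measurable_randomOrbit_right hF (n + 1) x)
    rw [show n + 1 + m = n + m + 1 by ring, orbitLaw_succ hF _ _ hA, key]
    conv_rhs => rw [← hmp.map_eq]
    rw [lintegral_map h1 hmp.measurable, lintegral_prod _ (show Measurable fun p : Y × (ℕ → Y) =>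
      orbitLaw F θ m (randomOrbit F (consSeq p.1 p.2) x (n + 1)) A from
        h1.comp hmp.measurable).aemeasurable]
    refine lintegral_congr fun η => ?_
    rw [ih, key]
    simp only [randomOrbit_consSeq]

lemma eval_averageCLM_pow (hF : Measurable fun p : Y × X => F p.1 p.2) (n : ℕ)
    (f : BoundedMeasurable X) (x : X) :
    eval ((averageCLM θ hF ^ n) f) x = ∫ y, eval f y ∂(orbitLaw F θ n x) := by
  have key : ∀ n x, ∫ y, eval f y ∂(orbitLaw F θ n x) =
      ∫ ω, eval f (randomOrbit F ω x n) ∂(Measure.infinitePi fun _ : ℕ => θ) := fun n x =>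
    integral_map (measurable_randomOrbit_right hF n x).aemeasurable
      f.measurable_eval.aestronglyMeasurable
  induction n generalizing x with
  | zero => simp [key, randomOrbit]
  | succ n ih =>
    rw [pow_succ', mul_apply_eq_comp, eval_weightedOp, eval_one, one_mul, key,
      integral_infinitePi_eq (φ := fun ω => eval f (randomOrbit F ω x (n + 1)))
        (f.measurable_eval.comp
        (measurable_randomOrbit_right hF (n + 1) x)).stronglyMeasurable
        ⟨‖f‖, fun ω => f.norm_eval_le _⟩]
    refine integral_congr_ae (Eventually.of_forall fun η => ?_)
    simp only [ih, key, randomOrbit_consSeq]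

/-- A uniform minorization (Doeblin condition) yields a spectral gap on bounded measurable
functions. -/
theorem StationarySystem.exists_spectralGap {μ : Measure X} [IsProbabilityMeasure μ]
    (H : StationarySystem F θ μ) {N : ℕ} (hN : 0 < N) {ν : Measure X} (hν0 : ν ≠ 0)
    (hν : ∀ x, ν ≤ orbitLaw F θ N x) :
    ∃ C ρ : ℝ, SpectralGap (averageCLM θ H.measurable) (integralCLM μ) (one X) C ρ := by
  have hX : Nonempty X := by
    by_contra hX
    rw [not_nonempty_iff] at hX
    exact hν0 (Measure.eq_zero_of_isEmpty ν)
  have hprob := fun x => isProbabilityMeasure_orbitLaw (θ := θ) H.measurable N x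
  have hνfin : IsFiniteMeasure ν := ⟨lt_of_le_of_lt (hν hX.some univ) (by simp)⟩
  have hpos : 0 < ν.real univ := by
    rw [measureReal_def]
    exact ENNReal.toReal_pos (by simpa using hν0) (measure_ne_top _ _)
  refine SpectralGap.exists_of_minorization norm_one_le ?_ (averageCLM_one θ H.measurable)
    H.integralCLM_averageCLM (norm_averageCLM_le θ H.measurable) (norm_integralCLM_le μ) hN
    -- The maximum with one half keeps the rate positive when `ν` has full mass.
    (γ := max (1 - ν.real univ) (1 / 2)) (by positivity)
    (max_lt (by linarith) (by norm_num)) (fun f => ∫ y, eval f y ∂ν) fun f => ?_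
  · rw [integralCLM_apply]; simp
  · refine norm_le (by positivity) fun x => ?_
    rw [eval_sub, eval_smul, eval_one, mul_one, eval_averageCLM_pow]
    have := hprob x
    have hdec := Measure.sub_add_cancel_of_le (hν x)
    -- What is left after removing `ν` has mass $1-\nu(X)$ for every $x$; its integral is the only
    -- part of the iterate depending on $x$.
    set τ := orbitLaw F θ N x - ν with hτ
    have hτfin : IsFiniteMeasure τ := by rw [hτ]; infer_instance
    have hmass : τ.real univ = 1 - ν.real univ := by
      have : (τ + ν).real univ = 1 := by rw [hdec]; simp
      rw [measureReal_add_apply] at this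
      linarith
    rw [← hdec, integral_add_measure (f.integrable_eval _) (f.integrable_eval _),
      add_sub_cancel_right]
    calc ‖∫ y, eval f y ∂τ‖ ≤ ‖f‖ * τ.real univ :=
          norm_integral_le_of_norm_le_const (Eventually.of_forall f.norm_eval_le)
      _ ≤ _ := by
          rw [hmass, mul_comm]
          gcongr
          exact le_max_left _ _

/-- From all points near `x`, the set `V` is reached at time `n` with probability bounded below. -/
def Reaches [TopologicalSpace X] (F : Y → X → X) (θ : Measure Y) [IsProbabilityMeasure θ]
    (V : Set X) (n : ℕ) (x : X) : Prop :=
  ∃ c : ENNReal, c ≠ 0 ∧ ∀ᶠ y in 𝓝 x, c ≤ orbitLaw F θ n y V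

variable [TopologicalSpace X]

lemma Reaches.of_mem {V : Set X} (hV : IsOpen V) (hVm : MeasurableSet V) {x : X} (hx : x ∈ V) :
    Reaches F θ V 0 x := by
  refine ⟨1, one_ne_zero, ?_⟩
  filter_upwards [hV.mem_nhds hx] with y hy
  rw [orbitLaw_zero, Measure.dirac_apply' _ hVm, indicator_of_mem hy]
  rfl

/-- By joint continuity, noises near `η` carry points near `x` into the good neighbourhood of `F η
x`. Such noises have positive probability, independent of the point, which multiplies the lower
bound. -/
lemma Reaches.step [TopologicalSpace Y] (hF : Measurable fun p : Y × X => F p.1 p.2)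
    (hFc : Continuous fun p : Y × X => F p.1 p.2) {V : Set X} (hV : MeasurableSet V) {n : ℕ}
    {η : Y} (hη : ∀ J ∈ 𝓝 η, θ J ≠ 0) {x : X} (h : Reaches F θ V n (F η x)) :
    Reaches F θ V (n + 1) x := by
  obtain ⟨c, hc, h⟩ := h
  have h1 : ∀ᶠ p : Y × X in 𝓝 (η, x), c ≤ orbitLaw F θ n (F p.1 p.2) V :=
    (hFc.tendsto (η, x)).eventually h
  rw [nhds_prod_eq] at h1
  obtain ⟨pa, ha, pb, hb, hab⟩ := eventually_prod_iff.1 h1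
  refine ⟨c * θ {η | pa η}, mul_ne_zero hc (hη _ ha), ?_⟩
  filter_upwards [hb] with y hy
  have hms : MeasurableSet {η' | c ≤ orbitLaw F θ n (F η' y) V} :=
    measurableSet_le measurable_const
      ((measurable_orbitLaw hF n hV).comp (hF.comp measurable_prodMk_right))
  rw [orbitLaw_succ hF n y hV]
  calc c * θ {η | pa η} ≤ c * θ {η' | c ≤ orbitLaw F θ n (F η' y) V} := by
        gcongr
        exact fun hpa => hab hpa hy
    _ ≤ _ := by
        have := mul_meas_ge_le_lintegral₀ (μ := θ) (f := fun η' => orbitLaw F θ n (F η' y) V)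
          ((measurable_orbitLaw hF n hV).comp (hF.comp measurable_prodMk_right)).aemeasurable c
        exact this

lemma Reaches.iterate [TopologicalSpace Y] (hF : Measurable fun p : Y × X => F p.1 p.2)
    (hFc : Continuous fun p : Y × X => F p.1 p.2) {V : Set X} (hV : MeasurableSet V) {n : ℕ}
    {η : Y} (hη : ∀ J ∈ 𝓝 η, θ J ≠ 0) (k : ℕ) {x : X} (h : Reaches F θ V n ((F η)^[k] x)) :
    Reaches F θ V (n + k) x := by
  induction k generalizing x with
  | zero => exact h
  | succ k ih => exact (ih (x := F η x) h).step hF hFc hV hη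

/-- Uniform minorization at all large times, from a local minorization and reachability. -/
theorem exists_uniform_minorization (hF : Measurable fun p : Y × X => F p.1 p.2) {K : Set X}
    (hK : IsCompact K) (hmaps : ∀ x, ∀ᵐ η ∂θ, F η x ∈ K) {V : Set X} (hV : MeasurableSet V)
    {ν : Measure X} (hνV : ν V ≠ 0) (hone : ∀ x ∈ V, ν ≤ orbitLaw F θ 1 x)
    (hreach : ∀ x ∈ K, ∃ n, Reaches F θ V n x) :
    ∃ N > 0, ∃ c : ENNReal, c ≠ 0 ∧ ∀ x, c • ν ≤ orbitLaw F θ N x := by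
  -- Since `ν` charges `V`, mass can remain in `V` for any further number of steps. This removes
  -- periodicity and lets different arrival times be synchronized.
  have hstay : ∀ n : ℕ, ∃ c : ENNReal, c ≠ 0 ∧ ∀ x ∈ V, c • ν ≤ orbitLaw F θ (n + 1) x := by
    intro n
    induction n with
    | zero => exact ⟨1, one_ne_zero, by simpa using hone⟩
    | succ n ih =>
      obtain ⟨c, hc, h⟩ := ih
      refine ⟨c * ν V, mul_ne_zero hc hνV, fun x hx => Measure.le_iff.2 fun A hA => ?_⟩
      rw [show n + 1 + 1 = 1 + (n + 1) by ring, orbitLaw_add hF _ _ _ hA]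
      calc (c * ν V) • ν A = ∫⁻ _ in V, c * ν A ∂ν := by
            rw [setLIntegral_const, smul_eq_mul]; ring
        _ ≤ ∫⁻ y in V, orbitLaw F θ (n + 1) y A ∂ν :=
            setLIntegral_mono' hV fun y hy => h y hy A
        _ ≤ ∫⁻ y in V, orbitLaw F θ (n + 1) y A ∂(orbitLaw F θ 1 x) :=
            lintegral_mono' (Measure.restrict_mono le_rfl (hone x hx)) le_rfl
        _ ≤ _ := setLIntegral_le_lintegral _ _
  -- Asking for all late times, rather than one time, makes the property stable under finite unions,
  -- as the compactness induction demands.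
  have hcomp : ∃ M : ℕ, ∀ n ≥ M, ∃ c : ENNReal, c ≠ 0 ∧ ∀ x ∈ K, c • ν ≤ orbitLaw F θ n x := by
    refine hK.induction_on (p := fun s => ∃ M : ℕ, ∀ n ≥ M, ∃ c : ENNReal, c ≠ 0 ∧
      ∀ x ∈ s, c • ν ≤ orbitLaw F θ n x) ?_ ?_ ?_ ?_
    · exact ⟨0, fun n _ => ⟨1, one_ne_zero, fun x hx => hx.elim⟩⟩
    · rintro s t hst ⟨M, hM⟩
      refine ⟨M, fun n hn => ?_⟩
      obtain ⟨c, hc, h⟩ := hM n hn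
      exact ⟨c, hc, fun x hx => h x (hst hx)⟩
    · rintro s t ⟨M, hM⟩ ⟨M', hM'⟩
      refine ⟨max M M', fun n hn => ?_⟩
      obtain ⟨c, hc, h⟩ := hM n (le_of_max_le_left hn)
      obtain ⟨c', hc', h'⟩ := hM' n (le_of_max_le_right hn)
      refine ⟨min c c', by simp [min_eq_zero, hc, hc'], fun x hx => ?_⟩
      rcases hx with hx | hx
      · exact (Measure.le_iff.2 fun A _ => by
          simp only [Measure.smul_apply, smul_eq_mul]; gcongr; exact min_le_left _ _).trans (h x hx)
      · exact (Measure.le_iff.2 fun A _ => by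
          simp only [Measure.smul_apply, smul_eq_mul]; gcongr; exact min_le_right _ _).trans
            (h' x hx)
    · intro x hx
      obtain ⟨n, c, hc, h⟩ := hreach x hx
      refine ⟨_, mem_nhdsWithin_of_mem_nhds h, n + 1, fun m hm => ?_⟩
      obtain ⟨j, rfl⟩ := Nat.exists_eq_add_of_le hm
      obtain ⟨c', hc', h'⟩ := hstay j
      refine ⟨c' * c, mul_ne_zero hc' hc, fun y hy => Measure.le_iff.2 fun A hA => ?_⟩
      rw [show n + 1 + j = n + (j + 1) by ring, orbitLaw_add hF _ _ _ hA]
      calc (c' * c) • ν A = c' * ν A * c := by rw [smul_eq_mul]; ring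
        _ ≤ c' * ν A * orbitLaw F θ n y V := by gcongr; exact hy
        _ = ∫⁻ _ in V, c' * ν A ∂(orbitLaw F θ n y) := by rw [setLIntegral_const]
        _ ≤ ∫⁻ z in V, orbitLaw F θ (j + 1) z A ∂(orbitLaw F θ n y) :=
            setLIntegral_mono' hV fun z hz => h' z hz A
        _ ≤ _ := setLIntegral_le_lintegral _ _
  obtain ⟨M, hM⟩ := hcomp
  obtain ⟨c, hc, h⟩ := hM M le_rfl
  -- The extra step brings an arbitrary starting point into `K`.
  refine ⟨M + 1, Nat.succ_pos M, c, hc, fun x => Measure.le_iff.2 fun A hA => ?_⟩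
  rw [orbitLaw_succ hF M x hA]
  calc (c • ν) A = ∫⁻ _, (c • ν) A ∂θ := by simp
    _ ≤ _ := lintegral_mono_ae ((hmaps x).mono fun η hη => h _ hη A)

end Minorization

/-! ### The random map near its attractor -/

section Affine

variable {T σ : ℝ → ℝ} {a s₀ s₁ b e d₁ d₂ : ℝ}

/-- From any point of an invariant interval, one noise step, deterministic motion and a second noise
step lead into the interior of the attractor. -/
lemma exists_jump (ha : 0 < a) (hs : 0 < s₀) (hσ : ∀ x ∈ Icc b e, s₀ ≤ σ x)
    (hK : ∀ x ∈ Icc b e, Ioo (T x - a * σ x) (T x + a * σ x) ⊆ Icc b e) (hd : d₁ < d₂)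
    (hattr : ∀ᵐ x ∂(volume.restrict (Icc b e)),
      Tendsto (fun t : ℕ => Metric.infDist (T^[t] x) (Icc d₁ d₂)) atTop (𝓝 0))
    {x : ℝ} (hx : x ∈ Icc b e) :
    ∃ y ∈ Ioo (T x - a * σ x) (T x + a * σ x), ∃ t : ℕ, T^[t] y ∈ Icc b e ∧
      (Ioo (T (T^[t] y) - a * σ (T^[t] y)) (T (T^[t] y) + a * σ (T^[t] y)) ∩
        Ioo d₁ d₂).Nonempty := by
  have hpos : ∀ x ∈ Icc b e, 0 < a * σ x := fun x hx => mul_pos ha (hs.trans_le (hσ x hx))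
  have hmaps : MapsTo T (Icc b e) (Icc b e) := fun x hx =>
    hK x hx ⟨by linarith [hpos x hx], by linarith [hpos x hx]⟩
  have hvol : 0 < volume.restrict (Icc b e) (Ioo (T x - a * σ x) (T x + a * σ x)) := by
    rw [Measure.restrict_eq_self _ (hK x hx), Real.volume_Ioo]
    exact ENNReal.ofReal_pos.2 (by linarith [hpos x hx])
  -- The first noise interval has positive length, so it cannot avoid the points attracted to the
  -- core.
  obtain ⟨y, hy, hty⟩ : ∃ y ∈ Ioo (T x - a * σ x) (T x + a * σ x),
      Tendsto (fun t : ℕ => Metric.infDist (T^[t] y) (Icc d₁ d₂)) atTop (𝓝 0) := by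
    by_contra! hcon
    refine hvol.ne' (measure_mono_null (fun y hy => ?_) (ae_iff.1 hattr))
    exact hcon y hy
  have hyK := hK x hx hy
  -- The shift by one makes the image $T^{t+1}y$ close to the core, so that the noise applied at
  -- $T^ty$ can bridge the remaining distance, which is less than $as_0$.
  obtain ⟨t, ht⟩ := ((tendsto_add_atTop_iff_nat 1).2 hty |>.eventually
    (gt_mem_nhds (mul_pos ha hs))).exists
  obtain ⟨w, hw, hdist⟩ := (Metric.infDist_lt_iff ⟨d₁, left_mem_Icc.2 hd.le⟩).1 ht
  have htK := hmaps.iterate t hyK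
  refine ⟨y, hy, t, htK, ?_⟩
  rw [Function.iterate_succ_apply', Real.dist_eq, abs_lt] at hdist
  have h1 : a * s₀ ≤ a * σ (T^[t] y) := by gcongr; exact hσ _ htK
  have hwo : w ∈ Ioo (T (T^[t] y) - a * σ (T^[t] y)) (T (T^[t] y) + a * σ (T^[t] y)) :=
    ⟨by linarith, by linarith⟩
  rw [← closure_Ioo hd.ne] at hw
  exact mem_closure_iff.1 hw _ isOpen_Ioo hwo

/-- An invariant interval contains the attractor. -/
lemma attractor_subset (ha : 0 < a) (hs : 0 < s₀) (hσ : ∀ x ∈ Icc b e, s₀ ≤ σ x) (hbe : b ≤ e)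
    (hK : ∀ x ∈ Icc b e, Ioo (T x - a * σ x) (T x + a * σ x) ⊆ Icc b e) (hd : d₁ < d₂)
    (htr : TopTransitiveOn T (Icc d₁ d₂))
    (hattr : ∀ᵐ x ∂(volume.restrict (Icc b e)),
      Tendsto (fun t : ℕ => Metric.infDist (T^[t] x) (Icc d₁ d₂)) atTop (𝓝 0)) :
    Icc d₁ d₂ ⊆ Icc b e := by
  have hpos : ∀ x ∈ Icc b e, 0 < a * σ x := fun x hx => mul_pos ha (hs.trans_le (hσ x hx))
  have hmaps : MapsTo T (Icc b e) (Icc b e) := fun x hx =>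
    hK x hx ⟨by linarith [hpos x hx], by linarith [hpos x hx]⟩
  obtain ⟨y, -, t, htK, u, hu⟩ := exists_jump ha hs hσ hK hd hattr (left_mem_Icc.2 hbe)
  intro w hw
  rw [← isClosed_Icc.closure_eq (s := Icc b e), mem_closure_iff]
  intro U hU hwU
  -- A noise window inside $[b,e]$ meets the core in an open set. By transitivity, orbits from it
  -- visit every neighbourhood in the core and never leave the closed interval.
  obtain ⟨k, v, hv, hkv⟩ := htr U _ hU (isOpen_Ioo.inter isOpen_Ioo) ⟨w, hwU, hw⟩
    ⟨u, hu, Ioo_subset_Icc_self hu.2⟩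
  exact ⟨_, hkv.1, hmaps.iterate k (hK _ htK hv.1.1)⟩

/-- Minorization for a map with nondegenerate additive noise and a transitive attractor. -/
theorem exists_minorization_affine (hT : Continuous T) (hσc : Continuous σ) (ha : 0 < a)
    (hs : 0 < s₀) (hσ : ∀ x, s₀ ≤ σ x) (hσ1 : ∀ x, σ x ≤ s₁)
    (hK : ∀ x, Ioo (T x - a * σ x) (T x + a * σ x) ⊆ Icc b e) (hd : d₁ < d₂)
    (hinv : MapsTo T (Icc d₁ d₂) (Icc d₁ d₂)) (htr : TopTransitiveOn T (Icc d₁ d₂))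
    (hattr : ∀ᵐ x ∂(volume.restrict (Icc b e)),
      Tendsto (fun t : ℕ => Metric.infDist (T^[t] x) (Icc d₁ d₂)) atTop (𝓝 0))
    {θ : Measure ℝ} [IsProbabilityMeasure θ] (hθ : ∀ᵐ η ∂θ, η ∈ Ioo (-a) a) {m : ENNReal}
    (hm : m ≠ 0) (hdens : m • volume.restrict (Icc (-(a / 2)) (a / 2)) ≤ θ)
    (hsupp : ∀ η ∈ Ioo (-a) a, ∀ J ∈ 𝓝 η, θ J ≠ 0) :
    ∃ N > 0, ∃ ν : Measure ℝ, ν ≠ 0 ∧ ∀ x, ν ≤ orbitLaw (fun η x => T x + σ x * η) θ N x := by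
  set F : ℝ → ℝ → ℝ := fun η x => T x + σ x * η with hFdef
  have hFc : Continuous fun p : ℝ × ℝ => F p.1 p.2 := by simp only [hFdef]; fun_prop
  have hF : Measurable fun p : ℝ × ℝ => F p.1 p.2 := hFc.measurable
  have hσpos : ∀ x, 0 < σ x := fun x => hs.trans_le (hσ x)
  have hFmem : ∀ x η, η ∈ Ioo (-a) a → F η x ∈ Ioo (T x - a * σ x) (T x + a * σ x) := by
    intro x η hη
    have := hσpos x
    constructor <;> simp only [hFdef] <;> nlinarith [hη.1, hη.2]
  have hFsurj : ∀ x, ∀ y ∈ Ioo (T x - a * σ x) (T x + a * σ x), ∃ η ∈ Ioo (-a) a, F η x = y := by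
    intro x y hy
    have := hσpos x
    refine ⟨(y - T x) / σ x, ⟨?_, ?_⟩, ?_⟩
    · rw [lt_div_iff₀ this]; linarith [hy.1]
    · rw [div_lt_iff₀ this]; linarith [hy.2]
    · simp only [hFdef]; field_simp; ring
  have hF0 : F 0 = T := by ext x; simp [hFdef]
  have h0 : (0 : ℝ) ∈ Ioo (-a) a := ⟨by linarith, ha⟩
  -- Near a fixed point in the core, moving from one point of a small ball to another needs only
  -- moderate noise.
  obtain ⟨z, hz, hfix⟩ := exists_mem_Icc_isFixedPt_of_mapsTo hT.continuousOn hd.le hinv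
  -- For $x\in V$ both $T(x)$ and the target lie within $r$ of $z$, so $\sigma(x)|\eta|\le2r=as_0/2$
  -- and $|\eta|\le a/2$, where the noise density is bounded below.
  set r := a * s₀ / 4 with hr
  have hrpos : 0 < r := by positivity
  obtain ⟨δ, hδ, hδT⟩ := Metric.continuousAt_iff.1 (hT.continuousAt (x := z)) r hrpos
  rw [hfix.eq] at hδT
  set V := Metric.ball z (min δ r) with hV
  have hVm : MeasurableSet V := Metric.isOpen_ball.measurableSet
  have hs1 : 0 < s₁ := (hσpos z).trans_le (hσ1 z)
  set c := m * ENNReal.ofReal s₁⁻¹ with hc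
  have hc0 : c ≠ 0 := mul_ne_zero hm (by simpa using hs1)
  have hone : ∀ x ∈ V, c • volume.restrict V ≤ orbitLaw F θ 1 x := by
    intro x hx
    refine Measure.le_iff.2 fun A hA => ?_
    rw [orbitLaw_one hF x hA]
    have hx' := hδT (lt_of_lt_of_le hx (min_le_left _ _))
    have hsub : (fun η => F η x) ⁻¹' (A ∩ V) ⊆
        (fun η => F η x) ⁻¹' A ∩ Icc (-(a / 2)) (a / 2) := by
      rintro η ⟨hηA, hηV⟩
      refine ⟨hηA, ?_⟩
      have h1 : dist (F η x) z < r := lt_of_lt_of_le (Metric.mem_ball.1 hηV) (min_le_right _ _)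
      rw [Real.dist_eq, abs_lt] at h1 hx'
      have h2 : |σ x * η| ≤ a * s₀ / 2 := by
        simp only [hFdef] at h1
        rw [abs_le]; constructor <;> linarith [h1.1, h1.2, hx'.1, hx'.2]
      rw [abs_mul, abs_of_pos (hσpos x)] at h2
      have h3 : s₀ * |η| ≤ s₀ * (a / 2) :=
        (mul_le_mul_of_nonneg_right (hσ x) (abs_nonneg _)).trans (h2.trans (by linarith))
      exact abs_le.1 (le_of_mul_le_mul_left h3 hs)
    have hvol : volume ((fun η => F η x) ⁻¹' (A ∩ V)) =
        ENNReal.ofReal (σ x)⁻¹ * volume (A ∩ V) := by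
      have : (fun η => F η x) ⁻¹' (A ∩ V) =
          (fun η => σ x * η) ⁻¹' ((fun y => T x + y) ⁻¹' (A ∩ V)) := rfl
      rw [this, Real.volume_preimage_mul_left (hσpos x).ne', measure_preimage_add,
        abs_of_pos (inv_pos.2 (hσpos x))]
    calc (c • volume.restrict V) A = m * (ENNReal.ofReal s₁⁻¹ * volume (A ∩ V)) := by
          rw [Measure.smul_apply, Measure.restrict_apply hA, smul_eq_mul, hc, mul_assoc]
      _ ≤ m * (ENNReal.ofReal (σ x)⁻¹ * volume (A ∩ V)) := by
          gcongr
          · exact hσpos x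
          · exact hσ1 x
      _ ≤ m * volume ((fun η => F η x) ⁻¹' A ∩ Icc (-(a / 2)) (a / 2)) := by
          rw [← hvol]; gcongr
      _ = (m • volume.restrict (Icc (-(a / 2)) (a / 2))) ((fun η => F η x) ⁻¹' A) := by
          have hmx : Measurable fun η => F η x := hF.comp (measurable_prodMk_right (y := x))
          rw [Measure.smul_apply, Measure.restrict_apply (hmx hA), smul_eq_mul]
      _ ≤ _ := hdens _
  have hVpos : volume V ≠ 0 := (Metric.measure_ball_pos volume z (lt_min hδ hrpos)).ne'
  have hνV : (c • volume.restrict V) V ≠ 0 := by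
    rw [Measure.smul_apply, Measure.restrict_apply_self, smul_eq_mul]
    exact mul_ne_zero hc0 hVpos
  have hreach : ∀ x ∈ Icc b e, ∃ n, Reaches F θ V n x := by
    intro x hx
    -- The route is: noise to $y$, $t$ noiseless steps, noise to $v$ in the core, $k$ noiseless
    -- steps into `V`. Reachability is built backwards along it, zero being an admissible noise.
    obtain ⟨y, hy, t, -, u, hu⟩ := exists_jump ha hs (fun x _ => hσ x) (fun x _ => hK x) hd hattr hx
    obtain ⟨k, v, hv, hkv⟩ := htr V _ Metric.isOpen_ball (isOpen_Ioo.inter isOpen_Ioo)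
      ⟨z, Metric.mem_ball_self (lt_min hδ hrpos), hz⟩ ⟨u, hu, Ioo_subset_Icc_self hu.2⟩
    have h1 : Reaches F θ V 0 ((F 0)^[k] v) := by
      rw [hF0]; exact Reaches.of_mem Metric.isOpen_ball hVm hkv.1
    have h2 := h1.iterate hF hFc hVm (hsupp 0 h0)
    obtain ⟨η, hη, hηv⟩ := hFsurj _ v hv.1.1
    rw [← hηv] at h2
    have h3 := h2.step hF hFc hVm (hsupp η hη)
    rw [← hF0] at h3
    have h4 := h3.iterate hF hFc hVm (hsupp 0 h0)
    obtain ⟨η', hη', hηy⟩ := hFsurj _ y hy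
    rw [← hηy] at h4
    exact ⟨_, h4.step hF hFc hVm (hsupp η' hη')⟩
  obtain ⟨N, hN, c', hc', h⟩ := exists_uniform_minorization hF isCompact_Icc
    (fun x => hθ.mono fun η hη => hK x (hFmem x η hη)) hVm hνV hone hreach
  refine ⟨N, hN, c' • c • volume.restrict V, fun h0 => ?_, h⟩
  have := congrArg (fun ν : Measure ℝ => ν V) h0
  rw [Measure.smul_apply, smul_eq_mul] at this
  exact mul_ne_zero hc' hνV this

end Affine

/-! ### Localization of the stationary measure -/

namespace RandomSystem

variable (S : RandomSystem)

lemma a_pos : 0 < S.a := S.noise_assumption.a_pos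

lemma gap_pos : 0 < gap S.T S.c := sub_pos.2 S.map_assumption.max_lt_one

lemma gap_le_one : gap S.T S.c ≤ 1 := by
  have := (S.map_assumption.mapsTo S.map_assumption.c_mem).1
  unfold gap
  linarith

lemma normConst_pos : 0 < S.normConst := inv_pos.2 S.weight_integral_pos

lemma noiseDensity_eq_zero {η : ℝ} (hη : η ∉ Ioo (-S.a) S.a) : S.noiseDensity η = 0 := by
  rw [← S.bump_assumption.support_eq, Function.notMem_support] at hη
  simp [noiseDensity, hη]

lemma noiseDensity_pos {η : ℝ} (hη : η ∈ Ioo (-S.a) S.a) : 0 < S.noiseDensity η := by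
  rw [← S.bump_assumption.support_eq, Function.mem_support] at hη
  have := lt_of_le_of_ne (S.bump_assumption.nonneg η) hη.symm
  have := S.normConst_pos
  unfold noiseDensity
  positivity

lemma continuous_noiseDensity : Continuous S.noiseDensity := by
  have := S.bump_assumption.contDiff.continuous
  unfold noiseDensity
  fun_prop

lemma ae_mem_noise : ∀ᵐ η ∂S.θ, η ∈ Ioo (-S.a) S.a := by
  rw [θ, ae_withDensity_iff S.continuous_noiseDensity.measurable.ennreal_ofReal]
  refine Eventually.of_forall fun η hη => ?_
  by_contra hcon
  simp [S.noiseDensity_eq_zero hcon] at hη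

lemma noise_absolutelyContinuous : S.θ ≪ volume := withDensity_absolutelyContinuous _ _

lemma noise_nhds_ne_zero : ∀ η ∈ Ioo (-S.a) S.a, ∀ J ∈ 𝓝 η, S.θ J ≠ 0 := by
  intro η hη J hJ h0
  obtain ⟨u, hu, huo, hηu⟩ := mem_nhds_iff.1 (inter_mem hJ (isOpen_Ioo.mem_nhds hη))
  have h1 : S.θ u = 0 := measure_mono_null (hu.trans inter_subset_left) h0
  rw [θ, withDensity_apply_eq_zero S.continuous_noiseDensity.measurable.ennreal_ofReal] at h1
  have hsub : u ⊆ {y | ENNReal.ofReal (S.noiseDensity y) ≠ 0} ∩ u := fun y hy =>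
    ⟨by simpa using S.noiseDensity_pos (hu hy).2, hy⟩
  exact (huo.measure_pos volume ⟨η, hηu⟩).ne' (measure_mono_null hsub h1)

lemma exists_noise_minorization :
    ∃ m : ENNReal, m ≠ 0 ∧ m • volume.restrict (Icc (-(S.a / 2)) (S.a / 2)) ≤ S.θ := by
  have ha := S.a_pos
  obtain ⟨y, hy, hmin⟩ := (isCompact_Icc (a := -(S.a / 2)) (b := S.a / 2)).exists_isMinOn
    ⟨0, by constructor <;> linarith⟩ S.continuous_noiseDensity.continuousOn
  refine ⟨ENNReal.ofReal (S.noiseDensity y), ?_, Measure.le_iff.2 fun A hA => ?_⟩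
  · simpa using S.noiseDensity_pos ⟨by linarith [hy.1], by linarith [hy.2]⟩
  · rw [θ, withDensity_apply _ hA, Measure.smul_apply, smul_eq_mul, Measure.restrict_apply hA,
      ← setLIntegral_const]
    calc ∫⁻ _ in A ∩ Icc (-(S.a / 2)) (S.a / 2), ENNReal.ofReal (S.noiseDensity y)
        ≤ ∫⁻ z in A ∩ Icc (-(S.a / 2)) (S.a / 2), ENNReal.ofReal (S.noiseDensity z) :=
          setLIntegral_mono' (hA.inter measurableSet_Icc) fun z hz =>
            ENNReal.ofReal_le_ofReal (hmin hz.2)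
      _ ≤ _ := lintegral_mono_set inter_subset_left

lemma measurable_randomMap : Measurable fun p : ℝ × ℝ => S.randomMap p.1 p.2 := by
  have h1 := S.extension_assumption.measurable
  have h2 := S.noise_assumption.measurable
  unfold randomMap
  fun_prop

lemma map_le_of_mem {x : ℝ} (hx : x ∈ S.space) : S.T x ≤ 1 - gap S.T S.c := by
  have hc : 1 - gap S.T S.c = S.T S.c := by unfold gap; ring
  rw [hc]
  rcases le_total 0 x with h | h
  · by_cases hxc : x = S.c
    · rw [hxc]
    · exact (S.map_assumption.unique_max x ⟨h, hx.2⟩ hxc).le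
  · exact (S.extension_assumption.antitoneOn ⟨le_rfl, by linarith [S.gap_pos]⟩ ⟨hx.1, h⟩ hx.1).trans
      S.extension_assumption.left_lt.le

lemma le_map_of_nonpos {x : ℝ} (hx : x ∈ S.space) (h : x ≤ 0) : S.T 0 ≤ S.T x :=
  S.extension_assumption.antitoneOn ⟨hx.1, h⟩ ⟨by linarith [S.gap_pos], le_rfl⟩ h

lemma noise_le {x : ℝ} (hx : x ∈ S.space) : S.a * S.σ x ≤ gap S.T S.c / 2 := by
  rcases S.noise_assumption.cases with ⟨-, -, h, -⟩ | ⟨-, h⟩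
  · exact h x hx
  · exact (h x hx).trans (min_le_left _ _)

lemma upper_le {x : ℝ} (hx : x ∈ S.space) : S.T x + S.a * S.σ x ≤ 1 - gap S.T S.c / 2 := by
  linarith [S.map_le_of_mem hx, S.noise_le hx]

lemma randomMap_mem {x η : ℝ} (hx : x ∈ S.space) (hη : η ∈ Ioo (-S.a) S.a) :
    S.randomMap η x ∈ Icc (S.T x - S.a * S.σ x) (S.T x + S.a * S.σ x) := by
  have := S.noise_assumption.nonneg x hx
  unfold randomMap
  constructor <;> nlinarith [hη.1, hη.2]

variable {S} {μ : Measure ℝ} {h : ℝ → ℝ}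

lemma IsStationary.stationarySystem [IsProbabilityMeasure μ] (hμ : S.IsStationary μ) :
    StationarySystem S.randomMap S.θ μ := by
  refine ⟨S.measurable_randomMap, ?_⟩
  ext A hA
  rw [Measure.map_apply S.measurable_randomMap hA,
    Measure.prod_apply_symm (S.measurable_randomMap hA), ← hμ A hA]
  rfl

lemma HasBVDensity.absolutelyContinuous (hh : S.HasBVDensity μ h) :
    μ ≪ volume.restrict S.space := by
  rw [hh.eq_withDensity]
  exact withDensity_absolutelyContinuous _ _

lemma HasBVDensity.ae_mem_space (hh : S.HasBVDensity μ h) : ∀ᵐ x ∂μ, x ∈ S.space :=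
  hh.absolutelyContinuous.ae_le (ae_restrict_mem measurableSet_Icc)

/-- A property that holds after one step holds almost surely. -/
lemma IsStationary.ae_of_step (hμ : S.IsStationary μ) {A : Set ℝ} (hA : MeasurableSet A)
    (h : ∀ᵐ x ∂μ, ∀ η ∈ Ioo (-S.a) S.a, S.randomMap η x ∈ A) : ∀ᵐ x ∂μ, x ∈ A := by
  rw [ae_iff]
  change μ Aᶜ = 0
  rw [← hμ _ hA.compl, lintegral_eq_zero_iff']
  · filter_upwards [h] with x hx
    exact ae_iff.1 (S.ae_mem_noise.mono fun η hη => hx η hη)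
  · exact (measurable_measure_prodMk_right (S.measurable_randomMap hA.compl)).aemeasurable

lemma continuousOn_lower {b e : ℝ} (hb : 0 < b) (he : e < 1) :
    ContinuousOn (fun x => S.T x - S.a * S.σ x) (Icc b e) := by
  refine (S.map_assumption.continuousOn.mono (Icc_subset_Icc hb.le he.le)).sub
    (continuousOn_const.mul (S.noise_assumption.differentiableOn.continuousOn.mono ?_))
  exact Icc_subset_Ioo hb he

lemma IsStationary.ae_le (hμ : S.IsStationary μ) (hh : S.HasBVDensity μ h) :
    ∀ᵐ x ∂μ, x ≤ 1 - gap S.T S.c / 2 :=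
  hμ.ae_of_step measurableSet_Iic (hh.ae_mem_space.mono fun _ hx _ hη =>
    (S.randomMap_mem hx hη).2.trans (S.upper_le hx))

/-- When `0` is fixed, almost every point is positive. -/
lemma IsStationary.ae_pos [IsProbabilityMeasure μ] (hμ : S.IsStationary μ) (hh : S.HasBVDensity μ h) (h0 : S.T 0 = 0) :
    ∀ᵐ x ∂μ, 0 < x := by
  have ha := S.a_pos
  have hne : ∀ᵐ x ∂μ, x ≠ 0 := by
    rw [ae_iff]
    have : {x : ℝ | ¬ x ≠ 0} = {0} := by ext x; simp
    rw [this]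
    exact hh.absolutelyContinuous (measure_mono_null subset_rfl
      (Measure.absolutelyContinuous_of_le Measure.restrict_le_self Real.volume_singleton))
  have hθ : S.θ (Iio 0) < 1 := by
    have h1 : S.θ (Ioi 0) ≠ 0 := S.noise_nhds_ne_zero (S.a / 2) ⟨by linarith, by linarith⟩ _
      (Ioi_mem_nhds (by linarith))
    have h2 : S.θ (Iio 0) + S.θ (Ioi 0) ≤ 1 := by
      rw [← measure_union (by
        rw [Set.disjoint_left]; intro x hx hx'; exact lt_asymm (mem_Iio.1 hx) (mem_Ioi.1 hx')) measurableSet_Ioi]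
      exact prob_le_one
    refine lt_of_lt_of_le (ENNReal.lt_add_right (measure_ne_top _ _) h1) h2
  -- From a negative point only negative noise gives a negative image, because $T\ge T(0)=0$ there;
  -- from a positive point none does. Negative noise has probability below one, so the negative mass
  -- must vanish.
  have hstep : μ (Iio 0) ≤ S.θ (Iio 0) * μ (Iio 0) := by
    rw [← setLIntegral_const]
    nth_rewrite 1 [← hμ _ measurableSet_Iio]
    rw [← lintegral_indicator measurableSet_Iio]
    refine lintegral_mono_ae ?_
    filter_upwards [hh.ae_mem_space, hne, hμ.ae_le hh] with x hx hx0 hxe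
    rcases lt_or_gt_of_ne hx0 with hneg | hpos
    · rw [indicator_of_mem (show x ∈ Iio 0 from hneg)]
      refine measure_mono fun η hη => ?_
      by_contra hcon
      have h1 := S.le_map_of_nonpos hx hneg.le
      have h2 : 0 ≤ S.σ x * η := mul_nonneg (S.noise_assumption.nonneg x hx) (not_lt.1 hcon)
      have h3 : S.T x + S.σ x * η < 0 := hη
      linarith
    · have h1 := S.noise_assumption.lower_pos x ⟨hpos, hxe⟩
      have : S.transition x (Iio 0) = 0 := measure_mono_null (fun η hη => by
        change ¬ _
        intro hcon
        exact absurd (show S.randomMap η x < 0 from hη)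
          (not_lt.2 (h1.le.trans (S.randomMap_mem hx hcon).1))) (ae_iff.1 S.ae_mem_noise)
      rw [this]
      exact zero_le
  have hz : μ (Iio 0) = 0 := by
    by_contra hcon
    have := ENNReal.mul_lt_mul_left hcon (measure_ne_top μ _) hθ
    rw [one_mul] at this
    exact absurd hstep (not_le.2 this)
  have hnn : ∀ᵐ x ∂μ, 0 ≤ x := by
    rw [ae_iff]
    simp only [not_le]
    exact hz
  filter_upwards [hnn, hne] with x h1 h2
  exact lt_of_le_of_ne h1 h2.symm

/-- Points that are pushed up by every noise below the level `ε`, and never fall below it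
afterwards, do not charge the stationary measure. -/
lemma IsStationary.ae_ge_of_pushed [IsProbabilityMeasure μ] (hμ : S.IsStationary μ) {ε : ℝ}
    (hpush : ∀ᵐ x ∂μ, ∀ η ∈ Ioo (-S.a) S.a, x < ε → x < S.randomMap η x)
    (hstay : ∀ᵐ x ∂μ, ∀ η ∈ Ioo (-S.a) S.a, ε ≤ x → ε ≤ S.randomMap η x)
    (hpos : ∀ᵐ x ∂μ, 0 < x) (hε : 0 < ε) : ∀ᵐ x ∂μ, ε ≤ x := by
  have H := hμ.stationarySystem
  -- A bounded Lyapunov function: stationarity makes its mean increment zero, while it never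
  -- decreases and strictly increases below `ε`.
  set V : ℝ → ℝ := fun x => max 0 (min x ε) with hV
  have hVb : BddMeasurable V := by
    refine ⟨by fun_prop, ε, fun x => ?_⟩
    rw [abs_of_nonneg (le_max_left _ _)]
    exact max_le hε.le (min_le_right _ _)
  have hi1 : Integrable (fun p : ℝ × ℝ => V (S.randomMap p.1 p.2)) (S.θ.prod μ) :=
    (hVb.comp H.measurable).integrable _
  have hi2 : Integrable (fun p : ℝ × ℝ => V p.2) (S.θ.prod μ) :=
    (hVb.comp measurable_snd).integrable _
  have hint : ∫ p, (V (S.randomMap p.1 p.2) - V p.2) ∂(S.θ.prod μ) = 0 := by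
    rw [integral_sub hi1 hi2, sub_eq_zero]
    have h1 : ∫ p : ℝ × ℝ, V p.2 ∂(S.θ.prod μ) = ∫ x, V x ∂μ := by
      rw [integral_fun_snd]; simp
    rw [h1]
    conv_rhs => rw [← H.map_eq]
    rw [integral_map H.measurable.aemeasurable hVb.measurable.aestronglyMeasurable]
  have hfst : ∀ᵐ p ∂(S.θ.prod μ), p.1 ∈ Ioo (-S.a) S.a :=
    Measure.quasiMeasurePreserving_fst.ae S.ae_mem_noise
  have hall : ∀ᵐ p ∂(S.θ.prod μ), V p.2 ≤ V (S.randomMap p.1 p.2) ∧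
      (p.2 < ε → V p.2 < V (S.randomMap p.1 p.2)) := by
    filter_upwards [hfst, Measure.quasiMeasurePreserving_snd.ae hpush,
      Measure.quasiMeasurePreserving_snd.ae hstay,
      Measure.quasiMeasurePreserving_snd.ae hpos] with p h1 h2 h3 h4
    rcases lt_or_ge p.2 ε with hlt | hge
    · have h5 := h2 _ h1 hlt
      have : V p.2 < V (S.randomMap p.1 p.2) := by
        simp only [hV]
        rw [min_eq_left hlt.le, max_eq_right h4.le]
        exact lt_max_of_lt_right (lt_min h5 hlt)
      exact ⟨this.le, fun _ => this⟩
    · refine ⟨?_, fun hlt => absurd hlt (not_lt.2 hge)⟩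
      simp only [hV]
      rw [min_eq_right hge, min_eq_right (h3 _ h1 hge)]
  have hzero := (integral_eq_zero_iff_of_nonneg_ae
    (hall.mono fun p hp => sub_nonneg.2 hp.1) (hi1.sub hi2)).1 hint
  have hfin : ∀ᵐ p ∂(S.θ.prod μ), ε ≤ p.2 := by
    filter_upwards [hall, hzero] with p h1 h2
    by_contra hcon
    have := h1.2 (not_le.1 hcon)
    have h3 : V (S.randomMap p.1 p.2) - V p.2 = 0 := h2
    linarith
  have hmp : (S.θ.prod μ).map Prod.snd = μ := by
    rw [Measure.map_snd_prod]; simp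
  rw [← hmp, ae_map_iff measurable_snd.aemeasurable measurableSet_Ici]
  exact hfin

/-- The stationary measure lives on a compact subinterval of `(0, 1)` invariant under all noises. -/
theorem IsStationary.exists_interval [IsProbabilityMeasure μ] (hμ : S.IsStationary μ) (hh : S.HasBVDensity μ h) :
    ∃ b e : ℝ, 0 < b ∧ b ≤ e ∧ e < 1 ∧
      (∀ x ∈ Icc b e, b ≤ S.T x - S.a * S.σ x ∧ S.T x + S.a * S.σ x ≤ e) ∧
        ∀ᵐ x ∂μ, x ∈ Icc b e := by
  have hΓ := S.gap_pos
  have hΓ1 := S.gap_le_one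
  set Γ := gap S.T S.c with hΓdef
  have hsp : ∀ b : ℝ, 0 < b → ∀ x ∈ Icc b (1 - Γ / 2), x ∈ S.space := fun b hb x hx =>
    ⟨by linarith [hx.1], by linarith [hx.2]⟩
  rcases S.noise_assumption.cases with ⟨hT0, -, -, ε, hε, hlow, hhigh⟩ | ⟨hT0, hnoise⟩
  -- Otherwise the point $1-3\Gamma/4$ would have to be pushed up, although $T\le1-\Gamma$.
  · have hεe : ε < 1 - Γ / 2 := by
      by_contra hcon
      have hx : 1 - 3 * Γ / 4 ∈ Ioo 0 ε := ⟨by linarith, by linarith⟩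
      have hxs : 1 - 3 * Γ / 4 ∈ S.space := ⟨by linarith, by linarith⟩
      have h1 := hlow _ hx
      have h2 := S.map_le_of_mem hxs
      have h3 := mul_nonneg S.a_pos.le (S.noise_assumption.nonneg _ hxs)
      linarith
    have hle : ∀ x ∈ Icc ε (1 - Γ / 2), ε ≤ S.T x - S.a * S.σ x := by
      intro x hx
      have hc := continuousOn_lower (S := S) (b := ε) (e := 1 - Γ / 2) hε (by linarith)
      rw [← closure_Ioo hεe.ne] at hc hx
      exact le_on_closure (fun y hy => (hhigh y hy).le) continuousOn_const hc hx
    refine ⟨ε, 1 - Γ / 2, hε, hεe.le, by linarith, fun x hx => ⟨hle x hx, S.upper_le (hsp ε hε x hx)⟩,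
      ?_⟩
    have hpos := hμ.ae_pos hh hT0
    have hge := hμ.ae_ge_of_pushed (ε := ε) ?_ ?_ hpos hε
    · filter_upwards [hge, hμ.ae_le hh] with x h1 h2 using ⟨h1, h2⟩
    · filter_upwards [hpos, hh.ae_mem_space] with x h1 h2 η hη hlt
      exact (hlow x ⟨h1, hlt⟩).trans_le (S.randomMap_mem h2 hη).1
    · filter_upwards [hμ.ae_le hh, hh.ae_mem_space] with x h1 h2 η hη hge
      exact (hle x ⟨hge, h1⟩).trans (S.randomMap_mem h2 hη).1
  · have hT0c : ContinuousWithinAt S.T (Icc 0 1) 0 :=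
      S.map_assumption.continuousOn 0 ⟨le_rfl, zero_le_one⟩
    obtain ⟨δ, hδ, hδT⟩ := Metric.continuousWithinAt_iff.1 hT0c (S.T 0 / 4) (by linarith)
    set δ' := min (δ / 2) (1 - Γ / 2) with hδ'
    have hδ'0 : 0 < δ' := lt_min (by linarith) (by linarith)
    obtain ⟨y, hy, hmin⟩ := (isCompact_Icc (a := δ') (b := 1 - Γ / 2)).exists_isMinOn
      ⟨δ', le_rfl, min_le_right _ _⟩ (continuousOn_lower (S := S) hδ'0 (by linarith))
    have hypos := S.noise_assumption.lower_pos y ⟨hδ'0.trans_le hy.1, hy.2⟩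
    -- Three terms: the minimum of $T-a\sigma$ away from $0$, the value $q/4$, which bounds it from
    -- below near and left of $0$, and $1-\Gamma/2$ to ensure $b\le e$.
    set b := min (S.T y - S.a * S.σ y) (min (S.T 0 / 4) (1 - Γ / 2)) with hb
    have hb0 : 0 < b := lt_min hypos (lt_min (by linarith) (by linarith))
    have hbq : b ≤ S.T 0 / 4 := (min_le_right _ _).trans (min_le_left _ _)
    have hle : ∀ x ∈ S.space, x ≤ 1 - Γ / 2 → b ≤ S.T x - S.a * S.σ x := by
      intro x hx hxe
      have hn : S.a * S.σ x ≤ S.T 0 / 2 :=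
        (hnoise x hx).trans ((min_le_right _ _).trans (min_le_left _ _))
      rcases le_or_gt x 0 with h0 | h0
      · have := S.le_map_of_nonpos hx h0
        linarith
      · rcases le_or_gt δ' x with h1 | h1
        · exact (min_le_left _ _).trans (hmin ⟨h1, hxe⟩)
        · have h2 : dist x 0 < δ := by
            rw [Real.dist_eq, sub_zero, abs_of_pos h0]
            linarith [h1.trans_le (min_le_left (δ / 2) (1 - Γ / 2))]
          have h3 := hδT ⟨h0.le, hx.2⟩ h2
          rw [Real.dist_eq, abs_lt] at h3
          linarith [h3.1]
    refine ⟨b, 1 - Γ / 2, hb0, (min_le_right _ _).trans (min_le_right _ _), by linarith,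
      fun x hx => ⟨hle x (hsp b hb0 x hx) hx.2, S.upper_le (hsp b hb0 x hx)⟩, ?_⟩
    refine hμ.ae_of_step measurableSet_Icc ?_
    filter_upwards [hh.ae_mem_space, hμ.ae_le hh] with x h1 h2 η hη
    have h3 := S.randomMap_mem h1 hη
    exact ⟨(hle x h1 h2).trans h3.1, h3.2.trans (S.upper_le h1)⟩

end RandomSystem

/-! ### Functions of bounded variation -/

/-- A function of bounded variation has a bounded measurable version. -/
lemma MemBV.exists_bddMeasurable {g : ℝ → ℝ} {s : Set ℝ} (hg : MemBV g s) (hs : MeasurableSet s) :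
    ∃ f : ℝ → ℝ, BddMeasurable f ∧ f =ᵐ[volume.restrict s] g := by
  rcases s.eq_empty_or_nonempty with rfl | ⟨x₀, hx₀⟩
  · exact ⟨fun _ => 0, BddMeasurable.const 0, by simp [Filter.EventuallyEq]⟩
  obtain ⟨u, hug, hu⟩ : ∃ u : ℝ → ℝ, u =ᵐ[volume.restrict s] g ∧ eVariationOn u s < ⊤ := by
    have := hg.variation_ne_top.lt_top
    simpa only [essVariationOn, iInf_lt_iff, exists_prop] using this
  have hm := hg.integrableOn.aestronglyMeasurable
  -- A function of finite pointwise variation is bounded by its value at a base point plus the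
  -- variation. Truncating a measurable version of `g` at this level changes it only on a null set.
  set B := |u x₀| + (eVariationOn u s).toReal with hB
  have hB0 : 0 ≤ B := by positivity
  have hbd : ∀ x ∈ s, |u x| ≤ B := by
    intro x hx
    have h1 := eVariationOn.edist_le u hx hx₀
    rw [edist_dist, ENNReal.ofReal_le_iff_le_toReal hu.ne, Real.dist_eq] at h1
    have h2 := abs_add_le (u x - u x₀) (u x₀)
    rw [sub_add_cancel] at h2
    linarith
  refine ⟨fun x => max (-B) (min (hm.mk g x) B), ⟨?_, B, fun x => ?_⟩, ?_⟩
  · exact measurable_const.max (hm.stronglyMeasurable_mk.measurable.min measurable_const)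
  · exact abs_le.2 ⟨le_max_left _ _, max_le (by linarith) (min_le_right _ _)⟩
  · filter_upwards [hm.ae_eq_mk, hug, ae_restrict_mem hs] with x h1 h2 h3
    have h4 := abs_le.1 (hbd x h3)
    rw [h2] at h4
    rw [← h1, min_eq_left h4.2, max_eq_right h4.1]

lemma integral_le_bvNorm (f : ℝ → ℝ) (s : Set ℝ) : ∫ x in s, |f x| ≤ bvNorm f s :=
  le_add_of_nonneg_left ENNReal.toReal_nonneg

lemma gaussianReal_real_Iic {ι : ℝ} (hι : 0 < ι) (r : ℝ) :
    (gaussianReal 0 (Real.toNNReal (ι ^ 2))).real (Iic r) =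
      1 / (ι * √(2 * Real.pi)) * ∫ u in Iic r, Real.exp (-u ^ 2 / (2 * ι ^ 2)) := by
  have hv : Real.toNNReal (ι ^ 2) ≠ 0 := by
    rw [Ne, Real.toNNReal_eq_zero, not_le]; positivity
  rw [measureReal_def, gaussianReal_apply_eq_integral 0 hv, ENNReal.toReal_ofReal
    (integral_nonneg fun x => gaussianPDFReal_nonneg _ _ _)]
  simp only [gaussianPDFReal_def, sub_zero]
  rw [integral_const_mul, Real.coe_toNNReal _ (sq_nonneg ι), one_div,
    Real.sqrt_mul (by positivity), Real.sqrt_sq hι.le, mul_comm ι]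

lemma EqOn.iterate_of_mapsTo {α : Type*} {f g : α → α} {s : Set α} (h : EqOn f g s)
    (hs : MapsTo f s s) (n : ℕ) : EqOn f^[n] g^[n] s := by
  induction n with
  | zero => exact fun _ _ => rfl
  | succ n ih =>
    intro x hx
    rw [Function.iterate_succ_apply, Function.iterate_succ_apply, ih (hs hx), h hx]

/-! ### The clamped system -/

namespace RandomSystem

variable {S : RandomSystem} {b e : ℝ}

/-- The random map with its argument clamped to an invariant interval. -/
def clampedMap (S : RandomSystem) (hbe : b ≤ e) (η x : ℝ) : ℝ :=
  S.T (projIcc b e hbe x) + S.σ (projIcc b e hbe x) * η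

lemma clampedMap_of_mem (hbe : b ≤ e) (η : ℝ) {x : ℝ} (hx : x ∈ Icc b e) :
    S.clampedMap hbe η x = S.randomMap η x := by
  rw [clampedMap, projIcc_of_mem hbe hx, randomMap]

/-- All noises map the compact interval `[b, e] ⊆ (0, 1)` into itself. -/
structure InvariantInterval (S : RandomSystem) (b e : ℝ) : Prop where
  left_pos : 0 < b
  le : b ≤ e
  right_lt : e < 1
  invariant : ∀ x ∈ Icc b e, b ≤ S.T x - S.a * S.σ x ∧ S.T x + S.a * S.σ x ≤ e

namespace InvariantInterval

lemma subset_Ioo (I : S.InvariantInterval b e) : Icc b e ⊆ Ioo 0 1 :=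
  Icc_subset_Ioo I.left_pos I.right_lt

lemma subset_space (I : S.InvariantInterval b e) : Icc b e ⊆ S.space := fun x hx =>
  ⟨by linarith [hx.1, I.left_pos, S.gap_pos], hx.2.trans I.right_lt.le⟩

lemma continuousOn_map (I : S.InvariantInterval b e) : ContinuousOn S.T (Icc b e) :=
  S.map_assumption.continuousOn.mono (I.subset_Ioo.trans Ioo_subset_Icc_self)

lemma continuousOn_noise (I : S.InvariantInterval b e) : ContinuousOn S.σ (Icc b e) :=
  S.noise_assumption.differentiableOn.continuousOn.mono I.subset_Ioo

lemma continuous_map_proj (I : S.InvariantInterval b e) :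
    Continuous fun x => S.T (projIcc b e I.le x) :=
  I.continuousOn_map.comp_continuous (continuous_subtype_val.comp continuous_projIcc)
    fun x => (projIcc b e I.le x).2

lemma continuous_noise_proj (I : S.InvariantInterval b e) :
    Continuous fun x => S.σ (projIcc b e I.le x) :=
  I.continuousOn_noise.comp_continuous (continuous_subtype_val.comp continuous_projIcc)
    fun x => (projIcc b e I.le x).2

lemma measurable_clampedMap (I : S.InvariantInterval b e) :
    Measurable fun p : ℝ × ℝ => S.clampedMap I.le p.1 p.2 := by
  have h1 := I.continuous_map_proj.measurable
  have h2 := I.continuous_noise_proj.measurable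
  exact (h1.comp measurable_snd).add ((h2.comp measurable_snd).mul measurable_fst)

lemma randomMap_mem (I : S.InvariantInterval b e) {x η : ℝ} (hx : x ∈ Icc b e)
    (hη : η ∈ Ioo (-S.a) S.a) :
    S.randomMap η x ∈ Icc b e := by
  have h1 := S.randomMap_mem (I.subset_space hx) hη
  have h2 := I.invariant x hx
  exact ⟨h2.1.trans h1.1, h1.2.trans h2.2⟩

/-- Clamping changes nothing `μ`-almost everywhere. It makes the map continuous on the whole line
and lets the minorization hold from every starting point. -/
lemma stationarySystem (I : S.InvariantInterval b e) {μ : Measure ℝ} [IsProbabilityMeasure μ]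
    (hμ : S.IsStationary μ)
    (hI : ∀ᵐ x ∂μ, x ∈ Icc b e) : StationarySystem (S.clampedMap I.le) S.θ μ := by
  refine ⟨I.measurable_clampedMap, ?_⟩
  have H := hμ.stationarySystem
  conv_rhs => rw [← H.map_eq]
  refine Measure.map_congr ?_
  filter_upwards [Measure.quasiMeasurePreserving_snd.ae hI] with p hp
  exact clampedMap_of_mem I.le p.1 hp

lemma exists_minorization (I : S.InvariantInterval b e) :
    ∃ N > 0, ∃ ν : Measure ℝ, ν ≠ 0 ∧ ∀ x, ν ≤ orbitLaw (S.clampedMap I.le) S.θ N x := by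
  have M := S.map_assumption
  have ha := S.a_pos
  obtain ⟨y, hy, hmin⟩ := isCompact_Icc.exists_isMinOn ⟨b, left_mem_Icc.2 I.le⟩ I.continuousOn_noise
  obtain ⟨z, hz, hmax⟩ := isCompact_Icc.exists_isMaxOn ⟨b, left_mem_Icc.2 I.le⟩ I.continuousOn_noise
  have hs : 0 < S.σ y := S.noise_assumption.pos y (I.subset_Ioo hy)
  have hK : ∀ x ∈ Icc b e, Ioo (S.T x - S.a * S.σ x) (S.T x + S.a * S.σ x) ⊆ Icc b e :=
    fun x hx w hw => ⟨(I.invariant x hx).1.trans hw.1.le, hw.2.le.trans (I.invariant x hx).2⟩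
  have hmaps : MapsTo S.T (Icc b e) (Icc b e) := by
    intro x hx
    have := mul_pos ha (hs.trans_le (hmin hx))
    exact hK x hx ⟨by linarith, by linarith⟩
  have htr := M.core_transitive 1 le_rfl
  rw [Function.iterate_one] at htr
  have hattr := ae_restrict_of_ae_restrict_of_subset
    (I.subset_Ioo.trans Ioo_subset_Icc_self) M.core_attracting
  -- Because the core lies in $[b,e]$, where clamping is invisible, its invariance and transitivity
  -- pass to the clamped map.
  have hcore := attractor_subset ha hs (fun x hx => hmin hx) I.le hK M.d_lt htr hattr
  set T' : ℝ → ℝ := fun x => S.T (projIcc b e I.le x) with hT'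
  have heq : EqOn S.T T' (Icc b e) := fun x hx => by simp only [hT', projIcc_of_mem I.le hx]
  have hit := EqOn.iterate_of_mapsTo heq hmaps
  obtain ⟨m, hm, hdens⟩ := S.exists_noise_minorization
  refine exists_minorization_affine (T := T') (σ := fun x => S.σ (projIcc b e I.le x))
    (s₁ := S.σ z) I.continuous_map_proj I.continuous_noise_proj ha hs
    (fun x => hmin (projIcc b e I.le x).2) (fun x => hmax (projIcc b e I.le x).2)
    (fun x => hK _ (projIcc b e I.le x).2) M.d_lt (M.core_invariant.congr (heq.mono hcore)) ?_ ?_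
    S.ae_mem_noise hm hdens S.noise_nhds_ne_zero
  · intro U V hU hV hUs hVs
    obtain ⟨k, x, hx, hkx⟩ := htr U V hU hV hUs hVs
    exact ⟨k, x, hx, by rwa [← hit k (hcore hx.2)]⟩
  · filter_upwards [hattr, ae_restrict_mem measurableSet_Icc] with x h1 h2
    exact h1.congr fun t => by rw [hit t h2]

lemma orbit_eq (I : S.InvariantInterval b e) {ω : ℕ → ℝ} (hω : ∀ k, ω k ∈ Ioo (-S.a) S.a) {x : ℝ}
    (hx : x ∈ Icc b e) (k : ℕ) :
    S.orbit ω x k ∈ Icc b e ∧ S.orbit ω x k = randomOrbit (S.clampedMap I.le) ω x k := by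
  induction k with
  | zero => exact ⟨hx, rfl⟩
  | succ k ih =>
    refine ⟨I.randomMap_mem ih.1 (hω k), ?_⟩
    rw [orbit, randomOrbit, ← ih.2, clampedMap_of_mem I.le _ ih.1]

/-- Every point of the stationary orbit has law `μ`, so changing the observable on a `μ`-null set
alters no Birkhoff sum beyond a null event. -/
lemma birkhoff_ae_eq (I : S.InvariantInterval b e) {μ : Measure ℝ} [IsProbabilityMeasure μ]
    (hμ : S.IsStationary μ)
    (hI : ∀ᵐ x ∂μ, x ∈ Icc b e) {f g : ℝ → ℝ} (hfg : f =ᵐ[μ] g) (t : ℕ) :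
    randomSum (S.clampedMap I.le) f t =ᵐ[S.pathMeasure μ] S.birkhoff g t := by
  have H := I.stationarySystem hμ hI
  have h1 : ∀ᵐ p ∂(S.pathMeasure μ), ∀ k, p.1 k ∈ Ioo (-S.a) S.a := by
    refine Measure.quasiMeasurePreserving_fst.ae (p := fun ω : ℕ → ℝ => ∀ k, ω k ∈ Ioo (-S.a) S.a)
      (ae_all_iff.2 fun k => ?_)
    exact (measurePreserving_eval_infinitePi (fun _ : ℕ => S.θ) k).quasiMeasurePreserving.ae
      S.ae_mem_noise
  have h2 : ∀ᵐ p ∂(S.pathMeasure μ), p.2 ∈ Icc b e := Measure.quasiMeasurePreserving_snd.ae hI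
  have h3 : ∀ᵐ p ∂(S.pathMeasure μ), ∀ k,
      f (randomOrbit (S.clampedMap I.le) p.1 p.2 k) =
        g (randomOrbit (S.clampedMap I.le) p.1 p.2 k) :=
    ae_all_iff.2 fun k => (H.measurePreserving_randomOrbit k).quasiMeasurePreserving.ae hfg
  filter_upwards [h1, h2, h3] with p hp1 hp2 hp3
  simp only [randomSum, birkhoff]
  exact Finset.sum_congr rfl fun k _ => by rw [hp3, (I.orbit_eq hp1 hp2 k).2]

/-- As $\sigma(x)>0$ and the noise has a density, the one-step law from every $x$ in the interval is
absolutely continuous. -/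
lemma ae_randomMap (I : S.InvariantInterval b e) {x : ℝ} (hx : x ∈ Icc b e) {p : ℝ → Prop}
    (hp : ∀ᵐ y ∂(volume.restrict S.space), p y) : ∀ᵐ η ∂S.θ, p (S.randomMap η x) := by
  have hσ := S.noise_assumption.pos x (I.subset_Ioo hx)
  rw [ae_restrict_iff' (show MeasurableSet S.space from measurableSet_Icc)] at hp
  have h1 : ∀ᵐ η : ℝ, S.randomMap η x ∈ S.space → p (S.randomMap η x) := by
    rw [ae_iff] at hp ⊢
    have : {η : ℝ | ¬ (S.randomMap η x ∈ S.space → p (S.randomMap η x))} =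
        (fun η => S.σ x * η) ⁻¹' ((fun y => S.T x + y) ⁻¹' {y | ¬ (y ∈ S.space → p y)}) := rfl
    rw [this, Real.volume_preimage_mul_left hσ.ne', measure_preimage_add]
    exact mul_eq_zero_of_right _ hp
  filter_upwards [S.noise_absolutelyContinuous.ae_le h1, S.ae_mem_noise] with η h2 h3
  exact h2 (I.subset_space (I.randomMap_mem hx h3))

/-- One averaging step already forgets null sets, so from the first power on the two iterates agree
at every point of $[b,e]$; at power zero they agree only almost everywhere. -/
lemma adjointOp_iterate_eq (I : S.InvariantInterval b e) {f g : ℝ → ℝ}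
    (hfg : f =ᵐ[volume.restrict S.space] g) (t : ℕ) {x : ℝ}
    (hx : x ∈ Icc b e) :
    (averageOp (S.clampedMap I.le) S.θ)^[t + 1] f x = S.adjointOp^[t + 1] g x := by
  induction t generalizing x with
  | zero =>
    have hae : ∀ᵐ η ∂S.θ, f (S.clampedMap I.le η x) = g (S.randomMap η x) := by
      filter_upwards [I.ae_randomMap (p := fun y => f y = g y) hx hfg] with η hη
      rw [clampedMap_of_mem I.le η hx, hη]
    rw [zero_add, Function.iterate_one, Function.iterate_one]
    exact integral_congr_ae hae
  | succ t ih =>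
    have hae : ∀ᵐ η ∂S.θ, (averageOp (S.clampedMap I.le) S.θ)^[t + 1] f (S.clampedMap I.le η x) =
        S.adjointOp^[t + 1] g (S.randomMap η x) := by
      filter_upwards [S.ae_mem_noise] with η hη
      rw [clampedMap_of_mem I.le η hx, ih (I.randomMap_mem hx hη)]
    rw [Function.iterate_succ_apply' _ (t + 1), Function.iterate_succ_apply' _ (t + 1)]
    exact integral_congr_ae hae

end InvariantInterval

/-- The density integrates to one, so this norm may be inserted into the Berry–Esseen bound at no
cost. -/
lemma HasBVDensity.one_le_bvNorm {μ : Measure ℝ} [IsProbabilityMeasure μ] {h : ℝ → ℝ}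
    (hh : S.HasBVDensity μ h) : 1 ≤ bvNorm h S.space := by
  refine le_trans (le_of_eq ?_) (integral_le_bvNorm h S.space)
  have h1 : μ univ = 1 := measure_univ
  rw [hh.eq_withDensity, withDensity_apply _ MeasurableSet.univ, Measure.restrict_univ,
    ← ofReal_integral_eq_lintegral_ofReal hh.memBV.integrableOn
      (Eventually.of_forall hh.nonneg), ENNReal.ofReal_eq_one] at h1
  rw [← h1]
  exact integral_congr_ae (Eventually.of_forall fun x => (abs_of_nonneg (hh.nonneg x)).symm)

end RandomSystem

end

/-! ### Transfer from the clamped system to the original one -/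

theorem mainTheorem5 (S : RandomSystem)
    (μ : MeasureTheory.Measure ℝ) [MeasureTheory.IsProbabilityMeasure μ]
    (hμ : S.IsStationary μ) (h : ℝ → ℝ) (hh : S.HasBVDensity μ h)
    (g : ℝ → ℝ) (hg : MemBV g S.space) (hg0 : ∫ x, g x ∂μ = 0) :
    ∃ ι : ℝ, 0 ≤ ι ∧
      -- asymptotic variance and Green–Kubo formula
      (∀ t : ℕ, Integrable (fun p => S.birkhoff g t p ^ 2) (S.pathMeasure μ)) ∧
      (∀ t : ℕ, Integrable (fun x => g x * (S.adjointOp)^[t] g x) μ) ∧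
      Tendsto (fun t : ℕ => (1 / (t : ℝ)) * ∫ p, S.birkhoff g t p ^ 2 ∂(S.pathMeasure μ))
        atTop (𝓝 (ι ^ 2)) ∧
      Summable (fun t : ℕ => ∫ x, g x * (S.adjointOp)^[t + 1] g x ∂μ) ∧
      ι ^ 2 = ∫ x, g x ^ 2 ∂μ + 2 * ∑' t : ℕ, ∫ x, g x * (S.adjointOp)^[t + 1] g x ∂μ ∧
      (0 < ι →
        -- central limit theorem
        TendstoInDistribution (fun (t : ℕ) p => S.birkhoff g t p / √(t : ℝ)) atTop
          (id : ℝ → ℝ) (fun _ => S.pathMeasure μ) (gaussianReal 0 (Real.toNNReal (ι ^ 2))) ∧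
        -- large deviation principle
        (∃ R : ℝ → ℝ, (∀ x, 0 ≤ R x) ∧ Continuous R ∧ StrictConvexOn ℝ univ R ∧
          (∀ x, R x = 0 ↔ x = 0) ∧
          ∃ ε₀ : ℝ, 0 < ε₀ ∧ ∀ ε : ℝ, 0 < ε → ε < ε₀ →
            Tendsto (fun t : ℕ => (1 / (t : ℝ)) *
                Real.log ((S.pathMeasure μ).real {p | (t : ℝ) * ε < S.birkhoff g t p}))
              atTop (𝓝 (-R ε))) ∧
        -- Berry–Esseen inequality
        (∃ D : ℝ, 0 < D ∧ ∀ t : ℕ, 1 ≤ t → ∀ r : ℝ,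
          |(S.pathMeasure μ).real {p | S.birkhoff g t p / √(t : ℝ) ≤ r} -
              1 / (ι * √(2 * Real.pi)) * ∫ u in Iic r, Real.exp (-u ^ 2 / (2 * ι ^ 2))|
            ≤ D * bvNorm h S.space / √(t : ℝ))) := by

  obtain ⟨b, e, hb, hbe, he, hinv, hI⟩ := hμ.exists_interval hh
  have I : S.InvariantInterval b e := ⟨hb, hbe, he, hinv⟩
  have H := I.stationarySystem hμ hI
  obtain ⟨N, hN, ν, hν0, hν⟩ := I.exists_minorization
  obtain ⟨C, ρ, hgap⟩ := H.exists_spectralGap hN hν0 hν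
  obtain ⟨f, hf, hfg⟩ := hg.exists_bddMeasurable measurableSet_Icc
  have hfμ : f =ᵐ[μ] g := hh.absolutelyContinuous.ae_le hfg
  have hf0 : ∫ x, f x ∂μ = 0 := by rw [integral_congr_ae hfμ, hg0]
  have hcorr : ∀ t : ℕ, (fun x => f x * (averageOp (S.clampedMap I.le) S.θ)^[t] f x) =ᵐ[μ]
      fun x => g x * S.adjointOp^[t] g x := by
    intro t
    cases t with
    | zero => filter_upwards [hfμ] with x hx using by simp [hx]
    | succ t =>
      filter_upwards [hfμ, hI] with x h1 h2
      rw [h1, I.adjointOp_iterate_eq hfg t h2]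
  have hsum := I.birkhoff_ae_eq hμ hI hfμ
  have hsq : ∀ t : ℕ, (fun p => randomSum (S.clampedMap I.le) f t p ^ 2) =ᵐ[S.pathMeasure μ]
      fun p => S.birkhoff g t p ^ 2 := fun t => (hsum t).fun_comp (fun u => u ^ 2)
  have hs := H.summable_correlations hgap hf hf0
  have hvar := H.tendsto_variance hf hs
  set v := ∫ x, f x ^ 2 ∂μ +
    2 * ∑' t : ℕ, ∫ x, f x * (averageOp (S.clampedMap I.le) S.θ)^[t + 1] f x ∂μ with hv
  -- The Green–Kubo value is a limit of normalized second moments, so it has a real square root,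
  -- which serves as `ι`.
  have hv0 : 0 ≤ v := ge_of_tendsto' hvar fun t =>
    mul_nonneg (by positivity) (integral_nonneg fun p => sq_nonneg _)
  obtain ⟨ℓ, δ, K, Q⟩ := H.exists_quasiPower hgap hf hf0
  refine ⟨√v, Real.sqrt_nonneg v, fun t => ?_, fun t => ?_, ?_, ?_, ?_, fun hpos => ?_⟩
  · exact ((StationarySystem.bddMeasurable_randomSum H.measurable hf t).pow_two.integrable
      (S.pathMeasure μ)).congr (hsq t)
  · exact ((hf.mul (StationarySystem.bddMeasurable_averageOp_iterate H.measurable hf t)).integrable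
      μ).congr (hcorr t)
  · rw [Real.sq_sqrt hv0]
    exact hvar.congr fun t => by rw [← integral_congr_ae (hsq t)]; rfl
  · exact hs.congr fun t => integral_congr_ae (hcorr (t + 1))
  · have hfg2 : ∫ x, f x ^ 2 ∂μ = ∫ x, g x ^ 2 ∂μ :=
      integral_congr_ae (hfμ.fun_comp (fun u => u ^ 2))
    rw [Real.sq_sqrt hv0, hv, hfg2]
    congr 2
    exact tsum_congr fun t => integral_congr_ae (hcorr (t + 1))
  · have hvpos : 0 < v := Real.sqrt_pos.1 hpos
    have hℓ := Q.deriv_deriv_zero hvar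
    refine ⟨?_, ?_, ?_⟩
    · rw [Real.sq_sqrt hv0]
      exact (Q.tendstoInDistribution hvpos hℓ).congr
        (fun t => (hsum t).fun_comp (fun u => u / √(t : ℝ))) EventuallyEq.rfl
    · obtain ⟨R, h1, h2, h3, h4, ε₀, hε₀, h5⟩ := Q.large_deviations hvpos hℓ
      refine ⟨R, h1, h2, h3, h4, ε₀, hε₀, fun ε hε hεlt => (h5 ε hε hεlt).congr fun t => ?_⟩
      congr 2
      refine measureReal_congr ?_
      filter_upwards [hsum t] with p hp
      exact congrArg (fun u => (t : ℝ) * ε < u) hp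
    · obtain ⟨D, hD, hBE⟩ := Q.berry_esseen hvpos hℓ
      refine ⟨D, hD, fun t ht r => ?_⟩
      have h1 : (S.pathMeasure μ).real {p | S.birkhoff g t p / √(t : ℝ) ≤ r} =
          (S.pathMeasure μ).real {p | randomSum (S.clampedMap I.le) f t p / √(t : ℝ) ≤ r} := by
        refine measureReal_congr ?_
        filter_upwards [hsum t] with p hp
        exact congrArg (fun u => u / √(t : ℝ) ≤ r) hp.symm
      rw [h1, ← gaussianReal_real_Iic hpos, Real.sq_sqrt hv0]
      refine (hBE t ht r).trans ?_
      gcongr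
      exact le_mul_of_one_le_right hD.le hh.one_le_bvNorm
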